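/- **Lemma (Block Consensus).** Consider one round of the block-commit protocol below, for block number $N$. There are $M\ge 2000$ citizens, of which at most $M/4$ are corrupt, and $S$ politicians, of which at most $4S/5$ are corrupt; the corrupt parties are fixed before the randomness of the round and are controlled by an arbitrary (computationally unbounded, full-information, rushing) adversary. The committed blocks $\mathcal B_1,\dots,\mathcal B_{N-1}$ form a correct ledger (each block contains the hash of the previous one, and all transactions are valid in order) whose final global state has the Merkle root $\mathsf{GSRoot}_{N-1}$; committee members hold $\mathsf{Hash}(\mathcal B_{N-1})$ and $\mathsf{GSRoot}_{N-1}$. Signatures and VRFs are ideal (no forgeries; VRF values unique, independent and uniform). *Protocol.* Each citizen is in the committee $V$ independently with probability $2000/M$, and draws a uniformly random ordered sample of $25$ politicians, with which it communicates; messages that reach one honest politician reach all of them. A committee member is *good* if it is honest and its sample contains an honest politician. 1. Each member downloads transaction pools from $45$ designated politicians and uploads a signed list of the hashes it got (witness list). 2. Each member re-uploads $5$ random pools it holds to a random politician. Proposers (members selected by a VRF) propose, for the designated politicians, signed pool hashes that occur in at least $1122$ witness lists. 3. Each member takes the proposal with the least VRF, tries to download the missing pools, and enters byzantine agreement with this proposal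 if it holds all its pools, and with NULL otherwise. It then re-uploads $10$ random pools it holds to a random politician. Byzantine agreement is graded consensus followed by the binary agreement with a common coin (phases of three steps: coin fixed to $0$, coin fixed to $1$, coin equal to the last bit of the least VRF), run for at most $R$ phases. 4. If the output is NULL, a member signs the hash of the empty block (containing $\mathsf{Hash}(\mathcal B_{N-1})$), together with $\mathsf{GSRoot}_{N-1}$ and $N$. If the output is a proposal, it downloads the missing pools and reads the values of the $k$ keys referenced in them as follows: it takes all values from one politician of its sample, spot-checks the challenge paths of $\lceil 0.015k\rceil$ random keys against $\mathsf{GSRoot}_{N-1}$ (on failure it discards the politician and starts again with the next one), and then corrects at most $500$ values by exception lists (of at most $500$ out of $2000$ buckets) of the sampled politicians, each correction being verified by a challenge path. It drops the invalid transactions and forms a block from the others and $\mathsf{Hash}(\mathcal B_{N-1})$. It obtains the root of the new Merkle tree (depth $30$) in the same way, from the $2^{13}$ nodes of the frontier level, with $72$ random spot-checks and at most $800$ corrections, and signs (block hash, new root, $N$). *Claim.* There is an absolute constant $R_0$ such that for all $R\ge R_0$, all $M$, $S$, all transaction semantics, ledgers, hash functions and adversaries as above, the following holds except with negligible probability, that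 is, except with probability at most $2^{-30}$, unless the hash evaluations by which good citizens and honest politicians check pools and state values in the round exhibit a collision of the hash function: there is a block $\mathcal B$ such that (i) at the end of the protocol all good citizens except at most $36$ sign the hash of $\mathcal B$ and the same new global-state root $r$ (with block number $N$); and (ii) $\mathcal B_1,\dots,\mathcal B_{N-1},\mathcal B$ is a correct ledger, and $r$ is the Merkle root of its final global state. More precisely, the probability that neither this conclusion nor a hash collision occurs is at most $2^{-30}$. -/

import Mathlib

/-!
# The block-commit protocol of a two-tier (citizens / politicians) blockchain

One round of the protocol is defined explicitly: committee sortition, safe samples, download and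
re-upload of transaction pools, block proposal, byzantine agreement (graded consensus followed by
binary agreement with a common coin), the sampling-based Merkle tree read and write, and signing.
The adversary is an arbitrary (full-information, rushing, computationally unbounded) strategy that
controls all corrupted citizens and politicians.

Signatures are ideal: a message attributed to an honest party was sent by it. VRFs are ideal:
their values are independent and uniform, and unique. The hash function is arbitrary.
-/

namespace Blockene

noncomputable section

/-! ## Blocks, transactions, hashing -/

/-- A block: the hash of the previous block and a list of transactions. -/
structure Block (Tx D : Type*) where
  prev : D
  txs : List Tx

/-- The kinds of strings that are hashed: transaction pools, leaves of the Merkle tree (the set of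
key-value pairs stored there), internal nodes, buckets of key-value pairs, and blocks. -/
inductive HashInput (K V Tx D : Type*) where
  | pool (p : List Tx)
  | leaf (c : Finset (K × V))
  | node (l r : D)
  | bucket (c : Finset (K × V))
  | block (b : Block Tx D)

/-- Output of a VRF (a 256 bit hash of a unique signature). -/
abbrev Vrf : Type := Fin (2 ^ 256)

/-- The public data of the round: `M` citizens, `S` politicians, `45` designated politicians that
provide the transaction pools, the semantics of transactions, the hash function, the ledger so far
and its global state; and the corrupted parties, fixed before the randomness of the round. -/
structure Config (M S : ℕ) (K V Tx D : Type*) where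
  corruptCitizens : Finset (Fin M)
  corruptPoliticians : Finset (Fin S)
  /-- the politicians that provide the transaction pools of this round -/
  designated : Fin 45 ↪ Fin S
  /-- the pool that an honest politician freezes for this round -/
  frozenPool : Fin S → List Tx
  /-- the keys that a transaction accesses -/
  keysOf : Tx → Finset K
  /-- validation and effect of a transaction, given the values of its keys: `none` if it is invalid
  (bad signature, no access, wrong nonce, overspending, ...), else the new values of its keys -/
  exec : (t : Tx) → ({κ // κ ∈ keysOf t} → V) → Option ({κ // κ ∈ keysOf t} → V)
  /-- the leaf of the Merkle tree (of depth 30) that stores a key -/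
  leafOf : K → Fin (2 ^ 30)
  hash : HashInput K V Tx D → D
  genesisHash : D
  genesisState : K → V
  /-- the committed blocks, oldest first -/
  chain : List (Block Tx D)
  /-- the global state after the committed blocks -/
  state : K → V
  /-- a committee member is a proposer if the last `proposerBits` bits of its proposer VRF are 0 -/
  proposerBits : ℕ

/-! ## Randomness of a round -/

/-- A uniformly random rule that picks `min (f |H|) |H|` elements of any set `H` of candidates. -/
abbrev Pick (α : Type*) (f : ℕ → ℕ) : Type _ :=
  (H : Finset α) → {s : Finset α // s ⊆ H ∧ s.card = min (f H.card) H.card}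

/-- The randomness present at the start of the round. -/
structure Setup (M S : ℕ) where
  /-- committee sortition -/
  sortition : Fin M → Fin M
  /-- the (ordered) safe sample of 25 politicians of a citizen -/
  sample : Fin M → (Fin 25 ↪ Fin S)
  /-- the VRF that decides who proposes and who wins -/
  proposerVrf : Fin M → Vrf

/-- Randomness of a re-upload: which of the held pools, and to which politician. -/
abbrev Reupload (S k : ℕ) : Type := Pick (Fin 45) (fun _ => k) × Fin S

/-- The number `⌈0.015 k⌉` of keys that are spot-checked among `k` keys. -/
def spotCount (k : ℕ) : ℕ := (15 * k + 999) / 1000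

/-- All the randomness of a round in which the byzantine agreement runs for at most `R` phases. -/
structure Tape (R M S : ℕ) (K : Type*) where
  setup : Setup M S
  /-- first re-upload, of 5 pools -/
  upload1 : Fin M → Reupload S 5
  /-- second re-upload, of 10 pools -/
  upload2 : Fin M → Reupload S 10
  /-- the VRFs that form the common coin -/
  coin : Fin R → Fin M → Vrf
  /-- spot-checked keys in the `j`-th attempt to read the global state -/
  readSpot : Fin 25 → Fin M → Pick K spotCount
  /-- spot-checked frontier nodes in the `j`-th attempt to update the global state -/
  writeSpot : Fin 25 → Fin M → {s : Finset (Fin (2 ^ 13)) // s.card = 72}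

/-- Probability of an event under the uniform distribution on tapes: all coordinates are uniform
and independent. -/
def prob {R M S : ℕ} {K : Type*} (E : Tape R M S K → Prop) : ℝ :=
  (Nat.card {ω : Tape R M S K // E ω} : ℝ) / Nat.card (Tape R M S K)

/-! ## The adversary -/

/-- The part of the tape that the adversary has seen at some time. -/
structure View (R M S : ℕ) (K : Type*) where
  setup : Setup M S
  upload1 : Option (Fin M → Reupload S 5)
  upload2 : Option (Fin M → Reupload S 10)
  coin : Fin R → Fin M → Option Vrf
  readSpot : Fin 25 → Option (Fin M → Pick K spotCount)
  writeSpot : Fin 25 → Option (Fin M → {s : Finset (Fin (2 ^ 13)) // s.card = 72})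

/-- A proposal: its proposer and, for each designated politician, possibly the hash of a pool. -/
structure Proposal (M : ℕ) (D : Type*) where
  proposer : Fin M
  ids : Fin 45 → Option D

/-- A value of the byzantine agreement; `none` is the value NULL. -/
abbrev Value (M : ℕ) (D : Type*) : Type _ := Option (Proposal M D)

/-- A challenge path: the content of a leaf and the siblings on the way to the root. -/
structure Path (K V D : Type*) where
  leaf : Finset (K × V)
  sib : ℕ → D

/-- The data that proves the new value of a frontier node: the old contents of the leaves that
change, the digests of the unchanged nodes next to their paths (by height and index), and the
siblings on the way from the frontier node to the root of the old tree. -/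
structure UpdateProof (K V D : Type*) where
  leaf : ℕ → Finset (K × V)
  node : ℕ → ℕ → D
  sib : ℕ → D

/-- A strategy. Each move may depend on everything that has happened so far, that is, on the view.
An argument pair `v j` means: as presented to citizen `v` by citizen `j`;
`v i`, with `i : Fin 25`: as presented to `v` by the `i`-th politician of its sample. -/
structure Adversary (R M S : ℕ) (K V Tx D : Type*) where
  /-- pools handed to `v` by corrupted designated politicians -/
  pool : View R M S K → (v : Fin M) → Fin 45 → Option (List Tx)
  /-- witness lists -/
  witness : View R M S K → (v j : Fin M) → Fin 45 → Option D
  /-- pools that reach the honest politicians, before the two synchronizations on pools -/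
  inject1 : View R M S K → Fin 45 → Set (List Tx)
  inject2 : View R M S K → Fin 45 → Set (List Tx)
  /-- block proposals -/
  proposal : View R M S K → (v j : Fin M) → Option (Fin 45 → Option D)
  /-- missing pools that are offered to `v` -/
  offer1 : View R M S K → (v : Fin M) → Fin 45 → Option (List Tx)
  offer2 : View R M S K → (v : Fin M) → Fin 45 → Option (List Tx)
  /-- messages of the two rounds of graded consensus -/
  vote : View R M S K → (v j : Fin M) → Option (Value M D)
  echo : View R M S K → (v j : Fin M) → Option (Value M D)
  /-- messages in the three steps of phase `r` of the binary agreement -/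
  bit : View R M S K → (r : ℕ) → (step : Fin 3) → (v j : Fin M) → Option Bool
  /-- global state read: values, challenge paths, exception lists, claimed values, their paths -/
  readVal : View R M S K → (v : Fin M) → Fin 25 → K → V
  readPath : View R M S K → (v : Fin M) → Fin 25 → K → Path K V D
  exceptions : View R M S K → (v : Fin M) → Fin 25 → Finset (Fin 2000)
  claimVal : View R M S K → (v : Fin M) → Fin 25 → K → V
  claimPath : View R M S K → (v : Fin M) → Fin 25 → K → Path K V D
  /-- global state update: frontier and proofs in the spot-check, then in the correction -/
  frontier : View R M S K → (v : Fin M) → Fin 25 → ℕ → D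
  spotProof : View R M S K → (v : Fin M) → Fin 25 → ℕ → UpdateProof K V D
  claimFrontier : View R M S K → (v : Fin M) → Fin 25 → ℕ → D
  claimProof : View R M S K → (v : Fin M) → Fin 25 → ℕ → UpdateProof K V D

/-! ## Merkle trees -/

section Merkle

variable {M S : ℕ} {K V Tx D : Type*}

/-- Digests of the nodes of a binary hash tree over the digests `base`, by height and index. -/
def Config.build (C : Config M S K V Tx D) (base : ℕ → D) : ℕ → ℕ → D
  | 0, i => base i
  | h + 1, i => C.hash (.node (C.build base h (2 * i)) (C.build base h (2 * i + 1)))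

open scoped Classical in
/-- The key-value pairs stored in leaf `i`. -/
def Config.leafContent [Fintype K] (C : Config M S K V Tx D) (s : K → V) (i : ℕ) :
    Finset (K × V) :=
  (Finset.univ.filter fun κ => (C.leafOf κ : ℕ) = i).image fun κ => (κ, s κ)

/-- The Merkle tree of a global state: digest of the node of height `h` and index `i`. -/
def Config.tree [Fintype K] (C : Config M S K V Tx D) (s : K → V) (h i : ℕ) : D :=
  C.build (fun i => C.hash (.leaf (C.leafContent s i))) h i

/-- The root of the Merkle tree of a global state. -/
def Config.root [Fintype K] (C : Config M S K V Tx D) (s : K → V) : D := C.tree s 30 0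

/-- The node input hashed when climbing from a node with digest `x` and index `i` at its height:
at each step the sibling is put on the proper side. -/
def nodeInput (i : ℕ) (x y : D) : HashInput K V Tx D :=
  if i % 2 = 0 then .node x y else .node y x

/-- The digest reached from `x` (at index `i`) after `t` steps towards the root. -/
def Config.climb (C : Config M S K V Tx D) (i : ℕ) (x : D) (sib : ℕ → D) : ℕ → D
  | 0 => x
  | t + 1 => C.hash (nodeInput (i / 2 ^ t) (C.climb i x sib t) (sib t))

/-- The index of the sibling. -/
def sibling (i : ℕ) : ℕ := if i % 2 = 0 then i + 1 else i - 1

/-- The siblings in the tree of `s` above the node of height `h` and index `i`. -/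
def Config.truePath [Fintype K] (C : Config M S K V Tx D) (s : K → V) (h i : ℕ) : ℕ → D :=
  fun t => C.tree s (h + t) (sibling (i / 2 ^ t))

/-- The correct challenge path for a key. -/
def Config.honestPath [Fintype K] (C : Config M S K V Tx D) (κ : K) : Path K V D where
  leaf := C.leafContent C.state (C.leafOf κ)
  sib := C.truePath C.state 0 (C.leafOf κ)

/-- Verification of a challenge path for the value `w` of `κ` against the root. -/
def Config.PathOK [Fintype K] (C : Config M S K V Tx D) (κ : K) (w : V) (π : Path K V D) : Prop :=
  (κ, w) ∈ π.leaf ∧ C.climb (C.leafOf κ) (C.hash (.leaf π.leaf)) π.sib 30 = C.root C.state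

/-- The hash inputs of the verification of a challenge path. -/
def Config.pathInputs (C : Config M S K V Tx D) (κ : K) (π : Path K V D) :
    Set (HashInput K V Tx D) :=
  {.leaf π.leaf} ∪ {x | ∃ t < 30, x = nodeInput ((C.leafOf κ : ℕ) / 2 ^ t)
    (C.climb (C.leafOf κ) (C.hash (.leaf π.leaf)) π.sib t) (π.sib t)}

/-- The subtree of the node of height `h` and index `i` contains one of the `keys`. -/
def Config.Touched (C : Config M S K V Tx D) (keys : Finset K) (h i : ℕ) : Prop :=
  ∃ κ ∈ keys, (C.leafOf κ : ℕ) / 2 ^ h = i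

open scoped Classical in
/-- The digest in the old tree that an update proof claims for a node. -/
def Config.oldDigest (C : Config M S K V Tx D) (keys : Finset K) (π : UpdateProof K V D) :
    ℕ → ℕ → D
  | 0, i => if C.Touched keys 0 i then C.hash (.leaf (π.leaf i)) else π.node 0 i
  | h + 1, i =>
    if C.Touched keys (h + 1) i then
      C.hash (.node (C.oldDigest keys π h (2 * i)) (C.oldDigest keys π h (2 * i + 1)))
    else π.node (h + 1) i

open scoped Classical in
/-- The content of leaf `i` after the `keys` got the values `new`. -/
def Config.updateLeaf (C : Config M S K V Tx D) (keys : Finset K) (new : K → V) (i : ℕ)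
    (c : Finset (K × V)) : Finset (K × V) :=
  (c.filter fun e => e.1 ∉ keys) ∪
    (keys.filter fun κ => (C.leafOf κ : ℕ) = i).image fun κ => (κ, new κ)

open scoped Classical in
/-- The digest in the new tree that results from an update proof. -/
def Config.newDigest (C : Config M S K V Tx D) (keys : Finset K) (new : K → V)
    (π : UpdateProof K V D) : ℕ → ℕ → D
  | 0, i =>
    if C.Touched keys 0 i then C.hash (.leaf (C.updateLeaf keys new i (π.leaf i))) else π.node 0 i
  | h + 1, i =>
    if C.Touched keys (h + 1) i then
      C.hash (.node (C.newDigest keys new π h (2 * i)) (C.newDigest keys new π h (2 * i + 1)))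
    else π.node (h + 1) i

/-- Verification of the digest `y` of frontier node `f` in the new tree: the old data are
authenticated by the old root. The frontier is the level with `2 ^ 13` nodes. -/
def Config.UpdateOK [Fintype K] (C : Config M S K V Tx D) (keys : Finset K) (new : K → V) (f : ℕ)
    (y : D) (π : UpdateProof K V D) : Prop :=
  C.climb f (C.oldDigest keys π 17 f) π.sib 13 = C.root C.state ∧ C.newDigest keys new π 17 f = y

open scoped Classical in
/-- The hash inputs below a node in the authentication of the old data of an update proof. -/
def Config.oldInputs (C : Config M S K V Tx D) (keys : Finset K) (π : UpdateProof K V D) :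
    ℕ → ℕ → Set (HashInput K V Tx D)
  | 0, i => if C.Touched keys 0 i then {.leaf (π.leaf i)} else ∅
  | h + 1, i =>
    if C.Touched keys (h + 1) i then
      {.node (C.oldDigest keys π h (2 * i)) (C.oldDigest keys π h (2 * i + 1))} ∪
        C.oldInputs keys π h (2 * i) ∪ C.oldInputs keys π h (2 * i + 1)
    else ∅

/-- The hash inputs of the authentication of the old data of an update proof. -/
def Config.updateInputs (C : Config M S K V Tx D) (keys : Finset K) (f : ℕ)
    (π : UpdateProof K V D) : Set (HashInput K V Tx D) :=
  C.oldInputs keys π 17 f ∪ {x | ∃ t < 13, x = nodeInput (f / 2 ^ t)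
    (C.climb f (C.oldDigest keys π 17 f) π.sib t) (π.sib t)}

/-- The correct update proof for a frontier node. -/
def Config.honestProof [Fintype K] (C : Config M S K V Tx D) (f : ℕ) : UpdateProof K V D where
  leaf := C.leafContent C.state
  node := C.tree C.state
  sib := C.truePath C.state 17 f

/-- The hash inputs of the Merkle tree of the current global state. -/
def Config.treeInputs [Fintype K] (C : Config M S K V Tx D) : Set (HashInput K V Tx D) :=
  {x | ∃ i < 2 ^ 30, x = .leaf (C.leafContent C.state i)} ∪
  {x | ∃ h < 30, ∃ i < 2 ^ (29 - h),
    x = .node (C.tree C.state h (2 * i)) (C.tree C.state h (2 * i + 1))}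

end Merkle

/-! ## Correcting wrong values by exception lists -/

/-- State of the correction: current values, number of corrections, politicians found malicious,
and the proofs asked for. -/
structure CorrState (X Y : Type*) where
  cur : X → Y
  fixed : ℕ
  bad : Finset (Fin 25)
  asked : List (Fin 25 × X)

open scoped Classical in
/-- Treat item `x` of the exception list of politician `i`: if the claimed value differs from the
current one, ask for a proof; correct the value if it verifies, else drop the politician. At most
`τ` values are corrected. -/
def correctStep {X Y : Type*} (τ : ℕ) (listed : Fin 25 → X → Prop) (claim : Fin 25 → X → Y)
    (ok : Fin 25 → X → Prop) (st : CorrState X Y) (p : Fin 25 × X) : CorrState X Y :=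
  if st.fixed < τ ∧ p.1 ∉ st.bad ∧ listed p.1 p.2 ∧ claim p.1 p.2 ≠ st.cur p.2 then
    if ok p.1 p.2 then
      { cur := Function.update st.cur p.2 (claim p.1 p.2)
        fixed := st.fixed + 1
        bad := st.bad
        asked := p :: st.asked }
    else { st with bad := insert p.1 st.bad, asked := p :: st.asked }
  else st

/-- Treat the exception lists of the 25 politicians one after the other. -/
def correct {X Y : Type*} (τ : ℕ) (items : List X) (listed : Fin 25 → X → Prop)
    (claim : Fin 25 → X → Y) (ok : Fin 25 → X → Prop) (init : X → Y) : CorrState X Y :=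
  ((List.finRange 25).flatMap fun i => items.map fun x => (i, x)).foldl
    (correctStep τ listed claim ok) ⟨init, 0, ∅, []⟩

/-! ## Executing transactions; ledgers -/

section Ledger

variable {M S : ℕ} {K V Tx D : Type*}

open scoped Classical in
/-- Apply a transaction to a state, if it is valid. -/
def Config.applyTx (C : Config M S K V Tx D) (s : K → V) (t : Tx) : Option (K → V) :=
  (C.exec t fun κ => s κ).map fun w κ => if h : κ ∈ C.keysOf t then w ⟨κ, h⟩ else s κ

/-- Apply the transactions in order and drop those that are invalid: the list of the valid ones
and the final state. -/
def Config.runValid (C : Config M S K V Tx D) : List Tx → (K → V) → List Tx × (K → V)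
  | [], s => ([], s)
  | t :: ts, s =>
    match C.applyTx s t with
    | none => C.runValid ts s
    | some s' => (t :: (C.runValid ts s').1, (C.runValid ts s').2)

/-- Apply all the transactions in order; `none` if one of them is invalid. -/
def Config.runAll (C : Config M S K V Tx D) : List Tx → (K → V) → Option (K → V)
  | [], s => some s
  | t :: ts, s => (C.applyTx s t).bind (C.runAll ts)

open scoped Classical in
/-- Check a sequence of blocks, from a previous hash and a state: each block contains the hash of
the one before it, and all transactions are valid in order. The result is the final state. -/
def Config.replay (C : Config M S K V Tx D) : List (Block Tx D) → D → (K → V) → Option (K → V)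
  | [], _, s => some s
  | b :: bs, d, s =>
    if b.prev = d then (C.runAll b.txs s).bind (C.replay bs (C.hash (.block b))) else none

/-- `bs` is a correct ledger from genesis on, with final global state `s`. -/
def Config.IsLedger (C : Config M S K V Tx D) (bs : List (Block Tx D)) (s : K → V) : Prop :=
  C.replay bs C.genesisHash C.genesisState = some s

/-- The hash of the last committed block. -/
def Config.lastHash (C : Config M S K V Tx D) : D :=
  (C.chain.getLast?.map fun b => C.hash (.block b)).getD C.genesisHash

end Ledger

/-! ## The protocol -/

section Protocol

variable {R M S : ℕ} {K V Tx D : Type*}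

/-- The committee: each citizen is a member with probability `2000 / M`. -/
def Setup.committee (σ : Setup M S) : Finset (Fin M) :=
  Finset.univ.filter fun v => (σ.sortition v : ℕ) < 2000

/-- The safe sample of `v` contains an honest politician. -/
def Config.Reaches (C : Config M S K V Tx D) (σ : Setup M S) (v : Fin M) : Prop :=
  ∃ i, σ.sample v i ∉ C.corruptPoliticians

open scoped Classical in
/-- The good citizens: the honest committee members that speak to an honest politician. -/
def Config.good (C : Config M S K V Tx D) (σ : Setup M S) : Finset (Fin M) :=
  σ.committee.filter fun v => v ∉ C.corruptCitizens ∧ C.Reaches σ v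

open scoped Classical in
/-- What `v` reads from `j` when all committee members upload a signed message to their samples,
the politicians broadcast what they got, and the committee members download from their samples.
A message of an honest citizen gets through if both samples contain an honest politician; all else
is up to the adversary. -/
def Config.deliver {α : Type*} (C : Config M S K V Tx D) (σ : Setup M S) (sent : Fin M → α)
    (adv : Fin M → Fin M → α) (v j : Fin M) : α :=
  if j ∉ C.corruptCitizens ∧ C.Reaches σ j ∧ C.Reaches σ v then sent j else adv v j

open scoped Classical in
/-- What the adversary has seen at time `t`. The first re-upload happens at time `1`, the second
one at time `2`; the good citizens' coins of phase `r` of the binary agreement are revealed after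
time `3 + r` (those of the others are always known); the `j`-th spot-checks of the read and the
write are revealed after time `3 + R + j` and `3 + R + 25 + j`. -/
def Config.view (C : Config M S K V Tx D) (ω : Tape R M S K) (t : ℕ) : View R M S K where
  setup := ω.setup
  upload1 := if 1 ≤ t then some ω.upload1 else none
  upload2 := if 2 ≤ t then some ω.upload2 else none
  coin := fun r v => if v ∉ C.good ω.setup ∨ 3 + (r : ℕ) < t then some (ω.coin r v) else none
  readSpot := fun j => if 3 + R + (j : ℕ) < t then some (ω.readSpot j) else none
  writeSpot := fun j => if 3 + R + 25 + (j : ℕ) < t then some (ω.writeSpot j) else none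

/-- A commitment of the `i`-th designated politician with a valid signature: an honest politician
signs only the hash of its frozen pool. -/
def Config.Signed (C : Config M S K V Tx D) (i : Fin 45) (c : D) : Prop :=
  C.designated i ∈ C.corruptPoliticians ∨
    c = C.hash (.pool (C.frozenPool (C.designated i)))

variable (C : Config M S K V Tx D) (A : Adversary R M S K V Tx D) (ω : Tape R M S K)

/-! ### Transaction pools and proposals -/

open scoped Classical in
/-- The pool that `v` gets from the `i`-th designated politician. -/
def Config.held1 (v : Fin M) (i : Fin 45) : Option (List Tx) :=
  if C.designated i ∈ C.corruptPoliticians then A.pool (C.view ω 0) v i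
  else some (C.frozenPool (C.designated i))

/-- The indices of the pools that are held. -/
def heldIndices (held : Fin 45 → Option (List Tx)) : Finset (Fin 45) :=
  Finset.univ.filter fun i => (held i).isSome

/-- The witness list of citizen `j` as read by `v`. -/
def Config.witnessList (v j : Fin M) : Fin 45 → Option D :=
  C.deliver ω.setup (fun j i => (C.held1 A ω j i).map fun p => C.hash (.pool p))
    (A.witness (C.view ω 0)) v j

/-- Proposers. -/
def Config.IsProposer (u : Fin M) : Prop :=
  u ∈ ω.setup.committee ∧ 2 ^ C.proposerBits ∣ (ω.setup.proposerVrf u : ℕ)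

open scoped Classical in
/-- The commitments that an honest proposer `u` picks: those in at least `1122` witness lists. -/
def Config.pickIds (u : Fin M) (i : Fin 45) : Option D :=
  if h : ∃ c, C.Signed i c ∧
      1122 ≤ (ω.setup.committee.filter fun j => C.witnessList A ω u j i = some c).card
  then some h.choose else none

open scoped Classical in
/-- The list of commitments proposed by `u`, as downloaded by `v`. -/
def Config.proposalOf (v u : Fin M) : Option (Fin 45 → Option D) :=
  C.deliver ω.setup (fun u => if C.IsProposer ω u then some (C.pickIds A ω u) else none)
    (A.proposal (C.view ω 1)) v u

/-- `v` has downloaded a well-formed proposal `p`. -/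
def Config.Candidate (v : Fin M) (p : Proposal M D) : Prop :=
  C.IsProposer ω p.proposer ∧ C.proposalOf A ω v p.proposer = some p.ids ∧
    ∀ i c, p.ids i = some c → C.Signed i c

open scoped Classical in
/-- The winning proposal in the view of `v`: the one with the least VRF (ties are broken by the
names of the citizens). -/
def Config.winner (v : Fin M) : Option (Proposal M D) :=
  if h : ∃ p, C.Candidate A ω v p ∧ ∀ q, C.Candidate A ω v q →
      toLex (ω.setup.proposerVrf p.proposer, p.proposer) ≤
        toLex (ω.setup.proposerVrf q.proposer, q.proposer)
  then some h.choose else none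

/-- The pools at the honest politicians after the first re-upload and gossip. -/
def Config.store1 (i : Fin 45) : Set (List Tx) :=
  {p | (C.designated i ∉ C.corruptPoliticians ∧ p = C.frozenPool (C.designated i)) ∨
    (∃ v ∈ C.good ω.setup, (ω.upload1 v).2 ∉ C.corruptPoliticians ∧
      i ∈ ((ω.upload1 v).1 (heldIndices (C.held1 A ω v))).1 ∧ C.held1 A ω v i = some p) ∨
    p ∈ A.inject1 (C.view ω 1) i}

open scoped Classical in
/-- Download of a pool with hash `c`, from honest politicians with the pools `st` and from
malicious politicians that offer `offer`. -/
def Config.fetch (st : Set (List Tx)) (offer : Option (List Tx)) (c : D) : Option (List Tx) :=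
  if h : ∃ p ∈ st, C.hash (.pool p) = c then some h.choose
  else offer.filter fun p => decide (C.hash (.pool p) = c)

/-- The pools held by `v` after it has tried to download those that were missing for the winning
proposal. -/
def Config.held2 (v : Fin M) (i : Fin 45) : Option (List Tx) :=
  match C.held1 A ω v i with
  | some p => some p
  | none => ((C.winner A ω v).bind fun p => p.ids i).bind fun c =>
      C.fetch (C.store1 A ω i) (A.offer1 (C.view ω 1) v i) c

open scoped Classical in
/-- The initial value of `v` in the byzantine agreement: the winning proposal if `v` holds all the
pools committed in it, else NULL. -/
def Config.initial (v : Fin M) : Value M D :=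
  (C.winner A ω v).filter fun p =>
    decide (∀ i c, p.ids i = some c → ∃ q, C.held2 A ω v i = some q ∧ C.hash (.pool q) = c)

/-- The pools at the honest politicians after the second re-upload and gossip. -/
def Config.store2 (i : Fin 45) : Set (List Tx) :=
  {p | p ∈ C.store1 A ω i ∨
    (∃ v ∈ C.good ω.setup, (ω.upload2 v).2 ∉ C.corruptPoliticians ∧
      i ∈ ((ω.upload2 v).1 (heldIndices (C.held2 A ω v))).1 ∧ C.held2 A ω v i = some p) ∨
    p ∈ A.inject2 (C.view ω (3 + R)) i}

/-! ### Byzantine agreement on strings -/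

/-- The number of committee members with property `P`. -/
def Setup.count (σ : Setup M S) (P : Fin M → Prop) : ℕ := by
  classical exact (σ.committee.filter P).card

/-- More than two thirds of the committee. -/
def Setup.TwoThirds (σ : Setup M S) (P : Fin M → Prop) : Prop :=
  2 * σ.committee.card < 3 * σ.count P

/-- More than one third of the committee. -/
def Setup.OneThird (σ : Setup M S) (P : Fin M → Prop) : Prop :=
  σ.committee.card < 3 * σ.count P

/-- First round of graded consensus: send the initial value. -/
def Config.voteOf (v j : Fin M) : Option (Value M D) :=
  C.deliver ω.setup (fun j => some (C.initial A ω j)) (A.vote (C.view ω 2)) v j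

open scoped Classical in
/-- Second round: send the value received from more than two thirds, if there is one. -/
def Config.echoOf (v j : Fin M) : Option (Value M D) :=
  C.deliver ω.setup
    (fun j => if h : ∃ x, ω.setup.TwoThirds fun k => C.voteOf A ω j k = some x
      then some h.choose else none)
    (A.echo (C.view ω 2)) v j

open scoped Classical in
/-- The value of graded consensus: the one echoed by more than one third, if there is one. -/
def Config.graded (v : Fin M) : Value M D :=
  if h : ∃ x, ω.setup.OneThird fun j => C.echoOf A ω v j = some x then h.choose else none

/-- The value has grade 2: it was echoed by more than two thirds. -/
def Config.Grade2 (v : Fin M) : Prop :=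
  ∃ x, ω.setup.TwoThirds fun j => C.echoOf A ω v j = some x

/-- State of a citizen in the binary agreement: its bit, and its output once it has halted. A
halted citizen keeps sending its output. -/
structure BitState where
  bit : Bool
  out : Option Bool

open scoped Classical in
/-- A step with the coin fixed to `b`, given the received bits. -/
def fixedStep (σ : Setup M S) (b : Bool) (recv : Fin M → Option Bool) (st : BitState) : BitState :=
  if st.out.isSome then st
  else if σ.TwoThirds fun j => recv j = some b then ⟨b, some b⟩
  else if σ.TwoThirds fun j => recv j = some (!b) then ⟨!b, none⟩
  else ⟨b, none⟩

open scoped Classical in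
/-- A step with a genuinely flipped coin: the last bit of the least VRF received. -/
def coinStep (σ : Setup M S) (coin : Fin M → Vrf) (recv : Fin M → Option Bool) (st : BitState) :
    BitState :=
  if st.out.isSome then st
  else if σ.TwoThirds fun j => recv j = some false then ⟨false, none⟩
  else if σ.TwoThirds fun j => recv j = some true then ⟨true, none⟩
  else ⟨decide (sInf {x : ℕ | ∃ j ∈ σ.committee, recv j ≠ none ∧ x = coin j} % 2 = 1), none⟩

/-- The bits received in a step of phase `r`, at time `t`. -/
def Config.bitsOf (r : ℕ) (step : Fin 3) (t : ℕ) (st : Fin M → BitState) (v j : Fin M) :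
    Option Bool :=
  C.deliver ω.setup (fun j => some (st j).bit) (A.bit (C.view ω t) r step) v j

/-- A phase of the binary agreement: coin fixed to 0, coin fixed to 1, coin flipped. -/
def Config.phase (r : Fin R) (st : Fin M → BitState) : Fin M → BitState :=
  let st1 := fun v => fixedStep ω.setup false (C.bitsOf A ω r 0 (3 + r) st v) (st v)
  let st2 := fun v => fixedStep ω.setup true (C.bitsOf A ω r 1 (3 + r) st1 v) (st1 v)
  fun v => coinStep ω.setup (ω.coin r) (C.bitsOf A ω r 2 (3 + r + 1) st2 v) (st2 v)

open scoped Classical in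
/-- The binary agreement; the initial bit is 0 if the grade is 2, else 1. -/
def Config.bitAgreement : Fin M → BitState :=
  (List.finRange R).foldl (fun st r => C.phase A ω r st)
    fun v => ⟨decide (¬ C.Grade2 A ω v), none⟩

/-- The output of the byzantine agreement: the graded value if the output bit is 0, NULL if it
is 1; `none` if the citizen has not halted. -/
def Config.out (v : Fin M) : Option (Value M D) :=
  (C.bitAgreement A ω v).out.map fun b => if b then none else C.graded A ω v

/-! ### Reading the global state -/

variable [Fintype K]

/-- The pool with commitment `c` of the `i`-th designated politician, as held by `v` or downloaded
by it after the second re-upload. -/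
def Config.finalPool (v : Fin M) (i : Fin 45) (c : D) : Option (List Tx) :=
  ((C.held2 A ω v i).filter fun p => by classical exact decide (C.hash (.pool p) = c)).or
    (C.fetch (C.store2 A ω i) (A.offer2 (C.view ω (3 + R)) v i) c)

open scoped Classical in
/-- The transactions of the pools committed in `ids`, in order, if all the pools are at hand. -/
def assemble (ids : Fin 45 → Option D) (get : Fin 45 → D → Option (List Tx)) :
    Option (List Tx) :=
  if ∀ i c, ids i = some c → (get i c).isSome then
    some ((List.finRange 45).flatMap fun i => ((ids i).bind (get i)).getD [])
  else none

open scoped Classical in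
/-- The keys referenced by some transactions. -/
def Config.keysIn (txs : List Tx) : Finset K :=
  Finset.univ.filter fun κ => ∃ t ∈ txs, κ ∈ C.keysOf t

/-- The `i`-th politician in the sample of `v` is honest. -/
def Config.HonestPol (v : Fin M) (i : Fin 25) : Prop := ω.setup.sample v i ∉ C.corruptPoliticians

open scoped Classical in
/-- The values of the keys that the `j`-th politician gives in the `j`-th attempt. -/
def Config.readVals (v : Fin M) (j : Fin 25) : K → V :=
  if C.HonestPol ω v j then C.state else A.readVal (C.view ω (3 + R + j)) v j

open scoped Classical in
/-- The challenge paths that it gives. -/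
def Config.readPathOf (v : Fin M) (j : Fin 25) (κ : K) : Path K V D :=
  if C.HonestPol ω v j then C.honestPath κ else A.readPath (C.view ω (3 + R + j + 1)) v j κ

/-- The spot-checks of the `j`-th attempt succeed. -/
def Config.ReadPasses (v : Fin M) (keys : Finset K) (j : Fin 25) : Prop :=
  ∀ κ ∈ (ω.readSpot j v keys).1, C.PathOK κ (C.readVals A ω v j κ) (C.readPathOf A ω v j κ)

/-- The first attempt that succeeds: when spot-checks fail, the politician is discarded and the
next one is asked. -/
def firstPass (P : Fin 25 → Prop) : Option (Fin 25) := by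
  classical exact (List.finRange 25).find? fun j => decide (P j)

open scoped Classical in
/-- Bucket `b` of the keys (which are dealt in turn to 2000 buckets) with the values `w`. -/
def bucket (keys : Finset K) (w : K → V) (b : Fin 2000) : Finset (K × V) :=
  (keys.filter fun κ => keys.toList.idxOf κ % 2000 = (b : ℕ)).image fun κ => (κ, w κ)

open scoped Classical in
/-- The exception list of the `i`-th politician for the values `w` of citizen `v`. -/
def Config.exceptionList (v : Fin M) (keys : Finset K) (w : K → V) (i : Fin 25) :
    Finset (Fin 2000) :=
  if C.HonestPol ω v i then
    Finset.univ.filter fun b =>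
      C.hash (.bucket (bucket keys w b)) ≠ C.hash (.bucket (bucket keys C.state b))
  else A.exceptions (C.view ω (3 + R + 25)) v i

open scoped Classical in
/-- The values that it claims for the keys in the listed buckets. -/
def Config.claimedVal (v : Fin M) (i : Fin 25) : K → V :=
  if C.HonestPol ω v i then C.state else A.claimVal (C.view ω (3 + R + 25)) v i

open scoped Classical in
/-- The challenge paths that it gives for them. -/
def Config.claimedPath (v : Fin M) (i : Fin 25) (κ : K) : Path K V D :=
  if C.HonestPol ω v i then C.honestPath κ else A.claimPath (C.view ω (3 + R + 25)) v i κ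

open scoped Classical in
/-- Correction of the values `w`; an exception list is valid if it has at most 500 entries. -/
def Config.readCorrection (v : Fin M) (keys : Finset K) (w : K → V) : CorrState K V :=
  correct 500 keys.toList
    (fun i κ => (C.exceptionList A ω v keys w i).card ≤ 500 ∧
      ∃ b ∈ C.exceptionList A ω v keys w i, keys.toList.idxOf κ % 2000 = (b : ℕ))
    (C.claimedVal A ω v)
    (fun i κ => C.PathOK κ (C.claimedVal A ω v i κ) (C.claimedPath A ω v i κ)) w

/-- Global state read by `v`: the values of the `keys`. -/
def Config.read (v : Fin M) (keys : Finset K) : Option (K → V) :=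
  (firstPass (C.ReadPasses A ω v keys)).map fun j =>
    (C.readCorrection A ω v keys (C.readVals A ω v j)).cur

/-! ### Updating the global state -/

/-- The new global state in the view of the honest politicians, for a proposal `p`. -/
def Config.polState (p : Proposal M D) : K → V :=
  match assemble p.ids (fun i c => C.fetch (C.store2 A ω i) none c) with
  | some txs => (C.runValid txs C.state).2
  | none => C.state

open scoped Classical in
/-- The frontier of the new tree that the `j`-th politician gives in the `j`-th attempt. -/
def Config.frontierOf (p : Proposal M D) (v : Fin M) (j : Fin 25) : ℕ → D :=
  if C.HonestPol ω v j then C.tree (C.polState A ω p) 17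
  else A.frontier (C.view ω (3 + R + 25 + j)) v j

open scoped Classical in
/-- The proofs that it gives. -/
def Config.spotProofOf (v : Fin M) (j : Fin 25) (f : ℕ) : UpdateProof K V D :=
  if C.HonestPol ω v j then C.honestProof f
  else A.spotProof (C.view ω (3 + R + 25 + j + 1)) v j f

/-- The spot-checks of the `j`-th attempt succeed. -/
def Config.WritePasses (p : Proposal M D) (v : Fin M) (keys : Finset K) (new : K → V)
    (j : Fin 25) : Prop :=
  ∀ f ∈ (ω.writeSpot j v).1,
    C.UpdateOK keys new (f : ℕ) (C.frontierOf A ω p v j f) (C.spotProofOf A ω v j f)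

open scoped Classical in
/-- The frontier that the `i`-th politician claims afterwards. -/
def Config.claimedFrontier (p : Proposal M D) (v : Fin M) (i : Fin 25) (f : Fin (2 ^ 13)) : D :=
  if C.HonestPol ω v i then C.tree (C.polState A ω p) 17 f
  else A.claimFrontier (C.view ω (3 + R + 50)) v i f

open scoped Classical in
/-- The proofs that it gives for it. -/
def Config.claimedProof (v : Fin M) (i : Fin 25) (f : Fin (2 ^ 13)) : UpdateProof K V D :=
  if C.HonestPol ω v i then C.honestProof f else A.claimProof (C.view ω (3 + R + 50)) v i f

open scoped Classical in
/-- Correction of the frontier `F`; a politician is discarded if it differs from `F` in more than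
800 nodes. -/
def Config.writeCorrection (p : Proposal M D) (v : Fin M) (keys : Finset K) (new : K → V)
    (F : Fin (2 ^ 13) → D) : CorrState (Fin (2 ^ 13)) D :=
  correct 800 (List.finRange (2 ^ 13))
    (fun i _ => (Finset.univ.filter fun f => C.claimedFrontier A ω p v i f ≠ F f).card ≤ 800)
    (C.claimedFrontier A ω p v)
    (fun i f => C.UpdateOK keys new f (C.claimedFrontier A ω p v i f) (C.claimedProof A ω v i f)) F

/-- Global state update by `v`: the new root. -/
def Config.write (p : Proposal M D) (v : Fin M) (keys : Finset K) (new : K → V) : Option D :=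
  (firstPass (C.WritePasses A ω p v keys new)).map fun j =>
    C.build (fun i => (C.writeCorrection A ω p v keys new
      fun f => C.frontierOf A ω p v j f).cur (Fin.ofNat (2 ^ 13) i)) 13 0

/-! ### Block commit -/

/-- The transactions that `v` considers for proposal `p`, if it has all the pools. -/
def Config.txsOf (v : Fin M) (p : Proposal M D) : Option (List Tx) :=
  assemble p.ids (C.finalPool A ω v)

/-- The block and the root of the global state that `v` commits to, for the output `x` of the
byzantine agreement. -/
def Config.commitTo (v : Fin M) : Value M D → Option (Block Tx D × D)
  | none => some (⟨C.lastHash, []⟩, C.root C.state)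
  | some p =>
    (C.txsOf A ω v p).bind fun txs =>
      (C.read A ω v (C.keysIn txs)).bind fun w =>
        (C.write A ω p v (C.keysIn txs) (C.runValid txs w).2).map fun r =>
          (⟨C.lastHash, (C.runValid txs w).1⟩, r)

/-- What `v` signs at the end: block hash, root of the new global state, and block number
(`none` if it signs nothing). -/
def Config.signed (v : Fin M) : Option (D × D × ℕ) :=
  ((C.out A ω v).bind (C.commitTo A ω v)).map fun b =>
    (C.hash (.block b.1), b.2, C.chain.length + 1)

/-- The conclusion: there is a block `B` that extends the ledger correctly, with new global state
`s`, such that all good citizens except at most 36 sign the hash of `B` and the root of `s`. -/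
def Config.BlockConsensus : Prop :=
  ∃ (B : Block Tx D) (s : K → V), C.IsLedger (C.chain ++ [B]) s ∧
    {v | v ∈ C.good ω.setup ∧
      C.signed A ω v ≠ some (C.hash (.block B), C.root s, C.chain.length + 1)}.ncard ≤ 36

/-! ### Hash collisions -/

/-- The pools hashed in the round: those of the good citizens and of the honest politicians. -/
def Config.PoolSeen (p : List Tx) : Prop :=
  (∃ i, p ∈ C.store2 A ω i) ∨
  ∃ v ∈ C.good ω.setup, ∃ i, C.held2 A ω v i = some p ∨
    ∃ q c, C.out A ω v = some (some q) ∧ q.ids i = some c ∧ C.finalPool A ω v i c = some p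

/-- The hash inputs when `v` reads the values of the `keys`. -/
def Config.readInputs (v : Fin M) (keys : Finset K) : Set (HashInput K V Tx D) :=
  {x | ∃ j, (∀ i < j, ¬ C.ReadPasses A ω v keys i) ∧
      ∃ κ ∈ (ω.readSpot j v keys).1, x ∈ C.pathInputs κ (C.readPathOf A ω v j κ)} ∪
  {x | ∃ j, firstPass (C.ReadPasses A ω v keys) = some j ∧
    ((∃ b, x = .bucket (bucket keys (C.readVals A ω v j) b) ∨
        x = .bucket (bucket keys C.state b)) ∨
      ∃ a ∈ (C.readCorrection A ω v keys (C.readVals A ω v j)).asked,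
        x ∈ C.pathInputs a.2 (C.claimedPath A ω v a.1 a.2))}

/-- The hash inputs when `v` authenticates old data in the update of the global state. -/
def Config.writeInputs (p : Proposal M D) (v : Fin M) (keys : Finset K) (new : K → V) :
    Set (HashInput K V Tx D) :=
  {x | ∃ j, (∀ i < j, ¬ C.WritePasses A ω p v keys new i) ∧
      ∃ f ∈ (ω.writeSpot j v).1, x ∈ C.updateInputs keys (f : ℕ) (C.spotProofOf A ω v j f)} ∪
  {x | ∃ j, firstPass (C.WritePasses A ω p v keys new) = some j ∧
      ∃ a ∈ (C.writeCorrection A ω p v keys new fun f => C.frontierOf A ω p v j f).asked,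
        x ∈ C.updateInputs keys (a.2 : ℕ) (C.claimedProof A ω v a.1 a.2)}

/-- The hash inputs that good citizens and honest politicians hash in the round in order to check
pools against commitments and state values against the root. -/
def Config.hashed : Set (HashInput K V Tx D) :=
  {x | ∃ p, C.PoolSeen A ω p ∧ x = .pool p} ∪ C.treeInputs ∪
  {x | ∃ v ∈ C.good ω.setup, ∃ p txs, C.out A ω v = some (some p) ∧ C.txsOf A ω v p = some txs ∧
    (x ∈ C.readInputs A ω v (C.keysIn txs) ∨
      ∃ w, C.read A ω v (C.keysIn txs) = some w ∧
        x ∈ C.writeInputs A ω p v (C.keysIn txs) (C.runValid txs w).2)}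

/-- The round exhibits a collision of the hash function. -/
def Config.Collision : Prop :=
  ∃ x ∈ C.hashed A ω, ∃ y ∈ C.hashed A ω, x ≠ y ∧ C.hash x = C.hash y

end Protocol

end

end Blockene

/-! Write n for the size of the committee and g for the number of its good members. The proof splits
into a deterministic core and bounds for six bad events.

Core (`Config.GoodMajority.blockConsensus`). Messages between good members always arrive, so once 3g
> 2n any two quorums of more than 2n/3 members share a good member that told both receivers the
same. This makes graded consensus and binary agreement sound. As soon as one phase before the last
has coins that make every good member flip the only bit a quorum could hold fixed, the good members
are unanimous, and the next phase halts them all (`Config.GoodMajority.agreement`). If the output is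
NULL, all sign the empty block. If it is a proposal, more than g - n/3 good members entered the
agreement with it, and each of them held all its pools. Suppose every one of these pools was
re-uploaded to an honest politician by one of them. Then, without collisions, all good members
assemble the same transactions. A challenge path that verifies shows the true value, again without
collisions. So an attempt to read that passes its spot-checks leaves more than 500 wrong values only
if the random checks missed all of them. Otherwise the honest politician in the sample repairs
everything by its exception list, since each verified correction lowers the number of wrong values
and the budget therefore suffices (`correct_cur`). The update of the frontier is treated alike, with
800 in place of 500.

Probability. The adversary adapts to all that is revealed, so the relevant events are not
independent. `mean_mul_prod_le` replaces independence: if each factor is decided by a coordinate of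
the tape that earlier factors do not see, and its average over that coordinate is bounded whatever
the rest of the tape, then the bounds multiply. The lemmas on `Config.Agree` establish this
causality. The consequences are: - Exponential moments of the committee (`Config.mean_committee_le`)
give 3g > 2n, 3g ≥ n + 1800 and n ≤ 4000. - With n ≤ 4000, a phase is lucky with probability at
least a fixed positive constant, for instance because all coins of the committee take prescribed
values. Hence many phases suffice, and their number does not depend on any parameter. As the target
bit depends on the adversary, the tape is first transformed by a bijection that moves the target to
a constant (`Config.retarget`). - A proposal that may be output has at least 601 supporters. Each
re-uploads a given pool to an honest politician with probability at least 10/45 · 1/5 = 2/45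
(`Config.prob_not_stored_le`). - Spot-checks matter only as long as all politicians asked so far are
corrupt, which has probability at most (4/5)^(j+1) at attempt j (counted from 0). Weighting every
failure by 4 and applying Markov's inequality bounds the probability of more than 36 failing
citizens (`Config.prob_fails_le`).

The six bounds add up to less than 2⁻³⁰. -/

namespace Blockene

open Finset

/-! ## Averages over finite types -/

section Mean

variable {α β Ω Z : Type*} [Finite α] [Finite β] [Finite Ω] [Finite Z]

/-- The average of a function on a finite type. -/
noncomputable def mean {α : Type*} [Finite α] (f : α → ℝ) : ℝ :=
  letI := Fintype.ofFinite α
  (∑ a, f a) / Nat.card α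

theorem mean_eq {α : Type*} [Fintype α] (f : α → ℝ) : mean f = (∑ a, f a) / Fintype.card α := by
  unfold mean
  rw [Nat.card_eq_fintype_card]
  congr!

theorem mean_mono {f g : α → ℝ} (h : ∀ a, f a ≤ g a) : mean f ≤ mean g := by
  unfold mean
  gcongr with a
  exact h a

theorem mean_nonneg {f : α → ℝ} (h : ∀ a, 0 ≤ f a) : 0 ≤ mean f := by
  unfold mean
  exact div_nonneg (Finset.sum_nonneg fun a _ => h a) (Nat.cast_nonneg _)

theorem mean_const [Nonempty α] (c : ℝ) : mean (fun _ : α => c) = c := by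
  unfold mean
  let _ := Fintype.ofFinite α
  rw [Finset.sum_const, Finset.card_univ, Nat.card_eq_fintype_card, nsmul_eq_mul]
  field_simp

theorem mean_const_le {c : ℝ} (hc : 0 ≤ c) : mean (fun _ : α => c) ≤ c := by
  rcases isEmpty_or_nonempty α with h | h
  · unfold mean; simpa using hc
  · exact (mean_const c).le

theorem mean_le_of_le {f : α → ℝ} {c : ℝ} (hc : 0 ≤ c) (h : ∀ a, f a ≤ c) : mean f ≤ c :=
  (mean_mono h).trans (mean_const_le hc)

theorem mean_mul_left (c : ℝ) (f : α → ℝ) : mean (fun a => c * f a) = c * mean f := by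
  unfold mean
  rw [← Finset.mul_sum, mul_div_assoc]

theorem mean_add (f g : α → ℝ) : mean (fun a => f a + g a) = mean f + mean g := by
  unfold mean
  rw [Finset.sum_add_distrib, add_div]

theorem mean_sum {ι : Type*} (s : Finset ι) (f : ι → α → ℝ) :
    mean (fun a => ∑ i ∈ s, f i a) = ∑ i ∈ s, mean (f i) := by
  unfold mean
  rw [Finset.sum_comm, Finset.sum_div]

theorem mean_indicator (P : α → Prop) [DecidablePred P] :
    mean (fun a => if P a then (1 : ℝ) else 0) = (Nat.card {a // P a} : ℝ) / Nat.card α := by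
  let _ := Fintype.ofFinite α
  rw [mean_eq, Finset.sum_boole, Nat.card_eq_fintype_card, Nat.card_eq_fintype_card,
    Fintype.card_subtype]

/-- A coordinate of a product: it can be read and replaced. -/
structure Lens (Ω Z : Type*) where
  get : Ω → Z
  set : Ω → Z → Ω
  get_set : ∀ ω z, get (set ω z) = z
  set_get : ∀ ω, set ω (get ω) = ω
  set_set : ∀ ω z z', set (set ω z) z' = set ω z'

/-- Resampling a coordinate does not change an average. -/
theorem mean_resample (L : Lens Ω Z) (f : Ω → ℝ) :
    mean f = mean fun ω => mean fun z => f (L.set ω z) := by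
  let _ := Fintype.ofFinite Ω
  let _ := Fintype.ofFinite Z
  rcases isEmpty_or_nonempty Ω with h | h
  · simp [mean_eq]
  have hZ : Nonempty Z := h.map L.get
  -- Exchanging the coordinate of `ω` with the fresh value `z` is an involution of `Ω × Z`, so the
  -- resampled tape is distributed like the original one.
  let e : Ω × Z ≃ Ω × Z :=
    { toFun := fun p => (L.set p.1 p.2, L.get p.1)
      invFun := fun p => (L.set p.1 p.2, L.get p.1)
      left_inv := fun p => by simp [L.set_set, L.set_get, L.get_set]
      right_inv := fun p => by simp [L.set_set, L.set_get, L.get_set] }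
  have key : ∑ ω, ∑ z, f (L.set ω z) = (Fintype.card Z : ℝ) * ∑ ω, f ω := by
    rw [← Fintype.sum_prod_type' (f := fun ω z => f (L.set ω z))]
    rw [show (∑ p : Ω × Z, f (L.set p.1 p.2)) = ∑ p : Ω × Z, f p.1 from
      Equiv.sum_comp e (fun p => f p.1)]
    rw [Fintype.sum_prod_type, Finset.mul_sum]
    simp
  simp only [mean_eq]
  rw [← Finset.sum_div, key]
  have : (Fintype.card Z : ℝ) ≠ 0 := by
    exact_mod_cast Fintype.card_ne_zero
  field_simp

/-- The average of a product of factors, each of which is revealed by a coordinate that the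
earlier factors do not depend on, is bounded by bounds for the conditional averages. -/
theorem mean_mul_prod_le {ι : Type*} [LinearOrder ι] (L : ι → Lens Ω Z) (G c : ι → Ω → ℝ)
    (hG : ∀ l ω, 0 ≤ G l ω) (hc : ∀ l ω, 0 ≤ c l ω)
    (hci : ∀ l l' ω z, c l ((L l').set ω z) = c l ω)
    (hGi : ∀ l l', l' < l → ∀ ω z, G l' ((L l).set ω z) = G l' ω)
    (hle : ∀ l ω, mean (fun z => G l ((L l).set ω z)) ≤ c l ω) (s : Finset ι) :
    ∀ w : Ω → ℝ, (∀ ω, 0 ≤ w ω) → (∀ l ω z, w ((L l).set ω z) = w ω) →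
      mean (fun ω => w ω * ∏ l ∈ s, G l ω) ≤ mean (fun ω => w ω * ∏ l ∈ s, c l ω) := by
  induction s using Finset.induction_on_max with
  | empty => intro w _ _; simp
  | insert a s ha ih =>
    intro w hw hwi
    have ha' : a ∉ s := fun h => lt_irrefl _ (ha a h)
    simp only [Finset.prod_insert ha']
    -- The factor of largest index is averaged out first, because no other factor sees its
    -- coordinate. Its bound `c a` then joins the weight, which is why the induction runs over all
    -- `w`.
    calc mean (fun ω => w ω * (G a ω * ∏ l ∈ s, G l ω))
        = mean (fun ω => mean fun z => (w ω * ∏ l ∈ s, G l ω) * G a ((L a).set ω z)) := by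
          rw [mean_resample (L a)]
          congr 1; funext ω; congr 1; funext z
          rw [hwi, Finset.prod_congr rfl fun l hl => hGi a l (ha l hl) ω z]
          ring
      _ ≤ mean (fun ω => (w ω * c a ω) * ∏ l ∈ s, G l ω) := by
          apply mean_mono
          intro ω
          rw [mean_mul_left]
          have h1 : 0 ≤ w ω * ∏ l ∈ s, G l ω :=
            mul_nonneg (hw ω) (Finset.prod_nonneg fun l _ => hG l ω)
          calc _ ≤ (w ω * ∏ l ∈ s, G l ω) * c a ω := mul_le_mul_of_nonneg_left (hle a ω) h1
            _ = _ := by ring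
      _ ≤ mean (fun ω => (w ω * c a ω) * ∏ l ∈ s, c l ω) :=
          ih _ (fun ω => mul_nonneg (hw ω) (hc a ω)) fun l ω z => by rw [hwi, hci]
      _ = _ := by congr 1; funext ω; ring

theorem mean_prod_le {ι : Type*} [LinearOrder ι] (L : ι → Lens Ω Z) (G c : ι → Ω → ℝ)
    (hG : ∀ l ω, 0 ≤ G l ω) (hc : ∀ l ω, 0 ≤ c l ω)
    (hci : ∀ l l' ω z, c l ((L l').set ω z) = c l ω)
    (hGi : ∀ l l', l' < l → ∀ ω z, G l' ((L l).set ω z) = G l' ω)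
    (hle : ∀ l ω, mean (fun z => G l ((L l).set ω z)) ≤ c l ω) (s : Finset ι) :
    mean (fun ω => ∏ l ∈ s, G l ω) ≤ mean (fun ω => ∏ l ∈ s, c l ω) := by
  simpa using mean_mul_prod_le L G c hG hc hci hGi hle s (fun _ => 1) (by simp) (by simp)

/-- The average over dependent functions of a function of one coordinate. -/
theorem mean_pi_apply {ι : Type*} [Finite ι] {B : ι → Type*} [∀ i, Finite (B i)]
    [∀ i, Nonempty (B i)] (i : ι) (f : B i → ℝ) :
    mean (fun p : ((i : ι) → B i) => f (p i)) = mean f := by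
  classical
  let L : Lens ((i : ι) → B i) (B i) :=
    { get := fun p => p i
      set := fun p z => Function.update p i z
      get_set := by simp
      set_get := by simp
      set_set := by simp }
  rw [mean_resample L]
  simp only [L, Function.update_self]
  exact mean_const _

theorem mean_prod_mul (f : α → ℝ) (g : β → ℝ) :
    mean (fun p : α × β => f p.1 * g p.2) = mean f * mean g := by
  let _ := Fintype.ofFinite α
  let _ := Fintype.ofFinite β
  simp only [mean_eq, Fintype.sum_prod_type, Fintype.card_prod, ← Finset.mul_sum,
    ← Finset.sum_mul]
  push_cast
  rw [div_mul_div_comm]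

/-- Markov's inequality for products of weights. -/
theorem mean_indicator_le_of_le (P : Ω → Prop) (f : Ω → ℝ) (hf : ∀ ω, 0 ≤ f ω)
    (h : ∀ ω, P ω → 1 ≤ f ω) :
    (Nat.card {ω // P ω} : ℝ) / Nat.card Ω ≤ mean f := by
  classical
  rw [← mean_indicator]
  apply mean_mono
  intro ω
  split_ifs with hp
  · exact h ω hp
  · exact hf ω

end Mean

/-! ## Uniform subsets and injections -/

/-- Factor by factor, (a - m)/(b - m) ≤ a/b. In terms of sampling: draws without replacement all
land in a given subset no more often than draws with replacement. -/
theorem descFactorial_mul_pow_le {a b : ℕ} (h : a ≤ b) (m : ℕ) :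
    a.descFactorial m * b ^ m ≤ b.descFactorial m * a ^ m := by
  induction m with
  | zero => simp
  | succ m ih =>
    rw [Nat.descFactorial_succ, Nat.descFactorial_succ, pow_succ, pow_succ]
    have h1 : (a - m) * b ≤ (b - m) * a := by
      rcases le_total a m with h2 | h2
      · simp [Nat.sub_eq_zero_of_le h2]
      · obtain ⟨k, rfl⟩ := Nat.exists_eq_add_of_le h2
        obtain ⟨l, rfl⟩ := Nat.exists_eq_add_of_le h
        rw [Nat.add_sub_cancel_left, show m + k + l - m = k + l by omega]
        nlinarith
    calc (a - m) * a.descFactorial m * (b ^ m * b)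
        = ((a - m) * b) * (a.descFactorial m * b ^ m) := by ring
      _ ≤ ((b - m) * a) * (b.descFactorial m * a ^ m) := Nat.mul_le_mul h1 ih
      _ = _ := by ring

theorem choose_mul_pow_le {a b : ℕ} (h : a ≤ b) (m : ℕ) :
    a.choose m * b ^ m ≤ b.choose m * a ^ m := by
  have := descFactorial_mul_pow_le h m
  rw [Nat.descFactorial_eq_factorial_mul_choose, Nat.descFactorial_eq_factorial_mul_choose,
    mul_assoc, mul_assoc] at this
  exact Nat.le_of_mul_le_mul_left this (Nat.factorial_pos m)

/-- The probability that a random `m`-subset of `H` misses `W`. -/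
theorem mean_disjoint {α : Type*} [DecidableEq α] (H W : Finset α) (hW : W ⊆ H) (m : ℕ)
    (Q : Finset α → Prop)
    (hQ : ∀ s, Q s ↔ s ⊆ H ∧ s.card = m) [Finite {s // Q s}] :
    mean (fun s : {s // Q s} => if Disjoint s.1 W then (1 : ℝ) else 0) =
      ((H.card - W.card).choose m : ℝ) / H.card.choose m := by
  rw [mean_indicator (fun s : {s // Q s} => Disjoint s.1 W)]
  have h1 : Nat.card {s // Q s} = H.card.choose m := by
    rw [← Finset.card_powersetCard]
    exact Nat.subtype_card _ fun s => by rw [hQ, Finset.mem_powersetCard]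
  have h2 : Nat.card {s : {s // Q s} // Disjoint s.1 W} = (H.card - W.card).choose m := by
    rw [Nat.card_congr (Equiv.subtypeSubtypeEquivSubtypeInter Q (fun s => Disjoint s W)),
      ← Finset.card_sdiff_of_subset hW, ← Finset.card_powersetCard]
    exact Nat.subtype_card _ fun s => by
      rw [hQ, Finset.mem_powersetCard, Finset.subset_sdiff]; tauto
  rw [h1, h2]

theorem mean_disjoint_le {α : Type*} [DecidableEq α] (H W : Finset α) (hW : W ⊆ H) (m : ℕ)
    (Q : Finset α → Prop) (hQ : ∀ s, Q s ↔ s ⊆ H ∧ s.card = m) [Finite {s // Q s}] (hm : m ≤ H.card)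
    (hH : 0 < H.card) :
    mean (fun s : {s // Q s} => if Disjoint s.1 W then (1 : ℝ) else 0) ≤
      (((H.card - W.card : ℕ) : ℝ) / H.card) ^ m := by
  rw [mean_disjoint H W hW m Q hQ, div_pow, div_le_div_iff₀]
  · have := choose_mul_pow_le (Nat.sub_le H.card W.card) m
    calc ((H.card - W.card).choose m : ℝ) * (H.card : ℝ) ^ m
        = (((H.card - W.card).choose m * H.card ^ m : ℕ) : ℝ) := by push_cast; ring
      _ ≤ ((H.card.choose m * (H.card - W.card) ^ m : ℕ) : ℝ) := by exact_mod_cast this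
      _ = _ := by push_cast; ring
  · exact_mod_cast Nat.choose_pos hm
  · positivity

/-- The probability that the first `m` values of a random injection lie in `P`. -/
theorem mean_embedding_le {α : Type*} [Fintype α] [DecidableEq α] (P : Finset α) (n m : ℕ)
    (hm : m ≤ n) :
    mean (fun e : Fin n ↪ α => if ∀ i : Fin n, (i : ℕ) < m → e i ∈ P then (1 : ℝ) else 0) ≤
      ((P.card : ℝ) / Fintype.card α) ^ m := by
  rcases isEmpty_or_nonempty (Fin n ↪ α) with hE | hE
  · rw [mean_eq]; simp only [Finset.univ_eq_empty, Finset.sum_empty, zero_div]; positivity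
  obtain ⟨k, rfl⟩ := Nat.exists_eq_add_of_le hm
  have hcard : m + k ≤ Fintype.card α := by
    have := Fintype.card_le_of_embedding hE.some; simpa using this
  rw [mean_indicator]
  -- An injection is its restriction to the first `m` indices together with a continuation into the
  -- complement of the range. The number `D` of continuations is the same for every restriction and
  -- cancels.
  let E1 : (Fin (m + k) ↪ α) ≃ Σ f : Fin m ↪ α, Fin k ↪ ↥(Set.range f)ᶜ :=
    (Equiv.embeddingCongr finSumFinEquiv.symm (Equiv.refl α)).trans
      Equiv.sumEmbeddingEquivSigmaEmbeddingRestricted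
  have hfib : ∀ f : Fin m ↪ α, Nat.card (Fin k ↪ ↥(Set.range f)ᶜ) =
      (Fintype.card α - m).descFactorial k := by
    intro f
    rw [Nat.card_eq_fintype_card, Fintype.card_embedding_eq, Fintype.card_fin,
      Fintype.card_compl_set]
    congr 2
    rw [Set.card_range_of_injective f.injective, Fintype.card_fin]
  set D := (Fintype.card α - m).descFactorial k with hD
  have hDpos : 0 < D := Nat.pos_of_ne_zero (by
    rw [Ne, Nat.descFactorial_eq_zero_iff_lt]; omega)
  have htot : Nat.card (Fin (m + k) ↪ α) = (Fintype.card α).descFactorial m * D := by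
    rw [Nat.card_congr E1, Nat.card_sigma, Finset.sum_congr rfl fun f _ => hfib f, Finset.sum_const,
      Finset.card_univ, Fintype.card_embedding_eq, Fintype.card_fin, smul_eq_mul]
  have hev : Nat.card {e : Fin (m + k) ↪ α // ∀ i : Fin (m + k), (i : ℕ) < m → e i ∈ P} =
      P.card.descFactorial m * D := by
    have e2 : {e : Fin (m + k) ↪ α // ∀ i : Fin (m + k), (i : ℕ) < m → e i ∈ P} ≃
        {p : Σ f : Fin m ↪ α, Fin k ↪ ↥(Set.range f)ᶜ // ∀ i, p.1 i ∈ P} :=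
      E1.subtypeEquiv fun e => by
        constructor
        · intro h i
          exact h (Fin.castAdd k i) (by simp)
        · intro h i hi
          have := h ⟨i, hi⟩
          exact this
    have e3 : {p : Σ f : Fin m ↪ α, Fin k ↪ ↥(Set.range f)ᶜ // ∀ i, p.1 i ∈ P} ≃
        Σ f : {f : Fin m ↪ α // ∀ i, f i ∈ P}, Fin k ↪ ↥(Set.range f.1)ᶜ :=
      { toFun := fun p => ⟨⟨p.1.1, p.2⟩, p.1.2⟩
        invFun := fun p => ⟨⟨p.1.1, p.2⟩, p.1.2⟩
        left_inv := fun _ => rfl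
        right_inv := fun _ => rfl }
    have e4 : {f : Fin m ↪ α // ∀ i, f i ∈ P} ≃ (Fin m ↪ {x // x ∈ P}) :=
      { toFun := fun f => ⟨fun i => ⟨f.1 i, f.2 i⟩, fun i j h => f.1.injective (by simpa using h)⟩
        invFun := fun f => ⟨f.trans (Function.Embedding.subtype _), fun i => (f i).2⟩
        left_inv := fun _ => rfl
        right_inv := fun _ => rfl }
    rw [Nat.card_congr (e2.trans e3), Nat.card_sigma,
      Finset.sum_congr rfl fun f _ => hfib f.1, Finset.sum_const, Finset.card_univ,
      Fintype.card_congr e4, Fintype.card_embedding_eq, Fintype.card_fin, Fintype.card_coe,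
      smul_eq_mul]
  rw [htot, hev, div_pow]
  push_cast
  have hDpos' : (0 : ℝ) < D := by exact_mod_cast hDpos
  rw [mul_div_mul_right _ _ hDpos'.ne']
  rcases Nat.eq_zero_or_pos m with rfl | hm0
  · simp
  rw [div_le_div_iff₀]
  · rw [mul_comm ((P.card : ℝ) ^ m)]
    exact_mod_cast descFactorial_mul_pow_le (Finset.card_le_univ P) m
  · exact_mod_cast Nat.descFactorial_pos.mpr (by omega)
  · have : 0 < Fintype.card α := by omega
    positivity


/-! ## Ledgers -/

section Ledger

variable {M S : ℕ} {K V Tx D : Type*} (C : Config M S K V Tx D)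

/-- The second part starts from the hash of the last block of the first, or from `d` if there is
none; this matches `lastHash`. -/
theorem Config.replay_append (bs bs' : List (Block Tx D)) (d : D) (s : K → V) :
    C.replay (bs ++ bs') d s = (C.replay bs d s).bind
      (C.replay bs' ((bs.getLast?.map fun b => C.hash (.block b)).getD d)) := by
  induction bs generalizing d s with
  | nil => simp [Config.replay]
  | cons b bs ih =>
    simp only [List.cons_append, Config.replay]
    split_ifs with h
    · rw [Option.bind_assoc]
      congr 1
      funext s'
      rw [ih]
      congr 2
      cases bs with
      | nil => simp
      | cons c cs => 
        rw [List.getLast?_cons_cons]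
        rw [List.getLast?_eq_some_getLast (List.cons_ne_nil c cs)]
        rfl
    · rfl

/-- Dropped transactions leave the state alone, so each kept one is replayed in the very state in
which it was found valid. -/
theorem Config.runAll_runValid (ts : List Tx) (s : K → V) :
    C.runAll (C.runValid ts s).1 s = some (C.runValid ts s).2 := by
  induction ts generalizing s with
  | nil => rfl
  | cons t ts ih =>
    simp only [Config.runValid]
    cases h : C.applyTx s t with
    | none => exact ih s
    | some s' => simp only [Config.runAll, h, Option.bind_some, ih]

theorem Config.isLedger_append (txs : List Tx) (hC : C.IsLedger C.chain C.state) :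
    C.IsLedger (C.chain ++ [⟨C.lastHash, (C.runValid txs C.state).1⟩])
      (C.runValid txs C.state).2 := by
  unfold Config.IsLedger at hC ⊢
  rw [C.replay_append, hC, Option.bind_some]
  simp only [Config.replay, Config.lastHash, if_true, C.runAll_runValid, Option.bind_some]

theorem Config.applyTx_congr (keys : Finset K) (t : Tx) (ht : C.keysOf t ⊆ keys) (s s' : K → V)
    (h : ∀ κ ∈ keys, s κ = s' κ) :
    (C.applyTx s t = none ∧ C.applyTx s' t = none) ∨
      ∃ u u', C.applyTx s t = some u ∧ C.applyTx s' t = some u' ∧ ∀ κ ∈ keys, u κ = u' κ := by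
  unfold Config.applyTx
  have : (fun κ : {κ // κ ∈ C.keysOf t} => s κ) = fun κ : {κ // κ ∈ C.keysOf t} => s' κ := by
    funext κ; exact h _ (ht κ.2)
  rw [this]
  cases C.exec t fun κ : {κ // κ ∈ C.keysOf t} => s' κ with
  | none => left; simp
  | some w =>
    right
    refine ⟨_, _, rfl, rfl, fun κ hκ => ?_⟩
    dsimp only
    split_ifs
    · rfl
    · exact h κ hκ

/-- Transactions see the state only through their own keys. Hence it is enough for a citizen to read
the referenced keys correctly, whatever it assumes about the others. -/
theorem Config.runValid_congr (keys : Finset K) (ts : List Tx)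
    (ht : ∀ t ∈ ts, C.keysOf t ⊆ keys) (s s' : K → V) (h : ∀ κ ∈ keys, s κ = s' κ) :
    (C.runValid ts s).1 = (C.runValid ts s').1 ∧
      ∀ κ ∈ keys, (C.runValid ts s).2 κ = (C.runValid ts s').2 κ := by
  induction ts generalizing s s' with
  | nil => exact ⟨rfl, h⟩
  | cons t ts ih =>
    have ih' := ih fun t' ht' => ht t' (List.mem_cons_of_mem _ ht')
    rcases C.applyTx_congr keys t (ht t List.mem_cons_self) s s' h with
      ⟨h1, h2⟩ | ⟨u, u', h1, h2, h3⟩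
    · simpa only [Config.runValid, h1, h2] using ih' s s' h
    · have := ih' u u' h3
      simp only [Config.runValid, h1, h2]
      exact ⟨by rw [this.1], this.2⟩

theorem Config.runValid_of_notMem (ts : List Tx) (κ : K)
    (hκ : ∀ t ∈ ts, κ ∉ C.keysOf t) (s : K → V) : (C.runValid ts s).2 κ = s κ := by
  induction ts generalizing s with
  | nil => rfl
  | cons t ts ih =>
    have ih' := ih fun t' ht' => hκ t' (List.mem_cons_of_mem _ ht')
    have hs : ∀ s', C.applyTx s t = some s' → s' κ = s κ := by
      intro s' hs'
      unfold Config.applyTx at hs'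
      obtain ⟨w, -, rfl⟩ := Option.map_eq_some_iff.mp hs'
      exact dif_neg (hκ t List.mem_cons_self)
    simp only [Config.runValid]
    cases h : C.applyTx s t with
    | none => exact ih' s
    | some s' => exact (ih' s').trans (hs s' h)

end Ledger

/-! ## Merkle trees -/

theorem nodeInput_injective {K V Tx D : Type*} {q : ℕ} {x y x' y' : D}
    (h : (nodeInput q x y : HashInput K V Tx D) = nodeInput q x' y') : x = x' ∧ y = y' := by
  unfold nodeInput at h
  split_ifs at h <;> simp_all

theorem Config.Touched.half {M S : ℕ} {K V Tx D : Type*} {C : Config M S K V Tx D}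
    {keys : Finset K} {h i j : ℕ} (ht : C.Touched keys h j)
    (hj : j / 2 = i) : C.Touched keys (h + 1) i := by
  obtain ⟨κ, hκ, rfl⟩ := ht
  exact ⟨κ, hκ, (Nat.div_div_eq_div_mul _ (2 ^ h) 2).symm.trans hj⟩

section Merkle

variable {M S : ℕ} {K V Tx D : Type*} [Fintype K] (C : Config M S K V Tx D)

theorem Config.tree_succ (s : K → V) (h i : ℕ) :
    C.tree s (h + 1) i = C.hash (.node (C.tree s h (2 * i)) (C.tree s h (2 * i + 1))) := rfl

theorem Config.tree_succ_div (s : K → V) (h q : ℕ) :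
    C.tree s (h + 1) (q / 2) =
      C.hash (nodeInput q (C.tree s h q) (C.tree s h (sibling q))) := by
  rw [C.tree_succ]
  unfold nodeInput sibling
  split_ifs with hq
  · rw [show 2 * (q / 2) = q by omega]
  · rw [show 2 * (q / 2) = q - 1 by omega, show q - 1 + 1 = q by omega]

theorem Config.climb_truePath (s : K → V) (h i t : ℕ) :
    C.climb i (C.tree s h i) (C.truePath s h i) t = C.tree s (h + t) (i / 2 ^ t) := by
  induction t with
  | zero => simp [Config.climb]
  | succ t ih =>
    rw [Config.climb, ih, ← add_assoc, pow_succ, ← Nat.div_div_eq_div_mul, C.tree_succ_div]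
    rfl

/-- The hash function has no collisions on `X`. -/
def Config.InjOn (C : Config M S K V Tx D) (X : Set (HashInput K V Tx D)) : Prop :=
  ∀ x ∈ X, ∀ y ∈ X, C.hash x = C.hash y → x = y

theorem Config.treeInput_mem {h i : ℕ} (hh : h < 30) (hi : i < 2 ^ (29 - h)) :
    .node (C.tree C.state h (2 * i)) (C.tree C.state h (2 * i + 1)) ∈ C.treeInputs :=
  Or.inr ⟨h, hh, i, hi, rfl⟩

variable {C} {X : Set (HashInput K V Tx D)}

/-- Merkle binding: equal digests at the top have equal inputs, because both inputs lie in `X`.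
Descending one level at a time, the climbed digest agrees with the tree at every height. -/
theorem Config.InjOn.climb (hX : C.InjOn X) (hT : C.treeInputs ⊆ X) {h i : ℕ} {x : D} {sib : ℕ → D}
    {t : ℕ} (ht : h + t ≤ 30) (hi : i < 2 ^ (30 - h))
    (hin : ∀ t' < t, nodeInput (i / 2 ^ t') (C.climb i x sib t') (sib t') ∈ X)
    (heq : C.climb i x sib t = C.tree C.state (h + t) (i / 2 ^ t)) : x = C.tree C.state h i := by
  induction t with
  | zero => simpa [Config.climb] using heq
  | succ t ih =>
    apply ih (by omega) fun t' ht' => hin t' (by omega)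
    rw [Config.climb, ← add_assoc, pow_succ, ← Nat.div_div_eq_div_mul, C.tree_succ_div] at heq
    refine (nodeInput_injective (hX _ (hin t (by omega)) _ ?_ heq)).1
    apply hT
    have h2 : i / 2 ^ t / 2 < 2 ^ (29 - (h + t)) := by
      rw [Nat.div_div_eq_div_mul, ← pow_succ]
      apply Nat.div_lt_of_lt_mul
      rw [← pow_add]
      rwa [show t + 1 + (29 - (h + t)) = 30 - h by omega]
    have := C.treeInput_mem (h := h + t) (by omega) h2
    convert this using 1
    generalize i / 2 ^ t = q
    unfold nodeInput sibling
    split_ifs with hq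
    · rw [show 2 * (q / 2) = q by omega]
    · rw [show 2 * (q / 2) = q - 1 by omega, show q - 1 + 1 = q by omega]

theorem Config.mem_leafContent {s : K → V} {i : ℕ} {κ : K} {w : V} :
    (κ, w) ∈ C.leafContent s i ↔ (C.leafOf κ : ℕ) = i ∧ w = s κ := by
  simp only [Config.leafContent, Finset.mem_image, Finset.mem_filter, Finset.mem_univ, true_and,
    Prod.mk.injEq]
  constructor
  · rintro ⟨κ', h, rfl, rfl⟩; exact ⟨h, rfl⟩
  · rintro ⟨h, rfl⟩; exact ⟨κ, h, rfl, rfl⟩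

theorem Config.pathOK_honestPath (κ : K) : C.PathOK κ (C.state κ) (C.honestPath κ) := by
  refine ⟨Config.mem_leafContent.mpr ⟨rfl, rfl⟩, ?_⟩
  have := C.climb_truePath C.state 0 (C.leafOf κ) 30
  rw [Nat.div_eq_of_lt (C.leafOf κ).2] at this
  exact this

/-- The path binds the leaf shown to the true leaf, and the true leaf holds only one pair with key
`κ`. -/
theorem Config.InjOn.pathOK (hX : C.InjOn X) (hT : C.treeInputs ⊆ X) {κ : K} {w : V}
    {π : Path K V D} (hπ : C.pathInputs κ π ⊆ X) (h : C.PathOK κ w π) : w = C.state κ := by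
  have h1 : C.hash (.leaf π.leaf) = C.tree C.state 0 (C.leafOf κ) := by
    refine hX.climb hT (h := 0) (t := 30) (by norm_num) (C.leafOf κ).2
      (fun t ht => hπ (Or.inr ⟨t, ht, rfl⟩)) ?_
    rw [h.2, Nat.div_eq_of_lt (C.leafOf κ).2]
    rfl
  have h2 := hX _ (hπ (Or.inl rfl)) _ (hT (Or.inl ⟨C.leafOf κ, (C.leafOf κ).2, rfl⟩)) h1
  have h3 := h.1
  rw [HashInput.leaf.inj h2, Config.mem_leafContent] at h3
  exact h3.2

theorem Config.leafContent_congr {s s' : K → V} {i : ℕ}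
    (h : ∀ κ, (C.leafOf κ : ℕ) = i → s κ = s' κ) : C.leafContent s i = C.leafContent s' i := by
  ext ⟨κ, w⟩
  rw [Config.mem_leafContent, Config.mem_leafContent]
  constructor <;> rintro ⟨h1, h2⟩ <;> exact ⟨h1, by rw [h2, h κ h1]⟩

theorem Config.tree_congr {keys : Finset K} {s s' : K → V} (hs : ∀ κ ∉ keys, s κ = s' κ) {h i : ℕ}
    (ht : ¬ C.Touched keys h i) : C.tree s h i = C.tree s' h i := by
  induction h generalizing i with
  | zero =>
    change C.hash (.leaf _) = C.hash (.leaf _)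
    rw [Config.leafContent_congr fun κ hκ => hs κ fun hk => ht ⟨κ, hk, by simpa using hκ⟩]
  | succ h ih =>
    rw [C.tree_succ, C.tree_succ, ih fun h' => ht (h'.half (by omega)),
      ih fun h' => ht (h'.half (by omega))]

theorem Config.updateLeaf_leafContent {keys : Finset K} {new s' : K → V}
    (hnew : ∀ κ ∈ keys, new κ = s' κ) (hs : ∀ κ ∉ keys, C.state κ = s' κ) (i : ℕ) :
    C.updateLeaf keys new i (C.leafContent C.state i) = C.leafContent s' i := by
  ext ⟨κ, w⟩
  simp only [Config.updateLeaf, Finset.mem_union, Finset.mem_filter, Config.mem_leafContent,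
    Finset.mem_image, Prod.mk.injEq]
  constructor
  · rintro (⟨⟨h1, h2⟩, h3⟩ | ⟨κ', ⟨h1, h2⟩, rfl, rfl⟩)
    · exact ⟨h1, h2.trans (hs κ h3)⟩
    · exact ⟨h2, hnew _ h1⟩
  · rintro ⟨h1, h2⟩
    by_cases h3 : κ ∈ keys
    · exact Or.inr ⟨κ, ⟨h3, h1⟩, rfl, (hnew κ h3).trans h2.symm⟩
    · exact Or.inl ⟨⟨h1, h2.trans (hs κ h3).symm⟩, h3⟩

/-- An authenticated old digest forces, from the top down, all leaves and untouched nodes in the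
proof to be the true ones. Recomputing the digest from true old data and correct new values can only
give the new tree. -/
theorem Config.InjOn.newDigest (hX : C.InjOn X) (hT : C.treeInputs ⊆ X) {keys : Finset K}
    {new s' : K → V} (hnew : ∀ κ ∈ keys, new κ = s' κ) (hs : ∀ κ ∉ keys, C.state κ = s' κ)
    {π : UpdateProof K V D} {h i : ℕ} (hh : h ≤ 30) (hi : i < 2 ^ (30 - h))
    (hin : C.oldInputs keys π h i ⊆ X) (hold : C.oldDigest keys π h i = C.tree C.state h i) :
    C.newDigest keys new π h i = C.tree s' h i := by
  induction h generalizing i with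
  | zero =>
    unfold Config.oldDigest at hold
    unfold Config.newDigest
    unfold Config.oldInputs at hin
    split_ifs at hold hin ⊢ with ht
    · have := hX _ (hin rfl) _ (hT (Or.inl ⟨i, hi, rfl⟩)) hold
      rw [HashInput.leaf.inj this, Config.updateLeaf_leafContent hnew hs]
      rfl
    · rw [hold, Config.tree_congr hs ht]
  | succ h ih =>
    unfold Config.oldDigest at hold
    unfold Config.newDigest
    unfold Config.oldInputs at hin
    split_ifs at hold hin ⊢ with ht
    · have hi' : i < 2 ^ (29 - h) := by rwa [show 30 - (h + 1) = 29 - h by omega] at hi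
      have := hX _ (hin (Or.inl (Or.inl rfl))) _ (hT (C.treeInput_mem (by omega) hi')) hold
      obtain ⟨h1, h2⟩ := HashInput.node.inj this
      have h3 : 2 ^ (30 - h) = 2 * 2 ^ (29 - h) := by
        rw [← pow_succ', show 29 - h + 1 = 30 - h by omega]
      rw [C.tree_succ, ih (by omega) (by omega) (fun x hx => hin (Or.inl (Or.inr hx))) h1,
        ih (by omega) (by omega) (fun x hx => hin (Or.inr hx)) h2]
    · rw [hold, Config.tree_congr hs ht]

theorem Config.oldDigest_honestProof (keys : Finset K) (f h i : ℕ) :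
    C.oldDigest keys (C.honestProof f) h i = C.tree C.state h i := by
  induction h generalizing i with
  | zero => unfold Config.oldDigest; split_ifs <;> rfl
  | succ h ih => unfold Config.oldDigest; rw [ih, ih]; split_ifs <;> rfl

theorem Config.newDigest_honestProof {keys : Finset K} {new s' : K → V}
    (hnew : ∀ κ ∈ keys, new κ = s' κ) (hs : ∀ κ ∉ keys, C.state κ = s' κ) (f h i : ℕ) :
    C.newDigest keys new (C.honestProof f) h i = C.tree s' h i := by
  induction h generalizing i with
  | zero =>
    unfold Config.newDigest
    split_ifs with ht
    · change C.hash (.leaf (C.updateLeaf keys new i (C.leafContent C.state i))) = _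
      rw [Config.updateLeaf_leafContent hnew hs]
      rfl
    · exact Config.tree_congr hs ht
  | succ h ih =>
    unfold Config.newDigest
    rw [ih, ih]
    split_ifs with ht
    · rfl
    · exact Config.tree_congr hs ht

theorem Config.updateOK_honestProof {keys : Finset K} {new s' : K → V}
    (hnew : ∀ κ ∈ keys, new κ = s' κ) (hs : ∀ κ ∉ keys, C.state κ = s' κ) {f : ℕ}
    (hf : f < 2 ^ 13) : C.UpdateOK keys new f (C.tree s' 17 f) (C.honestProof f) := by
  refine ⟨?_, Config.newDigest_honestProof hnew hs f 17 f⟩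
  rw [Config.oldDigest_honestProof]
  have := C.climb_truePath C.state 17 f 13
  rw [Nat.div_eq_of_lt hf] at this
  exact this

theorem Config.InjOn.updateOK (hX : C.InjOn X) (hT : C.treeInputs ⊆ X) {keys : Finset K}
    {new s' : K → V} (hnew : ∀ κ ∈ keys, new κ = s' κ) (hs : ∀ κ ∉ keys, C.state κ = s' κ)
    {f : ℕ} (hf : f < 2 ^ 13) {y : D} {π : UpdateProof K V D}
    (hin : C.updateInputs keys f π ⊆ X) (h : C.UpdateOK keys new f y π) :
    y = C.tree s' 17 f := by
  rw [← h.2]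
  refine hX.newDigest hT hnew hs (by norm_num) hf (fun x hx => hin (Or.inl hx)) ?_
  refine hX.climb hT (h := 17) (t := 13) (by norm_num) hf
    (fun t ht => hin (Or.inr ⟨t, ht, rfl⟩)) ?_
  rw [h.1, Nat.div_eq_of_lt hf]
  rfl

theorem Config.build_tree {base : ℕ → D} {s : K → V} {h₀ n : ℕ}
    (hb : ∀ i < n, base i = C.tree s h₀ i) {h i : ℕ} (hi : (i + 1) * 2 ^ h ≤ n) :
    C.build base h i = C.tree s (h₀ + h) i := by
  induction h generalizing i with
  | zero => exact hb i (by simpa using hi)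
  | succ h ih =>
    rw [pow_succ] at hi
    have h1 : 0 < 2 ^ h := by positivity
    rw [Config.build, ← add_assoc, C.tree_succ, ih (by nlinarith), ih (by nlinarith)]

end Merkle

/-! ## Correction by exception lists -/

section Correction

variable {X Y : Type*} {τ : ℕ} {listed : Fin 25 → X → Prop} {claim : Fin 25 → X → Y}
  {ok : Fin 25 → X → Prop}

theorem correctStep_asked (st : CorrState X Y) (p a : Fin 25 × X) (h : a ∈ st.asked) :
    a ∈ (correctStep τ listed claim ok st p).asked := by
  unfold correctStep
  split_ifs
  · exact List.mem_cons_of_mem _ h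
  · exact List.mem_cons_of_mem _ h
  · exact h

theorem foldl_correctStep_asked (l : List (Fin 25 × X)) (st : CorrState X Y) (a : Fin 25 × X)
    (h : a ∈ st.asked) : a ∈ (l.foldl (correctStep τ listed claim ok) st).asked := by
  induction l generalizing st with
  | nil => exact h
  | cons p l ih => exact ih _ (correctStep_asked st p a h)

open scoped Classical in
/-- The invariant of the correction of the items `F`, where the politician `i` is honest. -/
structure CorrInv (τ : ℕ) (F : Finset X) (truth init : X → Y) (i : Fin 25) (st : CorrState X Y) :
    Prop where
  notBad : i ∉ st.bad
  budget : st.fixed + (F.filter fun x => st.cur x ≠ truth x).card ≤ τ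
  wrong : ∀ x, st.cur x ≠ truth x → init x ≠ truth x

variable {F : Finset X} {truth init : X → Y} {i : Fin 25}

/-- Proofs that verify are truthful, so a correction never spoils a right value. It spends one unit
of budget and removes at least one wrong item, which keeps their sum at most `τ`. The honest
politician always proves its claims and is never dropped; its list, made for the initial values,
still covers every value that is wrong now. -/
theorem correctStep_inv (hi : ∀ x ∈ F, claim i x = truth x) (hok : ∀ x ∈ F, ok i x)
    (hl : ∀ x ∈ F, init x ≠ truth x → listed i x) {st : CorrState X Y} {p : Fin 25 × X}
    (hp : p.2 ∈ F) (hinv : CorrInv τ F truth init i st)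
    (hask : ∀ a ∈ (correctStep τ listed claim ok st p).asked,
      ok a.1 a.2 → claim a.1 a.2 = truth a.2) :
    CorrInv τ F truth init i (correctStep τ listed claim ok st p) ∧
      (∀ x, st.cur x = truth x → (correctStep τ listed claim ok st p).cur x = truth x) ∧
      (p.1 = i → (correctStep τ listed claim ok st p).cur p.2 = truth p.2) := by
  classical
  unfold correctStep at hask ⊢
  split_ifs at hask ⊢ with h1 h2
  · have hc : claim p.1 p.2 = truth p.2 := hask p List.mem_cons_self h2
    have hst : ∀ x, st.cur x = truth x →
        Function.update st.cur p.2 (claim p.1 p.2) x = truth x := by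
      intro x hx
      by_cases hxp : x = p.2
      · subst hxp; rw [Function.update_self, hc]
      · rw [Function.update_of_ne hxp, hx]
    refine ⟨⟨hinv.notBad, ?_, fun x hx => hinv.wrong x fun h => hx (hst x h)⟩, hst, fun _ => ?_⟩
    · have hss : (F.filter fun x => Function.update st.cur p.2 (claim p.1 p.2) x ≠ truth x) ⊂
          F.filter fun x => st.cur x ≠ truth x := by
        rw [Finset.ssubset_iff_of_subset]
        · refine ⟨p.2, ?_, ?_⟩
          · rw [Finset.mem_filter]
            exact ⟨hp, fun h => h1.2.2.2 (hc.trans h.symm)⟩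
          · rw [Finset.mem_filter, Function.update_self]
            exact fun h => h.2 hc
        · intro x
          simp only [Finset.mem_filter]
          exact fun h => ⟨h.1, fun h' => h.2 (hst x h')⟩
      have := Finset.card_lt_card hss
      have := hinv.budget
      dsimp only
      omega
    · dsimp only
      rw [Function.update_self, hc]
  · have hpi : p.1 ≠ i := by
      rintro rfl
      exact h2 (hok _ hp)
    refine ⟨⟨?_, hinv.budget, hinv.wrong⟩, fun x hx => hx, fun h => absurd h hpi⟩
    rw [Finset.mem_insert, not_or]
    exact ⟨hpi.symm, hinv.notBad⟩
  · refine ⟨hinv, fun x hx => hx, ?_⟩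
    rintro rfl
    -- A remaining wrong item leaves room in the budget, so the honest politician's item could not
    -- have been skipped.
    by_contra hne
    apply h1
    refine ⟨?_, hinv.notBad, hl _ hp (hinv.wrong _ hne), fun h => hne (h.symm.trans (hi _ hp))⟩
    have : 0 < (F.filter fun x => st.cur x ≠ truth x).card :=
      Finset.card_pos.mpr ⟨p.2, Finset.mem_filter.mpr ⟨hp, hne⟩⟩
    have := hinv.budget
    omega

theorem foldl_correctStep (hi : ∀ x ∈ F, claim i x = truth x) (hok : ∀ x ∈ F, ok i x)
    (hl : ∀ x ∈ F, init x ≠ truth x → listed i x) (l : List (Fin 25 × X)) (st : CorrState X Y)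
    (hlF : ∀ p ∈ l, p.2 ∈ F) (hinv : CorrInv τ F truth init i st)
    (hask : ∀ a ∈ (l.foldl (correctStep τ listed claim ok) st).asked,
      ok a.1 a.2 → claim a.1 a.2 = truth a.2) :
    (∀ x, st.cur x = truth x → (l.foldl (correctStep τ listed claim ok) st).cur x = truth x) ∧
      ∀ x, (i, x) ∈ l → (l.foldl (correctStep τ listed claim ok) st).cur x = truth x := by
  induction l generalizing st with
  | nil => exact ⟨fun x h => h, fun x h => by simp at h⟩
  | cons p l ih =>
    rw [List.foldl_cons] at hask ⊢
    obtain ⟨h1, h2, h3⟩ := correctStep_inv hi hok hl (hlF p List.mem_cons_self) hinv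
      fun a ha => hask a (foldl_correctStep_asked l _ a ha)
    obtain ⟨h4, h5⟩ := ih _ (fun q hq => hlF q (List.mem_cons_of_mem _ hq)) h1 hask
    refine ⟨fun x hx => h4 x (h2 x hx), fun x hx => ?_⟩
    rcases List.mem_cons.mp hx with rfl | hx
    · exact h4 x (h3 rfl)
    · exact h5 x hx

open scoped Classical in
/-- The correction repairs all values if at most `τ` of them are wrong, some politician is honest,
and the proofs that verify are right. -/
theorem correct_cur (items : List X) (hi : ∀ x ∈ items, claim i x = truth x)
    (hok : ∀ x ∈ items, ok i x) (hl : ∀ x ∈ items, init x ≠ truth x → listed i x)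
    (hτ : (items.toFinset.filter fun x => init x ≠ truth x).card ≤ τ)
    (hask : ∀ a ∈ (correct τ items listed claim ok init).asked,
      ok a.1 a.2 → claim a.1 a.2 = truth a.2) (x : X) (hx : x ∈ items) :
    (correct τ items listed claim ok init).cur x = truth x := by
  refine (foldl_correctStep (F := items.toFinset) (init := init) (i := i) (by simpa using hi)
    (by simpa using hok) (by simpa using hl) _ ⟨init, 0, ∅, []⟩ ?_ ?_ hask).2 x ?_
  · intro p hp
    simp only [List.mem_flatMap, List.mem_map] at hp
    obtain ⟨j, -, y, hy, rfl⟩ := hp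
    simpa using hy
  · exact ⟨by simp, by simpa using hτ, fun _ h => h⟩
  · simp only [List.mem_flatMap, List.mem_map]
    exact ⟨i, List.mem_finRange i, x, hx, rfl⟩

theorem firstPass_spec {P : Fin 25 → Prop} {j : Fin 25} (h : firstPass P = some j) :
    P j ∧ ∀ i < j, ¬ P i := by
  classical
  unfold firstPass at h
  rw [List.find?_eq_some_iff_getElem] at h
  obtain ⟨h1, n, hn, rfl, h2⟩ := h
  refine ⟨by simpa using h1, fun i hi => ?_⟩
  have := h2 i (by simpa [Fin.lt_def] using hi)
  simpa using this

theorem exists_firstPass {P : Fin 25 → Prop} {j : Fin 25} (h : P j) :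
    ∃ i ≤ j, firstPass P = some i := by
  classical
  cases hf : firstPass P with
  | none =>
    unfold firstPass at hf
    rw [List.find?_eq_none] at hf
    exact absurd h (by simpa using hf j (List.mem_finRange j))
  | some i =>
    refine ⟨i, ?_, rfl⟩
    by_contra hij
    exact (firstPass_spec hf).2 j (not_le.mp hij) h

end Correction


/-! ## Byzantine agreement -/

section Agreement

variable {R M S : ℕ} {K V Tx D : Type*} (C : Config M S K V Tx D)

theorem Config.good_subset (σ : Setup M S) : C.good σ ⊆ σ.committee := by
  classical
  exact Finset.filter_subset _ _

/-- Good citizens form a reliable synchronous network; only the other members can tell different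
things to different receivers. -/
theorem Config.deliver_good {α : Type*} {σ : Setup M S} (sent : Fin M → α)
    (adv : Fin M → Fin M → α) {v j : Fin M} (hv : v ∈ C.good σ) (hj : j ∈ C.good σ) :
    C.deliver σ sent adv v j = sent j := by
  classical
  simp only [Config.good, Finset.mem_filter] at hv hj
  exact if_pos ⟨hj.2.1, hj.2.2, hv.2.2⟩

theorem Setup.count_eq (σ : Setup M S) (P : Fin M → Prop) [DecidablePred P] :
    σ.count P = (σ.committee.filter P).card := by
  unfold Setup.count
  congr!

theorem Config.card_le_count (σ : Setup M S) (P : Fin M → Prop) [DecidablePred P] :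
    ((C.good σ).filter P).card ≤ σ.count P := by
  rw [σ.count_eq]
  exact Finset.card_le_card (Finset.filter_subset_filter _ (C.good_subset σ))

/-- Apart from the good members with `P`, at most the `n - g` members that are not good can be
counted; the form avoids subtraction of naturals. -/
theorem Config.count_le (σ : Setup M S) (P : Fin M → Prop) [DecidablePred P] :
    σ.count P + (C.good σ).card ≤ ((C.good σ).filter P).card + σ.committee.card := by
  classical
  rw [σ.count_eq, ← Finset.card_sdiff_add_card_eq_card (C.good_subset σ)]
  have : (σ.committee.filter P).card ≤
      ((C.good σ).filter P ∪ (σ.committee \ C.good σ)).card := by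
    apply Finset.card_le_card
    intro v
    simp only [Finset.mem_filter, Finset.mem_union, Finset.mem_sdiff]
    tauto
  have := this.trans (Finset.card_union_le _ _)
  omega

/-- More than two thirds of the committee members are good. -/
def Config.GoodMajority (σ : Setup M S) : Prop :=
  2 * σ.committee.card < 3 * (C.good σ).card

variable {C} {σ : Setup M S}

/-- Quorum intersection. Were the good parts of the two quorums disjoint, adding both counts would
give 4n < 6n - 3g, against 2n < 3g. -/
theorem Config.GoodMajority.exists_of_twoThirds (hσ : C.GoodMajority σ) {P Q : Fin M → Prop}
    (hP : σ.TwoThirds P) (hQ : σ.TwoThirds Q) : ∃ j ∈ C.good σ, P j ∧ Q j := by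
  classical
  by_contra! hn
  have h1 := C.count_le σ P
  have h2 := C.count_le σ Q
  have h3 : ((C.good σ).filter P).card + ((C.good σ).filter Q).card ≤ (C.good σ).card := by
    rw [← Finset.card_union_of_disjoint]
    · exact Finset.card_le_card (Finset.union_subset (Finset.filter_subset _ _)
        (Finset.filter_subset _ _))
    · rw [Finset.disjoint_filter]
      exact hn
  unfold Setup.TwoThirds at hP hQ
  unfold Config.GoodMajority at hσ
  omega

theorem Config.GoodMajority.twoThirds (hσ : C.GoodMajority σ) {P : Fin M → Prop}
    (h : ∀ j ∈ C.good σ, P j) : σ.TwoThirds P := by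
  classical
  have := C.card_le_count σ P
  rw [Finset.filter_true_of_mem h] at this
  unfold Setup.TwoThirds
  unfold Config.GoodMajority at hσ
  omega

theorem Config.GoodMajority.exists_of_oneThird (hσ : C.GoodMajority σ) {P : Fin M → Prop}
    (hP : σ.OneThird P) : ∃ j ∈ C.good σ, P j := by
  classical
  by_contra! hn
  have h1 := C.count_le σ P
  rw [Finset.filter_false_of_mem hn, Finset.card_empty] at h1
  unfold Setup.OneThird at hP
  unfold Config.GoodMajority at hσ
  omega

theorem Config.GoodMajority.nonempty (hσ : C.GoodMajority σ) : (C.good σ).Nonempty := by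
  rw [← Finset.card_pos]
  unfold Config.GoodMajority at hσ
  omega

/-! ### Steps of the binary agreement -/

/-- All good citizens have bit `b`, and they have not halted with another output. -/
def Config.Unanimous (C : Config M S K V Tx D) (σ : Setup M S) (b : Bool)
    (st : Fin M → BitState) : Prop :=
  ∀ v ∈ C.good σ, (st v).bit = b ∧ ((st v).out = none ∨ (st v).out = some b)

/-- All good citizens have halted with output `b`. -/
def Config.Halted (C : Config M S K V Tx D) (σ : Setup M S) (b : Bool)
    (st : Fin M → BitState) : Prop :=
  ∀ v ∈ C.good σ, (st v).out = some b

/-- No good citizen has halted. -/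
def Config.Running (C : Config M S K V Tx D) (σ : Setup M S) (st : Fin M → BitState) : Prop :=
  ∀ v ∈ C.good σ, (st v).out = none

variable {st : Fin M → BitState} {recv : Fin M → Fin M → Option Bool} {b c : Bool}

theorem Config.GoodMajority.unanimous_fixedStep (hσ : C.GoodMajority σ)
    (hr : ∀ v ∈ C.good σ, ∀ j ∈ C.good σ, recv v j = some (st j).bit)
    (h : C.Unanimous σ b st) :
    C.Unanimous σ b (fun v => fixedStep σ c (recv v) (st v)) ∧
      (c = b → C.Halted σ b (fun v => fixedStep σ c (recv v) (st v))) := by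
  have key : ∀ v ∈ C.good σ, (fixedStep σ c (recv v) (st v)).bit = b ∧
      ((fixedStep σ c (recv v) (st v)).out = none ∨
        (fixedStep σ c (recv v) (st v)).out = some b) ∧
      (c = b → (fixedStep σ c (recv v) (st v)).out = some b) := by
    intro v hv
    have h1 : σ.TwoThirds fun j => recv v j = some b :=
      hσ.twoThirds fun j hj => by rw [hr v hv j hj, (h j hj).1]
    have h2 : ¬ σ.TwoThirds fun j => recv v j = some (!b) := fun h3 => by
      obtain ⟨j, -, h4, h5⟩ := hσ.exists_of_twoThirds h1 h3
      rw [h4] at h5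
      cases b <;> simp at h5
    obtain ⟨h3, h4⟩ := h v hv
    unfold fixedStep
    rcases h4 with h4 | h4
    · rw [h4]
      by_cases hcb : c = b
      · subst hcb
        simp [h1]
      · have : b = !c := by cases b <;> cases c <;> simp_all
        subst this
        simp only [Bool.not_not] at h2
        simp [h1, h2]
    · simp [h4, h3]
  exact ⟨fun v hv => ⟨(key v hv).1, (key v hv).2.1⟩, fun hc v hv => (key v hv).2.2 hc⟩

theorem Config.GoodMajority.unanimous_coinStep (hσ : C.GoodMajority σ) {coin : Fin M → Vrf}
    (hr : ∀ v ∈ C.good σ, ∀ j ∈ C.good σ, recv v j = some (st j).bit)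
    (h : C.Unanimous σ b st) :
    C.Unanimous σ b (fun v => coinStep σ coin (recv v) (st v)) := by
  intro v hv
  have h1 : σ.TwoThirds fun j => recv v j = some b :=
    hσ.twoThirds fun j hj => by rw [hr v hv j hj, (h j hj).1]
  have h2 : ¬ σ.TwoThirds fun j => recv v j = some (!b) := fun h3 => by
    obtain ⟨j, -, h4, h5⟩ := hσ.exists_of_twoThirds h1 h3
    rw [h4] at h5
    cases b <;> simp at h5
  obtain ⟨h3, h4⟩ := h v hv
  dsimp only
  unfold coinStep
  rcases h4 with h4 | h4
  · rw [h4]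
    cases b
    · simp [h1]
    · simp only [Bool.not_true] at h2
      simp [h1, h2]
  · simp [h4, h3]

theorem Config.Halted.fixedStep (h : C.Halted σ b st) :
    C.Halted σ b (fun v => fixedStep σ c (recv v) (st v)) := by
  intro v hv
  simp [Blockene.fixedStep, h v hv]

theorem Config.Halted.coinStep {coin : Fin M → Vrf} (h : C.Halted σ b st) :
    C.Halted σ b (fun v => coinStep σ coin (recv v) (st v)) := by
  intro v hv
  simp [Blockene.coinStep, h v hv]

/-- Halting here needs a quorum for `c`. By quorum intersection no good citizen can then see a
quorum for the other bit, so each takes `c`, from its own quorum or from the fixed coin. -/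
theorem Config.GoodMajority.running_fixedStep (hσ : C.GoodMajority σ)
    (hr : ∀ v ∈ C.good σ, ∀ j ∈ C.good σ, recv v j = some (st j).bit)
    (h : C.Running σ st) :
    C.Running σ (fun v => fixedStep σ c (recv v) (st v)) ∨
      C.Unanimous σ c (fun v => fixedStep σ c (recv v) (st v)) := by
  classical
  by_cases hh : ∃ v ∈ C.good σ, σ.TwoThirds fun j => recv v j = some c
  · right
    obtain ⟨v, hv, h1⟩ := hh
    intro w hw
    have h2 : ¬ σ.TwoThirds fun j => recv w j = some (!c) := fun h3 => by
      obtain ⟨j, hj, h4, h5⟩ := hσ.exists_of_twoThirds h1 h3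
      rw [hr v hv j hj] at h4
      rw [hr w hw j hj, h4] at h5
      cases c <;> simp at h5
    simp only [fixedStep, h w hw, h2]
    split_ifs <;> simp_all
  · left
    push Not at hh
    intro v hv
    simp only [fixedStep, h v hv, hh v hv]
    split_ifs <;> simp_all

/-- A VRF with a given last bit that is less than `2`. -/
def bitVrf (b : Bool) : Vrf := if b then ⟨1, by norm_num⟩ else ⟨0, by norm_num⟩

theorem bitVrf_val (b : Bool) : (bitVrf b : ℕ) = if b then 1 else 0 := by
  cases b <;> rfl

/-- The coins of a phase in which all good citizens flip `b`. -/
def Config.LuckyCoins (C : Config M S K V Tx D) (σ : Setup M S) (coin : Fin M → Vrf) (b : Bool) :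
    Prop :=
  (∀ v ∈ C.good σ, coin v = bitVrf b) ∧
    ∀ v ∈ σ.committee, v ∉ C.good σ → coin v = ⟨2, by norm_num⟩

open scoped Classical in
/-- The only bit that the coin-flipping step can hold fixed. -/
noncomputable def Config.target (C : Config M S K V Tx D) (σ : Setup M S)
    (st : Fin M → BitState) : Bool :=
  decide (2 * σ.committee.card + 3 * (C.good σ).card <
    3 * (((C.good σ).filter fun v => (st v).bit = true).card + σ.committee.card))

/-- Members outside the good set may show their VRFs selectively. Since theirs equal 2, which
exceeds both values of `bitVrf`, the minimum is the same in every view. -/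
theorem Config.LuckyCoins.least {coin : Fin M → Vrf} (h : C.LuckyCoins σ coin b)
    (hσ : C.GoodMajority σ) {recv : Fin M → Option Bool}
    (hr : ∀ j ∈ C.good σ, recv j ≠ none) :
    sInf {x : ℕ | ∃ j ∈ σ.committee, recv j ≠ none ∧ x = coin j} = (bitVrf b : ℕ) := by
  obtain ⟨v, hv⟩ := hσ.nonempty
  have hmem : (bitVrf b : ℕ) ∈ {x : ℕ | ∃ j ∈ σ.committee, recv j ≠ none ∧ x = coin j} :=
    ⟨v, C.good_subset σ hv, hr v hv, by rw [h.1 v hv]⟩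
  apply le_antisymm (Nat.sInf_le hmem)
  obtain ⟨j, hj, -, h2⟩ := Nat.sInf_mem ⟨_, hmem⟩
  rw [h2]
  by_cases hg : j ∈ C.good σ
  · rw [h.1 j hg]
  · rw [h.2 j hj hg, bitVrf_val]
    dsimp only
    split_ifs <;> norm_num

/-- A good citizen that sees a quorum keeps a bit that must be the target; any other flips the coin,
which shows the target. So all end with the same bit. -/
theorem Config.GoodMajority.running_coinStep (hσ : C.GoodMajority σ) {coin : Fin M → Vrf}
    (hr : ∀ v ∈ C.good σ, ∀ j ∈ C.good σ, recv v j = some (st j).bit)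
    (h : C.Running σ st) (hcoin : C.LuckyCoins σ coin (C.target σ st)) :
    C.Unanimous σ (C.target σ st) (fun v => coinStep σ coin (recv v) (st v)) := by
  classical
  intro v hv
  -- A necessary condition for a quorum for `b` that depends only on the good citizens' bits: at
  -- best all members that are not good join in.
  have key : ∀ b, (σ.TwoThirds fun j => recv v j = some b) → 2 * σ.committee.card +
      3 * (C.good σ).card < 3 * (((C.good σ).filter fun v => (st v).bit = b).card +
        σ.committee.card) := by
    intro b hb
    have h1 := C.count_le σ fun j => recv v j = some b
    have h2 : ((C.good σ).filter fun j => recv v j = some b) =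
        (C.good σ).filter fun j => (st j).bit = b :=
      Finset.filter_congr fun j hj => by rw [hr v hv j hj, Option.some_inj]
    rw [h2] at h1
    unfold Setup.TwoThirds at hb
    omega
  have hsum : ((C.good σ).filter fun v => (st v).bit = true).card +
      ((C.good σ).filter fun v => (st v).bit = false).card = (C.good σ).card := by
    rw [← Finset.card_filter_add_card_filter_not (s := C.good σ) fun v => (st v).bit = true]
    simp
  -- If the condition held for both bits, the sum of the two inequalities would contradict 3g > 2n.
  have hF : (σ.TwoThirds fun j => recv v j = some false) → C.target σ st = false := by
    intro h1
    have := key _ h1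
    unfold Config.target
    unfold Config.GoodMajority at hσ
    rw [decide_eq_false_iff_not]
    omega
  have hT : (σ.TwoThirds fun j => recv v j = some true) → C.target σ st = true :=
    fun h1 => decide_eq_true (key _ h1)
  have hL := hcoin.least hσ (recv := recv v) fun j hj => by rw [hr v hv j hj]; simp
  simp only [coinStep, h v hv, hL, bitVrf_val]
  split_ifs with h1 h2 h3 h4 <;> simp_all

end Agreement

/-! ### The phases of the binary agreement -/

section Phases

variable {R M S : ℕ} {K V Tx D : Type*} (C : Config M S K V Tx D)
  (A : Adversary R M S K V Tx D) (ω : Tape R M S K)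

/-- The states after the first step of a phase. -/
noncomputable def Config.stateOne (r : ℕ) (st : Fin M → BitState) : Fin M → BitState :=
  fun v => fixedStep ω.setup false (C.bitsOf A ω r 0 (3 + r) st v) (st v)

/-- The states after the second step of a phase. -/
noncomputable def Config.stateTwo (r : ℕ) (st : Fin M → BitState) : Fin M → BitState :=
  fun v => fixedStep ω.setup true (C.bitsOf A ω r 1 (3 + r) (C.stateOne A ω r st) v)
    (C.stateOne A ω r st v)

theorem Config.phase_eq (r : Fin R) (st : Fin M → BitState) :
    C.phase A ω r st = fun v => coinStep ω.setup (ω.coin r)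
      (C.bitsOf A ω r 2 (3 + r + 1) (C.stateTwo A ω r st) v) (C.stateTwo A ω r st v) := rfl

open scoped Classical in
/-- The states after `m` phases. -/
noncomputable def Config.bitState {R M S : ℕ} {K V Tx D : Type*} (C : Config M S K V Tx D)
    (A : Adversary R M S K V Tx D) (ω : Tape R M S K) : ℕ → Fin M → BitState
  | 0 => fun v => ⟨decide (¬ C.Grade2 A ω v), none⟩
  | m + 1 => if h : m < R then C.phase A ω ⟨m, h⟩ (C.bitState A ω m) else C.bitState A ω m

theorem Config.bitAgreement_eq : C.bitAgreement A ω = C.bitState A ω R := by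
  classical
  have key : ∀ m ≤ R, ((List.finRange R).take m).foldl (fun st r => C.phase A ω r st)
      (C.bitState A ω 0) = C.bitState A ω m := by
    intro m
    induction m with
    | zero => intro _; simp
    | succ m ih =>
      intro hm
      rw [List.take_succ_eq_append_getElem (by simpa using hm), List.foldl_append,
        ih (by omega), Config.bitState, dif_pos (show m < R by omega)]
      simp
  have := key R le_rfl
  rw [List.take_of_length_le (by simp)] at this
  exact this

theorem Config.bitsOf_good (r : ℕ) (step : Fin 3) (t : ℕ) (st : Fin M → BitState) :
    ∀ v ∈ C.good ω.setup, ∀ j ∈ C.good ω.setup,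
      C.bitsOf A ω r step t st v j = some (st j).bit :=
  fun _ hv _ hj => C.deliver_good _ _ hv hj

variable {C A ω} {b : Bool}

theorem Config.GoodMajority.unanimous_phase (hσ : C.GoodMajority ω.setup) {r : Fin R}
    {st : Fin M → BitState} (h : C.Unanimous ω.setup b st) :
    C.Unanimous ω.setup b (C.phase A ω r st) ∧ C.Halted ω.setup b (C.phase A ω r st) := by
  rw [Config.phase_eq]
  have h1 := hσ.unanimous_fixedStep (c := false) (C.bitsOf_good A ω r 0 (3 + r) st) h
  have h2 := hσ.unanimous_fixedStep (c := true)
    (C.bitsOf_good A ω r 1 (3 + r) (C.stateOne A ω r st)) h1.1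
  refine ⟨hσ.unanimous_coinStep (C.bitsOf_good A ω r 2 (3 + r + 1) _) h2.1, ?_⟩
  apply Config.Halted.coinStep
  cases b
  · exact (h1.2 rfl).fixedStep
  · exact h2.2 rfl

theorem Config.Halted.phase {r : Fin R} {st : Fin M → BitState} (h : C.Halted ω.setup b st) :
    C.Halted ω.setup b (C.phase A ω r st) := by
  rw [Config.phase_eq]
  exact h.fixedStep.fixedStep.coinStep

theorem Config.GoodMajority.stateTwo (hσ : C.GoodMajority ω.setup) {r : ℕ}
    {st : Fin M → BitState}
    (h : C.Running ω.setup st ∨ ∃ b, C.Unanimous ω.setup b st) :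
    C.Running ω.setup (C.stateTwo A ω r st) ∨
      ∃ b, C.Unanimous ω.setup b (C.stateTwo A ω r st) := by
  have h1 : C.Running ω.setup (C.stateOne A ω r st) ∨
      ∃ b, C.Unanimous ω.setup b (C.stateOne A ω r st) := by
    rcases h with h | ⟨b, h⟩
    · exact (hσ.running_fixedStep (C.bitsOf_good A ω r 0 (3 + r) st) h).imp_right fun h => ⟨_, h⟩
    · exact Or.inr ⟨b, (hσ.unanimous_fixedStep (C.bitsOf_good A ω r 0 (3 + r) st) h).1⟩
  rcases h1 with h | ⟨b, h⟩
  · exact (hσ.running_fixedStep (C.bitsOf_good A ω r 1 (3 + r) _) h).imp_right fun h => ⟨_, h⟩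
  · exact Or.inr ⟨b, (hσ.unanimous_fixedStep (C.bitsOf_good A ω r 1 (3 + r) _) h).1⟩

/-- Invariant between phases: either no good citizen has halted, or all good citizens agree. Mixed
situations cannot arise, because the first halt already forces agreement. -/
theorem Config.GoodMajority.phase_cases (hσ : C.GoodMajority ω.setup) {r : Fin R}
    {st : Fin M → BitState}
    (h : C.Running ω.setup st ∨ ∃ b, C.Unanimous ω.setup b st) :
    (C.Running ω.setup (C.phase A ω r st) ∨ ∃ b, C.Unanimous ω.setup b (C.phase A ω r st)) ∧
      (C.LuckyCoins ω.setup (ω.coin r) (C.target ω.setup (C.stateTwo A ω r st)) →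
        ∃ b, C.Unanimous ω.setup b (C.phase A ω r st)) := by
  classical
  rw [Config.phase_eq]
  have hr := C.bitsOf_good A ω r 2 (3 + r + 1) (C.stateTwo A ω r st)
  rcases hσ.stateTwo (A := A) (r := r) h with h | ⟨b, h⟩
  · refine ⟨Or.inl fun v hv => ?_, fun hl => ⟨_, hσ.running_coinStep hr h hl⟩⟩
    simp only [coinStep, h v hv]
    split_ifs <;> simp_all
  · have := hσ.unanimous_coinStep (coin := ω.coin r) hr h
    exact ⟨Or.inr ⟨b, this⟩, fun _ => ⟨b, this⟩⟩

variable (C A ω) in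
/-- Phase `r` of the binary agreement has lucky coins. -/
def Config.Lucky (r : Fin R) : Prop :=
  C.LuckyCoins ω.setup (ω.coin r)
    (C.target ω.setup (C.stateTwo A ω r (C.bitState A ω r)))

/-- Unanimity arises only at the end of the lucky phase and halting takes one more, hence `r + 1 <
R`. If no good citizen had grade 2, all would start with bit 1 and stay unanimous, so the output 0
would be impossible. -/
theorem Config.GoodMajority.bitAgreement (hσ : C.GoodMajority ω.setup)
    (hl : ∃ r : Fin R, (r : ℕ) + 1 < R ∧ C.Lucky A ω r) :
    ∃ b, C.Halted ω.setup b (C.bitAgreement A ω) ∧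
      (b = false → ∃ v ∈ C.good ω.setup, C.Grade2 A ω v) := by
  classical
  have hinv : ∀ m, C.Running ω.setup (C.bitState A ω m) ∨
      ∃ b, C.Unanimous ω.setup b (C.bitState A ω m) := by
    intro m
    induction m with
    | zero => exact Or.inl fun v _ => rfl
    | succ m ih =>
      rw [Config.bitState]
      split_ifs with h
      · exact (hσ.phase_cases ih).1
      · exact ih
  obtain ⟨r, hr, hl⟩ := hl
  obtain ⟨b, hb⟩ := (hσ.phase_cases (A := A) (r := r) (hinv r)).2 hl
  have hhalt : C.Halted ω.setup b (C.bitState A ω (r + 2)) := by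
    rw [Config.bitState, dif_pos hr, Config.bitState, dif_pos r.2]
    exact (hσ.unanimous_phase hb).2
  have hend : C.Halted ω.setup b (C.bitState A ω R) := by
    have key : ∀ k, C.Halted ω.setup b (C.bitState A ω (r + 2 + k)) := by
      intro k
      induction k with
      | zero => exact hhalt
      | succ k ih =>
        rw [← add_assoc, Config.bitState]
        split_ifs with h
        · exact ih.phase
        · exact ih
    have := key (R - (r + 2))
    rwa [show (r : ℕ) + 2 + (R - (r + 2)) = R by omega] at this
  refine ⟨b, by rwa [Config.bitAgreement_eq], ?_⟩
  rintro rfl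
  by_contra! hg
  have hall : ∀ m, C.Unanimous ω.setup true (C.bitState A ω m) := by
    intro m
    induction m with
    | zero => exact fun v hv => ⟨decide_eq_true (hg v hv), Or.inl rfl⟩
    | succ m ih =>
      rw [Config.bitState]
      split_ifs with h
      · exact (hσ.unanimous_phase ih).1
      · exact ih
  obtain ⟨v, hv⟩ := hσ.nonempty
  have h1 := hend v hv
  have h2 := (hall R v hv).2
  rw [h1] at h2
  simp at h2

open scoped Classical in
variable (C A ω) in
/-- The good citizens that enter the byzantine agreement with value `x`. -/
noncomputable def Config.supporters (x : Value M D) : Finset (Fin M) :=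
  (C.good ω.setup).filter fun v => C.initial A ω v = x

/-- Good citizens echo only values with a quorum of votes, so they all echo the same value or none.
Grade 2 at one good citizen means that more than n/3 good members echoed `x`, which every good
citizen sees; any other value seen from more than a third would need a good echoer. Some good echoer
had a quorum of votes for `x`, of which at most `n - g` came from members that are not good. -/
theorem Config.GoodMajority.graded (hσ : C.GoodMajority ω.setup)
    (hg : ∃ v ∈ C.good ω.setup, C.Grade2 A ω v) :
    ∃ x, (∀ v ∈ C.good ω.setup, C.graded A ω v = x) ∧
      3 * (C.good ω.setup).card < 3 * (C.supporters A ω x).card + ω.setup.committee.card := by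
  classical
  obtain ⟨v₀, hv₀, x, hx⟩ := hg
  have hecho : ∀ v ∈ C.good ω.setup, ∀ j ∈ C.good ω.setup, C.echoOf A ω v j =
      if h : ∃ x, ω.setup.TwoThirds fun k => C.voteOf A ω j k = some x
        then some h.choose else none :=
    fun v hv j hj => C.deliver_good _ _ hv hj
  have hvote : ∀ v ∈ C.good ω.setup, ∀ j ∈ C.good ω.setup,
      C.voteOf A ω v j = some (C.initial A ω j) :=
    fun v hv j hj => C.deliver_good _ _ hv hj
  have hecho2 : ∀ v ∈ C.good ω.setup, ∀ j ∈ C.good ω.setup, ∀ y, C.echoOf A ω v j = some y →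
      ω.setup.TwoThirds fun k => C.voteOf A ω j k = some y := by
    intro v hv j hj y hy
    rw [hecho v hv j hj] at hy
    split_ifs at hy with h
    rw [← Option.some.inj hy]
    exact h.choose_spec
  have huniq : ∀ v ∈ C.good ω.setup, ∀ w ∈ C.good ω.setup, ∀ j ∈ C.good ω.setup,
      ∀ k ∈ C.good ω.setup, ∀ y z, C.echoOf A ω v j = some y → C.echoOf A ω w k = some z →
        y = z := by
    intro v hv w hw j hj k hk y z hy hz
    obtain ⟨l, hl, h1, h2⟩ := hσ.exists_of_twoThirds (hecho2 v hv j hj y hy)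
      (hecho2 w hw k hk z hz)
    rw [hvote j hj l hl] at h1
    rw [hvote k hk l hl, h1] at h2
    exact Option.some.inj h2
  obtain ⟨j₀, hj₀, hj₀x, -⟩ := hσ.exists_of_twoThirds hx hx
  refine ⟨x, fun v hv => ?_, ?_⟩
  · have h1 : ω.setup.OneThird fun j => C.echoOf A ω v j = some x := by
      have h2 := C.count_le ω.setup fun j => C.echoOf A ω v₀ j = some x
      have h3 := C.card_le_count ω.setup fun j => C.echoOf A ω v j = some x
      have h4 : ((C.good ω.setup).filter fun j => C.echoOf A ω v₀ j = some x) =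
          (C.good ω.setup).filter fun j => C.echoOf A ω v j = some x :=
        Finset.filter_congr fun j hj => by rw [hecho v₀ hv₀ j hj, hecho v hv j hj]
      rw [h4] at h2
      unfold Setup.TwoThirds at hx
      unfold Setup.OneThird
      unfold Config.GoodMajority at hσ
      omega
    have h5 : ∃ x, ω.setup.OneThird fun j => C.echoOf A ω v j = some x := ⟨x, h1⟩
    rw [Config.graded, dif_pos h5]
    obtain ⟨k, hk, hky⟩ := hσ.exists_of_oneThird h5.choose_spec
    exact huniq v hv v₀ hv₀ k hk j₀ hj₀ _ _ hky hj₀x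
  · have h1 := hecho2 v₀ hv₀ j₀ hj₀ x hj₀x
    have h2 := C.count_le ω.setup fun k => C.voteOf A ω j₀ k = some x
    have h3 : ((C.good ω.setup).filter fun k => C.voteOf A ω j₀ k = some x) =
        C.supporters A ω x :=
      Finset.filter_congr fun k hk => by rw [hvote j₀ hj₀ k hk, Option.some_inj]
    rw [h3] at h2
    unfold Setup.TwoThirds at h1
    omega

/-- Agreement: all good citizens output the same value, and a proposal only if it has many
supporters. -/
theorem Config.GoodMajority.agreement (hσ : C.GoodMajority ω.setup)
    (hl : ∃ r : Fin R, (r : ℕ) + 1 < R ∧ C.Lucky A ω r) :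
    ∃ x : Value M D, (∀ v ∈ C.good ω.setup, C.out A ω v = some x) ∧
      (x ≠ none → 3 * (C.good ω.setup).card <
        3 * (C.supporters A ω x).card + ω.setup.committee.card) := by
  obtain ⟨b, hb, hbf⟩ := hσ.bitAgreement hl
  cases b with
  | true =>
    refine ⟨none, fun v hv => ?_, fun h => absurd rfl h⟩
    simp [Config.out, hb v hv]
  | false =>
    obtain ⟨x, hx, hs⟩ := hσ.graded (hbf rfl)
    refine ⟨x, fun v hv => ?_, fun _ => hs⟩
    simp [Config.out, hb v hv, hx v hv]

end Phases


/-! ## Reading and updating the global state -/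

section Commit

variable {R M S : ℕ} {K V Tx D : Type*} {C : Config M S K V Tx D}
  {A : Adversary R M S K V Tx D} {ω : Tape R M S K}

theorem Config.Reaches.exists_first {v : Fin M} (h : C.Reaches ω.setup v) :
    ∃ a, C.HonestPol ω v a ∧ ∀ i < a, ¬ C.HonestPol ω v i := by
  classical
  have hne : (Finset.univ.filter fun i => C.HonestPol ω v i).Nonempty := by
    obtain ⟨i, hi⟩ := h
    exact ⟨i, Finset.mem_filter.mpr ⟨Finset.mem_univ _, hi⟩⟩
  refine ⟨_, (Finset.mem_filter.mp (Finset.min'_mem _ hne)).2, fun i hi h' => ?_⟩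
  exact absurd (Finset.min'_le _ i (Finset.mem_filter.mpr ⟨Finset.mem_univ _, h'⟩)) (not_le.mpr hi)

theorem assemble_congr {ids : Fin 45 → Option D} {get get' : Fin 45 → D → Option (List Tx)}
    (h : ∀ i c, ids i = some c → get i c = get' i c) : assemble ids get = assemble ids get' := by
  unfold assemble
  have h1 : (∀ i c, ids i = some c → (get i c).isSome = true) ↔
      ∀ i c, ids i = some c → (get' i c).isSome = true :=
    forall_congr' fun i => forall_congr' fun c => forall_congr' fun hc => by rw [h i c hc]
  have h2 : (fun i => ((ids i).bind (get i)).getD []) =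
      fun i => ((ids i).bind (get' i)).getD [] := by
    funext i
    cases hi : ids i with
    | none => rfl
    | some c => simp [h i c hi]
  simp only [h1, h2]

theorem exists_assemble {ids : Fin 45 → Option D} {get : Fin 45 → D → Option (List Tx)}
    (h : ∀ i c, ids i = some c → (get i c).isSome) : ∃ txs, assemble ids get = some txs :=
  ⟨_, if_pos h⟩

variable (C A ω) in
/-- The honest politicians hold all the pools of proposal `p` after the second re-upload. -/
def Config.Stored (p : Proposal M D) : Prop :=
  ∀ i c, p.ids i = some c → ∃ q ∈ C.store2 A ω i, C.hash (.pool q) = c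

/-- The pool taken from the store does not depend on the offers of malicious politicians, so
everybody fetches the same one. -/
theorem Config.fetch_spec {st : Set (List Tx)} {c : D} (h : ∃ q ∈ st, C.hash (.pool q) = c) :
    ∃ q ∈ st, C.hash (.pool q) = c ∧ ∀ offer, C.fetch st offer c = some q :=
  ⟨h.choose, h.choose_spec.1, h.choose_spec.2, fun _ => dif_pos h⟩

variable [Fintype K]

theorem Config.InjOn.pool (hX : C.InjOn (C.hashed A ω)) {p q : List Tx} (hp : C.PoolSeen A ω p)
    (hq : C.PoolSeen A ω q) (h : C.hash (.pool p) = C.hash (.pool q)) : p = q :=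
  HashInput.pool.inj
    (hX _ (Or.inl (Or.inl ⟨p, hp, rfl⟩)) _ (Or.inl (Or.inl ⟨q, hq, rfl⟩)) h)

/-- All good citizens get the transactions that the honest politicians have. -/
theorem Config.InjOn.txsOf (hX : C.InjOn (C.hashed A ω)) {p : Proposal M D}
    (hp : C.Stored A ω p) : ∃ txs, C.polState A ω p = (C.runValid txs C.state).2 ∧
      ∀ v ∈ C.good ω.setup, C.txsOf A ω v p = some txs := by
  classical
  obtain ⟨txs, htxs⟩ := exists_assemble (ids := p.ids)
    (get := fun i c => C.fetch (C.store2 A ω i) none c) fun i c hc => by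
      obtain ⟨q, -, -, h⟩ := Config.fetch_spec (hp i c hc)
      simp only [h, Option.isSome_some]
  refine ⟨txs, by unfold Config.polState; rw [htxs], fun v hv => ?_⟩
  rw [← htxs, Config.txsOf]
  apply assemble_congr
  intro i c hc
  obtain ⟨q, hq, hqc, h⟩ := Config.fetch_spec (hp i c hc)
  rw [h, Config.finalPool, h]
  have key : ∀ o : Option (List Tx), (∀ q', o = some q' → q' = q) → o.or (some q) = some q := by
    rintro (_ | q') ho
    · rfl
    · rw [ho q' rfl]; rfl
  apply key
  intro q' hf
  rw [Option.filter_eq_some_iff] at hf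
  have hc' : C.hash (.pool q') = c := by simpa using hf.2
  -- A pool that `v` already held under this commitment is also among those hashed in the round, so
  -- it equals the stored one.
  exact hX.pool (Or.inr ⟨v, hv, i, Or.inl hf.1⟩) (Or.inl ⟨i, hq⟩) (hc'.trans hqc.symm)

open scoped Classical in
variable (C A ω) in
/-- The `j`-th attempt of `v` to read misses more than 500 wrong values of a corrupted
politician. -/
def Config.ReadFails (j : Fin 25) (v : Fin M) : Prop :=
  (v ∈ ω.setup.committee ∧ v ∉ C.corruptCitizens ∧ ∀ i ≤ j, ¬ C.HonestPol ω v i) ∧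
  ∃ p txs, C.out A ω v = some (some p) ∧ C.txsOf A ω v p = some txs ∧
    500 < ((C.keysIn txs).filter fun κ => C.readVals A ω v j κ ≠ C.state κ).card ∧
    ∀ κ ∈ (ω.readSpot j v (C.keysIn txs)).1, C.readVals A ω v j κ = C.state κ

open scoped Classical in
variable (C A ω) in
/-- The `j`-th attempt of `v` to write misses more than 800 wrong frontier nodes of a corrupted
politician. -/
def Config.WriteFails (j : Fin 25) (v : Fin M) : Prop :=
  (v ∈ ω.setup.committee ∧ v ∉ C.corruptCitizens ∧ ∀ i ≤ j, ¬ C.HonestPol ω v i) ∧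
  ∃ p, C.out A ω v = some (some p) ∧
    800 < (Finset.univ.filter fun f : Fin (2 ^ 13) =>
      C.frontierOf A ω p v j f ≠ C.tree (C.polState A ω p) 17 f).card ∧
    ∀ f ∈ (ω.writeSpot j v).1, C.frontierOf A ω p v j f = C.tree (C.polState A ω p) 17 f

theorem mem_bucket {K V : Type*} {keys : Finset K} {w : K → V} {b : Fin 2000} {κ : K} {x : V} :
    (κ, x) ∈ bucket keys w b ↔ (κ ∈ keys ∧
      (by classical exact keys.toList.idxOf κ) % 2000 = (b : ℕ)) ∧ x = w κ := by
  classical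
  simp only [bucket, Finset.mem_image, Finset.mem_filter, Prod.mk.injEq]
  constructor
  · rintro ⟨κ', h, rfl, rfl⟩; exact ⟨by convert h, rfl⟩
  · rintro ⟨h, rfl⟩; exact ⟨κ, by convert h, rfl, rfl⟩

open scoped Classical in
-- Each differing bucket contains a wrong key. Thus at most 500 wrong values keep the honest
-- exception list within its limit of 500 buckets.
theorem card_wrong_buckets_le {K V : Type*} (keys : Finset K) (w s : K → V)
    (P : Fin 2000 → Prop) [DecidablePred P] (hP : ∀ b, P b → bucket keys w b ≠ bucket keys s b) :
    (Finset.univ.filter P).card ≤ (keys.filter fun κ => w κ ≠ s κ).card := by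
  have hsub : Finset.univ.filter P ⊆ (keys.filter fun κ => w κ ≠ s κ).image fun κ =>
      (⟨keys.toList.idxOf κ % 2000, Nat.mod_lt _ (by norm_num)⟩ : Fin 2000) := by
    intro b hb
    by_contra hn
    apply hP b (Finset.mem_filter.mp hb).2
    ext ⟨κ, x⟩
    rw [mem_bucket, mem_bucket]
    apply and_congr_right
    rintro ⟨h1, h2⟩
    by_cases hw : w κ = s κ
    · rw [hw]
    · refine absurd (Finset.mem_image.mpr ⟨κ, Finset.mem_filter.mpr ⟨h1, hw⟩, ?_⟩) hn
      apply Fin.ext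
      convert h2
  exact (Finset.card_le_card hsub).trans Finset.card_image_le

variable {X : Set (HashInput K V Tx D)}

open scoped Classical in
-- Let `a` be the first honest politician of the sample. Its attempt passes, so the attempt `j` that
-- is accepted has `j ≤ a`: either `j = a` with all values right, or all politicians up to `j` are
-- corrupt and `hfail` applies. In both cases few enough values are wrong for `a` to correct them.
theorem Config.InjOn.read (hX : C.InjOn X) (hT : C.treeInputs ⊆ X) {v : Fin M}
    {keys : Finset K} (hin : C.readInputs A ω v keys ⊆ X) (hv : C.Reaches ω.setup v)
    (hfail : ∀ j, (∀ i ≤ j, ¬ C.HonestPol ω v i) →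
      (∀ κ ∈ (ω.readSpot j v keys).1, C.readVals A ω v j κ = C.state κ) →
      (keys.filter fun κ => C.readVals A ω v j κ ≠ C.state κ).card ≤ 500) :
    ∃ w, C.read A ω v keys = some w ∧ ∀ κ ∈ keys, w κ = C.state κ := by
  obtain ⟨a, ha, ha'⟩ := hv.exists_first
  have hpass : C.ReadPasses A ω v keys a := by
    intro κ _
    rw [Config.readVals, if_pos ha, Config.readPathOf, if_pos ha]
    exact Config.pathOK_honestPath κ
  obtain ⟨j, hja, hj⟩ := exists_firstPass hpass
  obtain ⟨hj1, hj2⟩ := firstPass_spec hj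
  refine ⟨_, by rw [Config.read, hj]; rfl, ?_⟩
  have hwrong : (keys.filter fun κ => C.readVals A ω v j κ ≠ C.state κ).card ≤ 500 := by
    by_cases hjh : C.HonestPol ω v j
    · rw [Config.readVals, if_pos hjh]
      simp
    · refine hfail j (fun i hi => ?_) fun κ hκ => ?_
      · rcases hi.lt_or_eq with hi | rfl
        · exact ha' i (hi.trans_le hja)
        · exact hjh
      · exact hX.pathOK hT (fun x hx => hin (Or.inl ⟨j, hj2, κ, hκ, hx⟩)) (hj1 κ hκ)
  have hbucket : ∀ b, C.hash (.bucket (bucket keys (C.readVals A ω v j) b)) =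
      C.hash (.bucket (bucket keys C.state b)) →
      bucket keys (C.readVals A ω v j) b = bucket keys C.state b := fun b hb =>
    HashInput.bucket.inj (hX _ (hin (Or.inr ⟨j, hj, Or.inl ⟨b, Or.inl rfl⟩⟩)) _
      (hin (Or.inr ⟨j, hj, Or.inl ⟨b, Or.inr rfl⟩⟩)) hb)
  intro κ hκ
  refine correct_cur (i := a) keys.toList ?_ ?_ ?_ ?_ ?_ κ (Finset.mem_toList.mpr hκ)
  · intro x _
    rw [Config.claimedVal, if_pos ha]
  · intro x _
    rw [Config.claimedVal, if_pos ha, Config.claimedPath, if_pos ha]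
    exact Config.pathOK_honestPath x
  · intro x hx hne
    rw [Config.exceptionList, if_pos ha]
    refine ⟨(card_wrong_buckets_le keys (C.readVals A ω v j) C.state
        (fun b => C.hash (.bucket (bucket keys (C.readVals A ω v j) b)) ≠
          C.hash (.bucket (bucket keys C.state b))) fun b hb h => hb (by rw [h])).trans hwrong,
      ⟨keys.toList.idxOf x % 2000, Nat.mod_lt _ (by norm_num)⟩, ?_, rfl⟩
    rw [Finset.mem_filter]
    refine ⟨Finset.mem_univ _, fun h => hne ?_⟩
    have hmem : (x, C.readVals A ω v j x) ∈ bucket keys (C.readVals A ω v j)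
        ⟨keys.toList.idxOf x % 2000, Nat.mod_lt _ (by norm_num)⟩ :=
      mem_bucket.mpr ⟨⟨Finset.mem_toList.mp hx, rfl⟩, rfl⟩
    rw [hbucket _ h] at hmem
    exact (mem_bucket.mp hmem).2
  · rw [Finset.toList_toFinset]
    exact hwrong
  · intro x hx hok
    exact hX.pathOK hT (fun y hy => hin (Or.inr ⟨j, hj, Or.inr ⟨x, hx, hy⟩⟩)) hok

open scoped Classical in
theorem Config.writeCorrection_eq (p : Proposal M D) (v : Fin M) (keys : Finset K) (new : K → V)
    (F : Fin (2 ^ 13) → D) : C.writeCorrection A ω p v keys new F =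
      correct 800 (List.finRange (2 ^ 13))
        (fun i _ => (Finset.univ.filter fun f => C.claimedFrontier A ω p v i f ≠ F f).card ≤ 800)
        (C.claimedFrontier A ω p v)
        (fun i f => C.UpdateOK keys new f (C.claimedFrontier A ω p v i f)
          (C.claimedProof A ω v i f)) F := rfl

open scoped Classical in
-- As for the read, with frontier nodes in place of keys. The honest politician's frontier is the
-- true one, so it differs from the accepted frontier in at most 800 nodes and is not discarded. The
-- 13 levels above a correct frontier are then recomputed.
theorem Config.InjOn.write (hX : C.InjOn X) (hT : C.treeInputs ⊆ X) {v : Fin M}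
    {p : Proposal M D} {keys : Finset K} {new : K → V}
    (hin : C.writeInputs A ω p v keys new ⊆ X) (hv : C.Reaches ω.setup v)
    (hnew : ∀ κ ∈ keys, new κ = C.polState A ω p κ)
    (hs : ∀ κ ∉ keys, C.state κ = C.polState A ω p κ)
    (hfail : ∀ j, (∀ i ≤ j, ¬ C.HonestPol ω v i) →
      (∀ f ∈ (ω.writeSpot j v).1, C.frontierOf A ω p v j f = C.tree (C.polState A ω p) 17 f) →
      (Finset.univ.filter fun f : Fin (2 ^ 13) =>
        C.frontierOf A ω p v j f ≠ C.tree (C.polState A ω p) 17 f).card ≤ 800) :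
    C.write A ω p v keys new = some (C.root (C.polState A ω p)) := by
  obtain ⟨a, ha, ha'⟩ := hv.exists_first
  have hpass : C.WritePasses A ω p v keys new a := by
    intro f _
    rw [Config.frontierOf, if_pos ha, Config.spotProofOf, if_pos ha]
    exact Config.updateOK_honestProof hnew hs f.2
  obtain ⟨j, hja, hj⟩ := exists_firstPass hpass
  obtain ⟨hj1, hj2⟩ := firstPass_spec hj
  have hwrong : (Finset.univ.filter fun f : Fin (2 ^ 13) =>
      C.frontierOf A ω p v j f ≠ C.tree (C.polState A ω p) 17 f).card ≤ 800 := by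
    by_cases hjh : C.HonestPol ω v j
    · rw [Config.frontierOf, if_pos hjh]
      simp
    · refine hfail j (fun i hi => ?_) fun f hf => ?_
      · rcases hi.lt_or_eq with hi | rfl
        · exact ha' i (hi.trans_le hja)
        · exact hjh
      · exact hX.updateOK hT hnew hs f.2 (fun x hx => hin (Or.inl ⟨j, hj2, f, hf, hx⟩))
          (hj1 f hf)
  rw [Config.write, hj, Option.map_some]
  generalize hc : (C.writeCorrection A ω p v keys new fun f => C.frontierOf A ω p v j f).cur = cur
  have hcur : ∀ f, cur f = C.tree (C.polState A ω p) 17 f := by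
    intro f
    rw [← hc, Config.writeCorrection_eq]
    refine correct_cur (i := a) (truth := fun f : Fin (2 ^ 13) => C.tree (C.polState A ω p) 17 f)
      (List.finRange (2 ^ 13)) ?_ ?_ ?_ ?_ ?_ f (List.mem_finRange f)
    · intro x _
      rw [Config.claimedFrontier, if_pos ha]
    · intro x _
      rw [Config.claimedFrontier, if_pos ha, Config.claimedProof, if_pos ha]
      exact Config.updateOK_honestProof hnew hs x.2
    · intro x _ _
      refine le_trans (Finset.card_le_card ?_) hwrong
      intro f hf
      rw [Finset.mem_filter, Config.claimedFrontier, if_pos ha] at hf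
      exact Finset.mem_filter.mpr ⟨Finset.mem_univ _, fun h => hf.2 h.symm⟩
    · refine le_trans (Finset.card_le_card ?_) hwrong
      intro f hf
      exact Finset.mem_filter.mpr ⟨Finset.mem_univ _, (Finset.mem_filter.mp hf).2⟩
    · intro x hx hok
      rw [← Config.writeCorrection_eq] at hx
      exact hX.updateOK hT hnew hs x.2.2 (fun y hy => hin (Or.inr ⟨j, hj, x, hx, hy⟩)) hok
  rw [Config.build_tree (h₀ := 17) (n := 2 ^ 13) (s := C.polState A ω p) _ (by norm_num)]
  · rfl
  · intro i hi
    rw [hcur, Fin.val_ofNat, Nat.mod_eq_of_lt hi]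

/-- Correct values on the referenced keys determine the kept transactions and the new values there.
All other keys keep their old values, which the update proofs carry over. -/
theorem Config.InjOn.signed (hX : C.InjOn (C.hashed A ω)) {p : Proposal M D} {txs : List Tx}
    (htxs : C.polState A ω p = (C.runValid txs C.state).2) {v : Fin M} (hv : v ∈ C.good ω.setup)
    (hout : C.out A ω v = some (some p)) (htx : C.txsOf A ω v p = some txs)
    (hread : ∀ j, ¬ C.ReadFails A ω j v) (hwrite : ∀ j, ¬ C.WriteFails A ω j v) :
    C.signed A ω v = some (C.hash (.block ⟨C.lastHash, (C.runValid txs C.state).1⟩),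
      C.root (C.runValid txs C.state).2, C.chain.length + 1) := by
  classical
  have hv' := hv
  simp only [Config.good, Finset.mem_filter] at hv'
  have hT : C.treeInputs ⊆ C.hashed A ω := fun x hx => Or.inl (Or.inr hx)
  obtain ⟨w, hw, hwk⟩ := hX.read (A := A) (ω := ω) hT (v := v) (keys := C.keysIn txs)
    (fun x hx => Or.inr ⟨v, hv, p, txs, hout, htx, Or.inl hx⟩) hv'.2.2 fun j h1 h2 => by
      by_contra hn
      exact hread j ⟨⟨hv'.1, hv'.2.1, h1⟩, p, txs, hout, htx, not_le.mp hn, h2⟩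
  have hkeys : ∀ t ∈ txs, C.keysOf t ⊆ C.keysIn txs := fun t ht κ hκ => by
    simp only [Config.keysIn, Finset.mem_filter, Finset.mem_univ, true_and]
    exact ⟨t, ht, hκ⟩
  obtain ⟨h1, h2⟩ := C.runValid_congr (C.keysIn txs) txs hkeys w C.state hwk
  have h3 : C.write A ω p v (C.keysIn txs) (C.runValid txs w).2 =
      some (C.root (C.polState A ω p)) := by
    refine hX.write hT
      (fun x hx => Or.inr ⟨v, hv, p, txs, hout, htx, Or.inr ⟨w, hw, hx⟩⟩) hv'.2.2 ?_ ?_ ?_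
    · rw [htxs]; exact h2
    · intro κ hκ
      rw [htxs, C.runValid_of_notMem]
      intro t ht hκt
      exact hκ (hkeys t ht hκt)
    · intro j h1 h2
      by_contra hn
      exact hwrite j ⟨⟨hv'.1, hv'.2.1, h1⟩, p, hout, not_le.mp hn, h2⟩
  simp only [Config.signed, hout, Option.bind_some, Config.commitTo, htx, hw, h3, Option.map_some,
    h1, htxs]

open scoped Classical in
/-- The protocol succeeds if none of the unlikely events happens. -/
theorem Config.GoodMajority.blockConsensus (hσ : C.GoodMajority ω.setup)
    (hC : C.IsLedger C.chain C.state) (hcol : ¬ C.Collision A ω)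
    (hl : ∃ r : Fin R, (r : ℕ) + 1 < R ∧ C.Lucky A ω r)
    (hstore : ∀ p, 3 * (C.good ω.setup).card <
      3 * (C.supporters A ω (some p)).card + ω.setup.committee.card → C.Stored A ω p)
    (hfail : ((C.good ω.setup).filter fun v =>
      ∃ j, C.ReadFails A ω j v ∨ C.WriteFails A ω j v).card ≤ 36) :
    C.BlockConsensus A ω := by
  have hX : C.InjOn (C.hashed A ω) := fun x hx y hy h => by
    by_contra hne
    exact hcol ⟨x, hx, y, hy, hne, h⟩
  obtain ⟨x, hx, hs⟩ := hσ.agreement hl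
  cases x with
  | none =>
    refine ⟨⟨C.lastHash, []⟩, C.state, C.isLedger_append [] hC, ?_⟩
    have : {v | v ∈ C.good ω.setup ∧ C.signed A ω v ≠ some
        (C.hash (.block ⟨C.lastHash, []⟩), C.root C.state, C.chain.length + 1)} = ∅ := by
      ext v
      simp only [Set.mem_ofPred_eq, Set.mem_empty_iff_false, iff_false, not_and, not_not]
      intro hv
      simp [Config.signed, hx v hv, Config.commitTo]
    rw [this]
    simp
  | some p =>
    obtain ⟨txs, htxs, htx⟩ := hX.txsOf (hstore p (hs (by simp)))
    refine ⟨_, _, C.isLedger_append txs hC, ?_⟩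
    rw [← Set.ncard_coe_finset] at hfail
    refine le_trans (Set.ncard_le_ncard ?_ (Finset.finite_toSet _)) hfail
    rintro v ⟨hv, hne⟩
    rw [Finset.mem_coe, Finset.mem_filter]
    refine ⟨hv, ?_⟩
    by_contra! hn
    exact hne (hX.signed htxs hv (hx v hv) (htx v hv) (fun j => (hn j).1) fun j => (hn j).2)

end Commit


/-! ## What the moves of a round depend on -/

section Dependence

variable {R M S : ℕ} {K V Tx D : Type*} {C : Config M S K V Tx D}
  {A : Adversary R M S K V Tx D} {ω ω' : Tape R M S K} {T : ℕ}

/-- The adversary has the same views of two tapes up to time `T`. -/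
def Config.Agree (C : Config M S K V Tx D) (T : ℕ) (ω ω' : Tape R M S K) : Prop :=
  ∀ t ≤ T, C.view ω t = C.view ω' t

theorem Config.Agree.setup (h : C.Agree T ω ω') : ω.setup = ω'.setup :=
  congrArg View.setup (h 0 (Nat.zero_le _))

theorem Config.Agree.upload1 (h : C.Agree T ω ω') (hT : 1 ≤ T) : ω.upload1 = ω'.upload1 := by
  have := congrArg View.upload1 (h 1 hT)
  simpa [Config.view] using this

theorem Config.Agree.upload2 (h : C.Agree T ω ω') (hT : 2 ≤ T) : ω.upload2 = ω'.upload2 := by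
  have := congrArg View.upload2 (h 2 hT)
  simpa [Config.view] using this

theorem Config.Agree.coin (h : C.Agree T ω ω') {r : Fin R} (hT : 3 + (r : ℕ) < T) :
    ω.coin r = ω'.coin r := by
  funext v
  have := congrFun (congrFun (congrArg View.coin (h T le_rfl)) r) v
  simpa [Config.view, hT] using this

theorem Config.Agree.held1 (h : C.Agree T ω ω') : C.held1 A ω = C.held1 A ω' := by
  funext v i
  unfold Config.held1
  rw [h 0 (Nat.zero_le _)]

theorem Config.Agree.witnessList (h : C.Agree T ω ω') :
    C.witnessList A ω = C.witnessList A ω' := by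
  funext v j
  unfold Config.witnessList
  rw [h 0 (Nat.zero_le _), h.setup, h.held1]

theorem Config.Agree.isProposer (h : C.Agree T ω ω') : C.IsProposer ω = C.IsProposer ω' := by
  funext u
  unfold Config.IsProposer
  rw [h.setup]

theorem Config.Agree.pickIds (h : C.Agree T ω ω') : C.pickIds A ω = C.pickIds A ω' := by
  funext u i
  unfold Config.pickIds
  rw [h.setup, h.witnessList]

theorem Config.Agree.proposalOf (h : C.Agree T ω ω') (hT : 1 ≤ T) :
    C.proposalOf A ω = C.proposalOf A ω' := by
  funext v u
  unfold Config.proposalOf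
  rw [h.setup, h.isProposer, h.pickIds, h 1 hT]

theorem Config.Agree.candidate (h : C.Agree T ω ω') (hT : 1 ≤ T) :
    C.Candidate A ω = C.Candidate A ω' := by
  funext v p
  unfold Config.Candidate
  rw [h.isProposer, h.proposalOf hT]

theorem Config.Agree.winner (h : C.Agree T ω ω') (hT : 1 ≤ T) :
    C.winner A ω = C.winner A ω' := by
  funext v
  unfold Config.winner
  rw [h.candidate hT, h.setup]

theorem Config.Agree.store1 (h : C.Agree T ω ω') (hT : 1 ≤ T) :
    C.store1 A ω = C.store1 A ω' := by
  funext i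
  unfold Config.store1
  rw [h.setup, h.held1, h.upload1 hT, h 1 hT]

theorem Config.Agree.held2 (h : C.Agree T ω ω') (hT : 1 ≤ T) : C.held2 A ω = C.held2 A ω' := by
  funext v i
  unfold Config.held2
  rw [h.held1, h.winner hT, h.store1 hT, h 1 hT]

theorem Config.Agree.initial (h : C.Agree T ω ω') (hT : 1 ≤ T) :
    C.initial A ω = C.initial A ω' := by
  funext v
  unfold Config.initial
  rw [h.winner hT, h.held2 hT]

theorem Config.Agree.store2 (h : C.Agree T ω ω') (hT : 3 + R ≤ T) :
    C.store2 A ω = C.store2 A ω' := by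
  funext i
  unfold Config.store2
  rw [h.store1 (by omega), h.held2 (by omega), h.upload2 (by omega), h.setup, h _ hT]

theorem Config.Agree.voteOf (h : C.Agree T ω ω') (hT : 2 ≤ T) :
    C.voteOf A ω = C.voteOf A ω' := by
  funext v j
  unfold Config.voteOf
  rw [h.initial (by omega), h.setup, h 2 hT]

theorem Config.Agree.echoOf (h : C.Agree T ω ω') (hT : 2 ≤ T) :
    C.echoOf A ω = C.echoOf A ω' := by
  funext v j
  unfold Config.echoOf
  rw [h.voteOf hT, h.setup, h 2 hT]

theorem Config.Agree.graded (h : C.Agree T ω ω') (hT : 2 ≤ T) :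
    C.graded A ω = C.graded A ω' := by
  funext v
  unfold Config.graded
  rw [h.echoOf hT, h.setup]

/-- The first two steps of phase `r` use the view at time `3 + r`, which does not yet contain the
good citizens' coins of this phase. -/
theorem Config.Agree.stateTwo (h : C.Agree T ω ω') {r : ℕ} (hT : 3 + r ≤ T)
    (st : Fin M → BitState) : C.stateTwo A ω r st = C.stateTwo A ω' r st := by
  unfold Config.stateTwo Config.stateOne Config.bitsOf
  rw [h.setup, h _ hT]

theorem Config.Agree.bitState (h : C.Agree T ω ω') {m : ℕ} (hT : 3 + m ≤ T) :
    C.bitState A ω m = C.bitState A ω' m := by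
  classical
  induction m with
  | zero =>
    unfold Config.bitState Config.Grade2
    rw [h.echoOf (by omega), h.setup]
  | succ m ih =>
    rw [Config.bitState, Config.bitState]
    split_ifs with hm
    · rw [Config.phase_eq, Config.phase_eq, ih (by omega), h.stateTwo (by dsimp only; omega)]
      unfold Config.bitsOf
      rw [h.setup, h.coin (by dsimp only; omega), h _ (by dsimp only; omega)]
    · exact ih (by omega)

/-- The target is settled before the good coins of phase `r` are revealed, though it may depend on
the coins of the others in this phase. -/
theorem Config.Agree.target (h : C.Agree T ω ω') {r : ℕ} (hT : 3 + r ≤ T) :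
    C.target ω.setup (C.stateTwo A ω r (C.bitState A ω r)) =
      C.target ω'.setup (C.stateTwo A ω' r (C.bitState A ω' r)) := by
  rw [h.setup, h.bitState hT, h.stateTwo hT]

theorem Config.Agree.out (h : C.Agree T ω ω') (hT : 3 + R ≤ T) : C.out A ω = C.out A ω' := by
  funext v
  unfold Config.out
  rw [Config.bitAgreement_eq, Config.bitAgreement_eq, h.bitState hT, h.graded (by omega)]

theorem Config.Agree.txsOf (h : C.Agree T ω ω') (hT : 3 + R ≤ T) :
    C.txsOf A ω = C.txsOf A ω' := by
  funext v p
  unfold Config.txsOf Config.finalPool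
  rw [h.held2 (by omega), h.store2 hT, h _ hT]

theorem Config.Agree.honestPol (h : C.Agree T ω ω') : C.HonestPol ω = C.HonestPol ω' := by
  funext v i
  unfold Config.HonestPol
  rw [h.setup]

theorem Config.Agree.readVals (h : C.Agree T ω ω') {j : Fin 25} (hT : 3 + R + j ≤ T)
    (v : Fin M) : C.readVals A ω v j = C.readVals A ω' v j := by
  unfold Config.readVals
  rw [h.honestPol, h _ hT]

theorem Config.Agree.polState (h : C.Agree T ω ω') (hT : 3 + R ≤ T) :
    C.polState A ω = C.polState A ω' := by
  funext p
  unfold Config.polState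
  rw [h.store2 hT]

variable [Fintype K]

theorem Config.Agree.frontierOf (h : C.Agree T ω ω') {j : Fin 25} (hT : 3 + R + 25 + j ≤ T)
    (p : Proposal M D) (v : Fin M) : C.frontierOf A ω p v j = C.frontierOf A ω' p v j := by
  unfold Config.frontierOf
  rw [h.honestPol, h.polState (by omega), h _ hT]

/-- The values are offered at time `3 + R + j`, before any spot-check of attempt `j` is revealed. Of
the spot-checks of this attempt, only the one of `v` itself matters. -/
theorem Config.Agree.readFails (h : C.Agree T ω ω') {j : Fin 25} (hT : 3 + R + j ≤ T) {v : Fin M}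
    (hs : ω.readSpot j v = ω'.readSpot j v) : C.ReadFails A ω j v ↔ C.ReadFails A ω' j v := by
  unfold Config.ReadFails
  rw [h.setup, h.honestPol, h.out (by omega), h.txsOf (by omega), h.readVals hT, hs]

theorem Config.Agree.writeFails (h : C.Agree T ω ω') {j : Fin 25} (hT : 3 + R + 25 + j ≤ T)
    {v : Fin M} (hs : ω.writeSpot j v = ω'.writeSpot j v) :
    C.WriteFails A ω j v ↔ C.WriteFails A ω' j v := by
  unfold Config.WriteFails
  rw [h.setup, h.honestPol, h.out (by omega), h.polState (by omega)]
  refine and_congr_right fun _ => exists_congr fun p => ?_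
  rw [h.frontierOf hT, hs]

end Dependence


/-! ## The tape as a product of coordinates -/

section Coordinates

variable {R M S : ℕ} {K : Type*}

instance : Finite (Setup M S) :=
  Finite.of_injective (fun σ : Setup M S => (σ.sortition, σ.sample, σ.proposerVrf)) fun σ σ' h => by
    cases σ; cases σ'; simpa using h

instance [Finite K] : Finite (Tape R M S K) :=
  have : Finite (Pick K spotCount) := inferInstance
  have : Finite {s : Finset (Fin (2 ^ 13)) // s.card = 72} := inferInstance
  have : Finite (Reupload S 5) := inferInstance
  have : Finite (Reupload S 10) := inferInstance
  Finite.of_injective (fun ω : Tape R M S K =>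
    (ω.setup, ω.upload1, ω.upload2, ω.coin, ω.readSpot, ω.writeSpot)) fun ω ω' h => by
    cases ω; cases ω'; simpa using h

/-- The sortition and the sample of citizen `v`. -/
def setupLens (R M S : ℕ) (K : Type*) (v : Fin M) :
    Lens (Tape R M S K) (Fin M × (Fin 25 ↪ Fin S)) where
  get ω := (ω.setup.sortition v, ω.setup.sample v)
  set ω z := { ω with setup := { ω.setup with
    sortition := Function.update ω.setup.sortition v z.1
    sample := Function.update ω.setup.sample v z.2 } }
  get_set := by simp
  set_get := by simp
  set_set := by simp

/-- The second re-upload of citizen `v`. -/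
def uploadLens (R M S : ℕ) (K : Type*) (v : Fin M) : Lens (Tape R M S K) (Reupload S 10) where
  get ω := ω.upload2 v
  set ω z := { ω with upload2 := Function.update ω.upload2 v z }
  get_set := by simp
  set_get := by simp
  set_set := by simp

/-- The coins of phase `r`. -/
def coinLens (R M S : ℕ) (K : Type*) (r : Fin R) : Lens (Tape R M S K) (Fin M → Vrf) where
  get ω := ω.coin r
  set ω z := { ω with coin := Function.update ω.coin r z }
  get_set := by simp
  set_get := by simp
  set_set := by simp

/-- The spot-checks of citizen `v` in the `j`-th attempt to read. -/
def readLens (R M S : ℕ) (K : Type*) (l : Fin 25 ×ₗ Fin M) :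
    Lens (Tape R M S K) (Pick K spotCount) where
  get ω := ω.readSpot (ofLex l).1 (ofLex l).2
  set ω z :=
    { ω with
      readSpot := Function.update ω.readSpot (ofLex l).1
        (Function.update (ω.readSpot (ofLex l).1) (ofLex l).2 z) }
  get_set := by simp
  set_get := by simp
  set_set := by simp

/-- The spot-checks of citizen `v` in the `j`-th attempt to write. -/
def writeLens (R M S : ℕ) (K : Type*) (l : Fin 25 ×ₗ Fin M) :
    Lens (Tape R M S K) {s : Finset (Fin (2 ^ 13)) // s.card = 72} where
  get ω := ω.writeSpot (ofLex l).1 (ofLex l).2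
  set ω z :=
    { ω with
      writeSpot := Function.update ω.writeSpot (ofLex l).1
        (Function.update (ω.writeSpot (ofLex l).1) (ofLex l).2 z) }
  get_set := by simp
  set_get := by simp
  set_set := by simp

theorem prob_le_mean [Finite K] {E : Tape R M S K → Prop} (f : Tape R M S K → ℝ)
    (hf : ∀ ω, 0 ≤ f ω) (h : ∀ ω, E ω → 1 ≤ f ω) : prob E ≤ mean f :=
  mean_indicator_le_of_le E f hf h

open scoped Classical in
theorem prob_eq_mean [Finite K] (E : Tape R M S K → Prop) :
    prob E = mean fun ω => if E ω then (1 : ℝ) else 0 :=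
  (mean_indicator E).symm

theorem prob_mono [Finite K] {E F : Tape R M S K → Prop} (h : ∀ ω, E ω → F ω) :
    prob E ≤ prob F := by
  classical
  rw [prob_eq_mean, prob_eq_mean]
  apply mean_mono
  intro ω
  split_ifs with h1 h2
  · exact le_rfl
  · exact absurd (h ω h1) h2
  · exact zero_le_one
  · exact le_rfl

theorem prob_or_le [Finite K] (E F : Tape R M S K → Prop) :
    prob (fun ω => E ω ∨ F ω) ≤ prob E + prob F := by
  classical
  simp only [prob_eq_mean, ← mean_add]
  apply mean_mono
  intro ω
  by_cases h1 : E ω <;> by_cases h2 : F ω <;> simp [h1, h2]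

theorem prob_exists_le [Finite K] {ι : Type*} [Fintype ι] (E : ι → Tape R M S K → Prop) :
    prob (fun ω => ∃ i, E i ω) ≤ ∑ i, prob (E i) := by
  classical
  simp only [prob_eq_mean, ← mean_sum]
  apply mean_mono
  intro ω
  split_ifs with h
  · obtain ⟨i, hi⟩ := h
    calc (1 : ℝ) = if E i ω then 1 else 0 := (if_pos hi).symm
      _ ≤ _ := Finset.single_le_sum (f := fun i => if E i ω then (1 : ℝ) else 0)
        (fun _ _ => by split_ifs <;> norm_num) (Finset.mem_univ i)
  · exact Finset.sum_nonneg fun _ _ => by split_ifs <;> norm_num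

theorem mean_pi_prod {ι B : Type*} [Fintype ι] [Finite B] (f : ι → B → ℝ) :
    mean (fun z : ι → B => ∏ i, f i (z i)) = ∏ i, mean (f i) := by
  classical
  let _ := Fintype.ofFinite B
  simp only [mean_eq, Finset.prod_div_distrib, Fintype.card_fun, Finset.prod_const,
    Finset.card_univ, Finset.prod_univ_sum, Fintype.piFinset_univ]
  push_cast
  rfl

theorem mean_pi_eq {ι B : Type*} [Fintype ι] [Fintype B] [Nonempty B] (T : Finset ι) (e : ι → B)
    (P : (ι → B) → Prop) [DecidablePred P] (hP : ∀ z, P z ↔ ∀ i ∈ T, z i = e i) :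
    mean (fun z : ι → B => if P z then (1 : ℝ) else 0) =
      ((Fintype.card B : ℝ)⁻¹) ^ T.card := by
  classical
  have h1 : (fun z : ι → B => if P z then (1 : ℝ) else 0) =
      fun z => ∏ i, if i ∈ T then (if z i = e i then (1 : ℝ) else 0) else 1 := by
    funext z
    rw [Finset.prod_ite_mem, Finset.univ_inter, Finset.prod_boole]
    simp only [hP]
    congr
  rw [h1, mean_pi_prod (fun i b => if i ∈ T then (if b = e i then (1 : ℝ) else 0) else 1)]
  rw [← Finset.prod_const, ← Finset.univ_inter T, ← Finset.prod_ite_mem]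
  simp only [Finset.univ_inter]
  refine Finset.prod_congr rfl fun i _ => ?_
  split_ifs with hi
  · simp only [mean_eq, Finset.sum_ite_eq', Finset.mem_univ, if_true, one_div]
  · exact mean_const 1

end Coordinates

/-! ## Common coins -/

section Coin

variable {R M S : ℕ} {K V Tx D : Type*} (C : Config M S K V Tx D)
  (A : Adversary R M S K V Tx D)

open scoped Classical in
/-- The tape on which `false` replaces the target of each phase: the values `0` and `1` of the
good citizens' coins are swapped in the phases in which the target is `true`. -/
noncomputable def Config.retarget (ω : Tape R M S K) : Tape R M S K :=
  { ω with coin := fun r v =>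
      if v ∈ C.good ω.setup ∧ C.target ω.setup (C.stateTwo A ω r (C.bitState A ω r)) = true
      then Equiv.swap (bitVrf true) (bitVrf false) (ω.coin r v) else ω.coin r v }

variable {C}

theorem Config.agree_of_coin {ω ω' : Tape R M S K} {T : ℕ} (hs : ω.setup = ω'.setup)
    (h1 : ω.upload1 = ω'.upload1) (h2 : ω.upload2 = ω'.upload2)
    (hr : ω.readSpot = ω'.readSpot) (hw : ω.writeSpot = ω'.writeSpot)
    (hc : ∀ (r : Fin R) v, (v ∉ C.good ω.setup ∨ 3 + (r : ℕ) < T) → ω.coin r v = ω'.coin r v) :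
    C.Agree T ω ω' := by
  classical
  intro t ht
  unfold Config.view
  rw [hs, h1, h2, hr, hw]
  congr 1
  funext r v
  split_ifs with h
  · rw [hc r v (by rw [hs]; exact h.imp_right fun h => h.trans_le ht)]
  · rfl

variable (C)

/-- The map is triangular. Coins outside the good set are unchanged, and the target of phase `r`
depends only on these and on earlier phases. So once the earlier coins are recovered, the swap of
phase `r` is known and can be undone. -/
theorem Config.retarget_injective : Function.Injective (C.retarget A) := by
  classical
  intro ω ω' h
  have hs : ω.setup = ω'.setup := (congrArg Tape.setup h : (C.retarget A ω).setup = _)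
  have h1 : ω.upload1 = ω'.upload1 := (congrArg Tape.upload1 h : (C.retarget A ω).upload1 = _)
  have h2 : ω.upload2 = ω'.upload2 := (congrArg Tape.upload2 h : (C.retarget A ω).upload2 = _)
  have hr : ω.readSpot = ω'.readSpot := (congrArg Tape.readSpot h : (C.retarget A ω).readSpot = _)
  have hw : ω.writeSpot = ω'.writeSpot := (congrArg Tape.writeSpot h : (C.retarget A ω).writeSpot = _)
  have hc : ∀ r v, (C.retarget A ω).coin r v = (C.retarget A ω').coin r v := fun r v => by rw [h]
  have hbad : ∀ r v, v ∉ C.good ω.setup → ω.coin r v = ω'.coin r v := by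
    intro r v hv
    have := hc r v
    simp only [Config.retarget] at this
    rwa [if_neg fun h => hv h.1, if_neg fun h => hv (hs ▸ h.1)] at this
  have hcoin : ∀ n, ∀ r : Fin R, (r : ℕ) = n → ω.coin r = ω'.coin r := by
    intro n
    induction n using Nat.strong_induction_on with
    | _ n ih =>
      rintro r rfl
      have hag : C.Agree (3 + r) ω ω' := Config.agree_of_coin hs h1 h2 hr hw fun r' v hv => by
        rcases hv with hv | hv
        · exact hbad r' v hv
        · rw [ih r' (by omega) r' rfl]
      have ht := hag.target (A := A) (r := r) le_rfl
      funext v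
      have := hc r v
      simp only [Config.retarget] at this
      rw [ht, hs] at this
      split_ifs at this
      · exact (Equiv.swap _ _).injective this
      · exact this
  have hcoin' : ω.coin = ω'.coin := funext fun r => hcoin r r rfl
  cases ω; cases ω'
  simp only at hs h1 h2 hr hw hcoin'
  subst hs h1 h2 hr hw hcoin'
  rfl

/-- Where the target is `true`, a transformed good coin 0 comes from an original coin 1; where it is
`false`, nothing was changed. -/
theorem Config.lucky_of_retarget {ω : Tape R M S K} {r : Fin R}
    (h : C.LuckyCoins ω.setup ((C.retarget A ω).coin r) false) : C.Lucky A ω r := by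
  classical
  refine ⟨fun v hv => ?_, fun v hv hg => ?_⟩
  · have := h.1 v hv
    simp only [Config.retarget] at this
    split_ifs at this with hb
    · rw [hb.2]
      rwa [Equiv.swap_apply_eq_iff, Equiv.swap_apply_right] at this
    · have hb' : C.target ω.setup (C.stateTwo A ω r (C.bitState A ω r)) = false := by
        by_contra hne
        exact hb ⟨hv, by simpa using hne⟩
      rw [hb', this]
  · have := h.2 v hv hg
    simp only [Config.retarget] at this
    rwa [if_neg fun h => hg h.1] at this

open scoped Classical in
-- After the transformation luck in a phase is a condition on the coins of that phase alone, given
-- the setup. It holds at least when the at most 4000 coins of the committee take prescribed values.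
-- Only `R - 1` phases count, since another one is needed to halt.
theorem Config.prob_unlucky_le [Finite K] :
    prob (fun ω : Tape R M S K => ω.setup.committee.card ≤ 4000 ∧
      ∀ r : Fin R, (r : ℕ) + 1 < R → ¬ C.Lucky A ω r) ≤
      (1 - ((Fintype.card Vrf : ℝ)⁻¹) ^ 4000) ^ (R - 1) := by
  set N : ℝ := (Fintype.card Vrf : ℝ)⁻¹ with hN
  have hN0 : 0 ≤ N := by positivity
  have hN1 : N ≤ 1 := by
    rw [hN]
    apply inv_le_one_of_one_le₀
    exact_mod_cast Fintype.card_pos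
  have hδ : N ^ 4000 ≤ 1 := pow_le_one₀ hN0 hN1
  let E' : Tape R M S K → Prop := fun ω => ω.setup.committee.card ≤ 4000 ∧
      ∀ r : Fin R, (r : ℕ) + 1 < R → ¬ C.LuckyCoins ω.setup (ω.coin r) false
  -- The distribution is uniform, so an injection between events compares their probabilities.
  have h1 : prob (fun ω : Tape R M S K => ω.setup.committee.card ≤ 4000 ∧
      ∀ r : Fin R, (r : ℕ) + 1 < R → ¬ C.Lucky A ω r) ≤ prob E' := by
    unfold prob
    gcongr
    refine Nat.card_le_card_of_injective
      (fun ω => ⟨C.retarget A ω.1, ω.2.1, fun r hr h => ω.2.2 r hr (C.lucky_of_retarget A h)⟩) ?_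
    intro ω ω' h
    exact Subtype.ext (C.retarget_injective A (Subtype.ext_iff.mp h))
  refine h1.trans ?_
  let s : Finset (Fin R) := Finset.univ.filter fun r => (r : ℕ) + 1 < R
  have hs : R - 1 ≤ s.card := by
    calc R - 1 = (Finset.range (R - 1)).card := (Finset.card_range _).symm
      _ ≤ (s.image fun r : Fin R => (r : ℕ)).card := by
          apply Finset.card_le_card
          intro n hn
          rw [Finset.mem_range] at hn
          exact Finset.mem_image.mpr ⟨⟨n, by omega⟩,
            Finset.mem_filter.mpr ⟨Finset.mem_univ _, by dsimp only; omega⟩, rfl⟩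
      _ ≤ s.card := Finset.card_image_le
  let w : Tape R M S K → ℝ := fun ω => if ω.setup.committee.card ≤ 4000 then 1 else 0
  let G : Fin R → Tape R M S K → ℝ := fun r ω =>
    if ω.setup.committee.card ≤ 4000 ∧ C.LuckyCoins ω.setup (ω.coin r) false then 0 else 1
  let c : Fin R → Tape R M S K → ℝ := fun _ ω =>
    if ω.setup.committee.card ≤ 4000 then 1 - N ^ 4000 else 1
  have hw0 : ∀ ω, 0 ≤ w ω := fun ω => by simp only [w]; split_ifs <;> norm_num
  have hG0 : ∀ r ω, 0 ≤ G r ω := fun r ω => by simp only [G]; split_ifs <;> norm_num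
  have hc0 : ∀ r ω, 0 ≤ c r ω := fun r ω => by simp only [c]; split_ifs <;> linarith
  calc prob E' ≤ mean (fun ω => w ω * ∏ r ∈ s, G r ω) := by
        apply prob_le_mean
        · exact fun ω => mul_nonneg (hw0 ω) (Finset.prod_nonneg fun r _ => hG0 r ω)
        · rintro ω ⟨hn, hl⟩
          have h2 : ∀ r ∈ s, G r ω = 1 := fun r hr =>
            if_neg fun h => hl r (Finset.mem_filter.mp hr).2 h.2
          rw [Finset.prod_congr rfl h2]
          simp [w, hn]
    _ ≤ mean (fun ω => w ω * ∏ r ∈ s, c r ω) := by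
        refine mean_mul_prod_le (coinLens R M S K) G c hG0 hc0 (fun _ _ _ _ => rfl) ?_ ?_ s w hw0
          (fun _ _ _ => rfl)
        · intro l l' hl ω z
          simp only [G, coinLens, Function.update_of_ne hl.ne]
        · intro l ω
          simp only [G, c, coinLens, Function.update_self]
          by_cases hn : ω.setup.committee.card ≤ 4000
          · simp only [hn, true_and, if_true]
            let e : Fin M → Vrf := fun v => if v ∈ C.good ω.setup then bitVrf false else
              ⟨2, by norm_num⟩
            have h3 := mean_pi_eq ω.setup.committee e _ fun z => Iff.rfl
            have h4 : mean (fun z : Fin M → Vrf => 1 + (-1) *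
                (if ∀ v ∈ ω.setup.committee, z v = e v then (1 : ℝ) else 0)) =
                1 - N ^ ω.setup.committee.card := by
              have : Nonempty Vrf := ⟨bitVrf false⟩
              rw [mean_add, mean_mul_left, h3, mean_const]
              ring
            refine (mean_mono fun z => ?_).trans (h4.le.trans ?_)
            · have h5 : (∀ v ∈ ω.setup.committee, z v = e v) →
                  C.LuckyCoins ω.setup z false := by
                intro h
                refine ⟨fun v hv => ?_, fun v hv hg => ?_⟩
                · rw [h v (C.good_subset _ hv)]; simp only [e, if_pos hv]
                · rw [h v hv]; simp only [e, if_neg hg]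
              split_ifs with h6 h7 h8
              · norm_num
              · norm_num
              · exact absurd (h5 h8) h6
              · norm_num
            · have := pow_le_pow_of_le_one hN0 hN1 hn
              linarith
          · simp only [hn, false_and, if_false]
            exact mean_const_le zero_le_one
    _ ≤ (1 - N ^ 4000) ^ (R - 1) := by
        apply mean_le_of_le (pow_nonneg (by linarith) _)
        intro ω
        simp only [w, c]
        split_ifs
        · rw [one_mul, Finset.prod_const]
          exact pow_le_pow_of_le_one (by linarith) (by linarith [pow_nonneg hN0 4000]) hs
        · rw [zero_mul]
          exact pow_nonneg (by linarith) _

end Coin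


/-! ## Sortition and samples -/

section Sortition

variable {R M S : ℕ} {K V Tx D : Type*} (C : Config M S K V Tx D)

theorem Config.mean_corrupt_prefix_le (hp : 5 * C.corruptPoliticians.card ≤ 4 * S) (m : ℕ)
    (hm : m ≤ 25) :
    mean (fun e : Fin 25 ↪ Fin S =>
      if ∀ i : Fin 25, (i : ℕ) < m → e i ∈ C.corruptPoliticians then (1 : ℝ) else 0) ≤
        (4 / 5) ^ m := by
  refine (mean_embedding_le C.corruptPoliticians 25 m hm).trans ?_
  rw [Fintype.card_fin]
  refine pow_le_pow_left₀ (by positivity) ?_ m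
  apply div_le_of_le_mul₀ (by positivity) (by positivity)
  have : (5 : ℝ) * C.corruptPoliticians.card ≤ 4 * S := by exact_mod_cast hp
  linarith

variable [Finite K]

theorem mean_sortition (hM : 2000 ≤ M) :
    mean (fun a : Fin M => if (a : ℕ) < 2000 then (1 : ℝ) else 0) = 2000 / M := by
  rw [mean_eq, Finset.sum_boole, Fintype.card_fin]
  congr 1
  have : (Finset.univ.filter fun a : Fin M => (a : ℕ) < 2000) =
      Finset.univ.map (Fin.castLEEmb hM) := by
    ext a
    simp only [Finset.mem_filter, Finset.mem_univ, true_and, Finset.mem_map]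
    constructor
    · intro h
      exact ⟨⟨a, h⟩, rfl⟩
    · rintro ⟨b, rfl⟩
      exact b.2
  rw [this, Finset.card_map, Finset.card_univ, Fintype.card_fin]
  norm_num

open scoped Classical in
/-- A product of weights of the committee members is, on average, at most as large as for a
Poisson process. -/
theorem Config.mean_committee_le (hM : 2000 ≤ M) (h : (Fin 25 ↪ Fin S) → ℝ) (B H κ : ℝ)
    (hh : ∀ s, 0 ≤ h s) (hB : 0 ≤ B) (hH : mean h ≤ H)
    (hκ : C.corruptCitizens.card * (B - 1) + (M - C.corruptCitizens.card) * (H - 1) ≤ M * κ) :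
    mean (fun ω : Tape R M S K => ∏ v, if v ∈ ω.setup.committee then
      (if v ∈ C.corruptCitizens then B else h (ω.setup.sample v)) else 1) ≤
        Real.exp (2000 * κ) := by
  have hM0 : (0 : ℝ) < M := by exact_mod_cast (by omega : 0 < M)
  let G : Fin M → Tape R M S K → ℝ := fun v ω => if v ∈ ω.setup.committee then
      (if v ∈ C.corruptCitizens then B else h (ω.setup.sample v)) else 1
  let c : Fin M → Tape R M S K → ℝ := fun v _ =>
    Real.exp (2000 / M * ((if v ∈ C.corruptCitizens then B else H) - 1))
  have hmem : ∀ (σ : Setup M S) v, v ∈ σ.committee ↔ (σ.sortition v : ℕ) < 2000 := by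
    intro σ v
    simp [Setup.committee]
  calc mean (fun ω => ∏ v, G v ω) ≤ mean (fun ω => ∏ v, c v ω) := by
        refine mean_prod_le (setupLens R M S K) G c ?_ (fun _ _ => (Real.exp_pos _).le)
          (fun _ _ _ _ => rfl) ?_ ?_ _
        · intro v ω
          simp only [G]
          split_ifs
          · exact hB
          · exact hh _
          · exact zero_le_one
        · intro v v' hv ω z
          simp only [G, hmem, setupLens, Function.update_of_ne hv.ne]
        · intro v ω
          have : Nonempty (Fin 25 ↪ Fin S) := ⟨ω.setup.sample v⟩
          have : Nonempty (Fin M) := ⟨v⟩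
          simp only [G, hmem, setupLens, Function.update_self]
          let g : (Fin 25 ↪ Fin S) → ℝ := fun s => if v ∈ C.corruptCitizens then B else h s
          have hg : mean (fun s => g s + (-1)) ≤ (if v ∈ C.corruptCitizens then B else H) - 1 := by
            rw [mean_add, mean_const]
            simp only [g]
            split_ifs
            · rw [mean_const]; rfl
            · linarith
          -- On average the factor of a citizen is 1 + (2000/M)(weight - 1), which is bounded by the
          -- exponential.
          have hf : (fun z : Fin M × (Fin 25 ↪ Fin S) => if (z.1 : ℕ) < 2000 then
              (if v ∈ C.corruptCitizens then B else h z.2) else 1) =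
              fun z => 1 + (if (z.1 : ℕ) < 2000 then (1 : ℝ) else 0) * (g z.2 + (-1)) := by
            funext z
            simp only [g]
            split_ifs <;> ring
          rw [hf, mean_add, mean_const,
            mean_prod_mul (fun a : Fin M => if (a : ℕ) < 2000 then (1 : ℝ) else 0)
              (fun s => g s + (-1)), mean_sortition hM]
          have h2 := mul_le_mul_of_nonneg_left hg (by positivity : (0 : ℝ) ≤ 2000 / M)
          have h3 := Real.add_one_le_exp
            (2000 / M * ((if v ∈ C.corruptCitizens then B else H) - 1))
          simp only [c]
          linarith
    _ ≤ Real.exp (2000 * κ) := by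
        apply mean_le_of_le (Real.exp_pos _).le
        intro ω
        simp only [c]
        rw [← Real.exp_sum, Real.exp_le_exp, ← Finset.mul_sum, Finset.sum_sub_distrib,
          Finset.sum_ite]
        simp only [Finset.sum_const, Finset.filter_mem_eq_inter, Finset.univ_inter,
          Finset.filter_notMem_eq_sdiff, Finset.card_univ, Fintype.card_fin, nsmul_eq_mul,
          Finset.card_sdiff_of_subset (Finset.subset_univ _)]
        rw [Nat.cast_sub (by simpa using Finset.card_le_univ C.corruptCitizens)]
        rw [div_mul_eq_mul_div, div_le_iff₀ hM0]
        nlinarith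

/-- The rate of the exponential bound for the weights `g` of good and `b` of bad members. -/
noncomputable def weightRate (g b : ℝ) : ℝ :=
  1 / 4 * (b - 1) + 3 / 4 * ((4 / 5) ^ 25 * b + (1 - (4 / 5) ^ 25) * g - 1)

/-- A member fails to be good by corruption, for at most a quarter of the citizens, or by an
all-corrupt sample, with probability at most (4/5)^25. Since `g ≤ b`, both bounds may be replaced by
equalities. Choosing the weights suitably gives Chernoff bounds for linear combinations of the two
counts. -/
theorem Config.mean_good_bad_le (hM : 2000 ≤ M) (hc : 4 * C.corruptCitizens.card ≤ M)
    (hp : 5 * C.corruptPoliticians.card ≤ 4 * S) (g b : ℝ) (hg : 0 ≤ g) (hgb : g ≤ b) :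
    mean (fun ω : Tape R M S K => g ^ (C.good ω.setup).card *
      b ^ (ω.setup.committee.card - (C.good ω.setup).card)) ≤
        Real.exp (2000 * weightRate g b) := by
  classical
  let h : (Fin 25 ↪ Fin S) → ℝ := fun e => if ∃ i, e i ∉ C.corruptPoliticians then g else b
  let ε : ℝ := (4 / 5) ^ 25
  have hε1 : ε ≤ 1 := pow_le_one₀ (by norm_num) (by norm_num)
  have hε0 : 0 ≤ ε := by positivity
  let H : ℝ := ε * b + (1 - ε) * g
  have hH : mean h ≤ H := by
    rcases isEmpty_or_nonempty (Fin 25 ↪ Fin S) with hE | hE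
    · have : mean h = 0 := by rw [mean_eq]; simp
      rw [this]
      have := hg.trans hgb
      have : 0 ≤ 1 - ε := by linarith
      positivity
    have h1 : h = fun e => g + (b - g) *
        (if ∀ i : Fin 25, (i : ℕ) < 25 → e i ∈ C.corruptPoliticians then (1 : ℝ) else 0) := by
      funext e
      simp only [h]
      split_ifs with h1 h2 h2
      · obtain ⟨i, hi⟩ := h1
        exact absurd (h2 i i.2) hi
      · ring
      · ring
      · push Not at h1
        exact absurd (fun i _ => h1 i) h2
    rw [h1, mean_add, mean_const, mean_mul_left]
    have := mul_le_mul_of_nonneg_left (C.mean_corrupt_prefix_le hp 25 le_rfl)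
      (sub_nonneg.mpr hgb)
    change _ ≤ ε * b + (1 - ε) * g
    change _ ≤ (b - g) * ε at this
    linarith
  have hHb : H ≤ b := by
    change ε * b + (1 - ε) * g ≤ b
    nlinarith
  have hc' : (4 : ℝ) * C.corruptCitizens.card ≤ M := by exact_mod_cast hc
  have key := C.mean_committee_le (R := R) hM h b H (weightRate g b) (fun s => ?_)
    (hg.trans hgb) hH ?_
  · refine le_trans (le_of_eq ?_) key
    congr 1
    funext ω
    rw [Finset.prod_ite_mem, Finset.univ_inter]
    have hgood : ∀ v ∈ ω.setup.committee,
        (if v ∈ C.corruptCitizens then b else h (ω.setup.sample v)) =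
          if v ∈ C.good ω.setup then g else b := by
      intro v hv
      have hmem : v ∈ C.good ω.setup ↔ v ∈ ω.setup.committee ∧ v ∉ C.corruptCitizens ∧
          C.Reaches ω.setup v := Finset.mem_filter
      by_cases h1 : v ∈ C.corruptCitizens
      · rw [if_pos h1, if_neg fun h2 => (hmem.mp h2).2.1 h1]
      · rw [if_neg h1]
        by_cases h2 : C.Reaches ω.setup v
        · rw [if_pos (hmem.mpr ⟨hv, h1, h2⟩)]
          exact if_pos h2
        · rw [if_neg fun h3 => h2 (hmem.mp h3).2.2]
          exact if_neg h2
    rw [Finset.prod_congr rfl hgood, Finset.prod_ite, Finset.prod_const, Finset.prod_const,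
      Finset.filter_mem_eq_inter, Finset.inter_eq_right.mpr (C.good_subset _),
      Finset.filter_notMem_eq_sdiff, Finset.card_sdiff_of_subset (C.good_subset _)]
  · simp only [h]
    split_ifs
    · exact hg
    · exact hg.trans hgb
  · have : weightRate g b = 1 / 4 * (b - 1) + 3 / 4 * (H - 1) := rfl
    rw [this]
    nlinarith

end Sortition

/-! ## Spot-checks -/

theorem exp_neg_bound : Real.exp (-(501 * 15 / 1000)) ≤ 11 / 20000 := by
  have h1 : (2.7182818283 : ℝ) < Real.exp 1 := Real.exp_one_gt_d9
  have h2 : (1.67 : ℝ) ≤ Real.exp 0.515 :=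
    le_trans (by norm_num [Finset.sum_range_succ, Nat.factorial])
      (Real.sum_le_exp_of_nonneg (by norm_num : (0 : ℝ) ≤ 0.515) 4)
  rw [Real.exp_neg, show (501 * 15 / 1000 : ℝ) = 7 * 1 + 0.515 by norm_num, Real.exp_add,
    show Real.exp (7 * 1) = Real.exp 1 ^ 7 by rw [← Real.exp_nat_mul]; norm_num]
  apply inv_le_of_inv_le₀ (by norm_num)
  have h3 : (2.718 : ℝ) ^ 7 ≤ Real.exp 1 ^ 7 := by gcongr; linarith
  calc (11 / 20000 : ℝ)⁻¹ ≤ 2.718 ^ 7 * 1.67 := by norm_num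
    _ ≤ _ := by gcongr

open scoped Classical in
-- With k keys, at least 501 of them wrong, and m ≥ 0.015k checks, the probability to miss is at
-- most (1 - 501/k)^m ≤ exp(-501 · 0.015), uniformly in k.
theorem mean_readSpot_le {K : Type*} [Finite K] (H W : Finset K) (hW : W ⊆ H)
    (h500 : 500 < W.card) :
    mean (fun z : Pick K spotCount => if Disjoint (z H).1 W then (1 : ℝ) else 0) ≤ 11 / 20000 := by
  have hne : ∀ H : Finset K,
      Nonempty {s : Finset K // s ⊆ H ∧ s.card = min (spotCount H.card) H.card} := fun H => by
    obtain ⟨s, hs⟩ := Finset.exists_subset_card_eq (min_le_right (spotCount H.card) H.card)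
    exact ⟨⟨s, hs⟩⟩
  have hk := Finset.card_le_card hW
  refine (mean_pi_apply (B := fun H : Finset K =>
    {s : Finset K // s ⊆ H ∧ s.card = min (spotCount H.card) H.card}) H
    fun s => if Disjoint s.1 W then (1 : ℝ) else 0).trans_le ?_
  refine (mean_disjoint_le H W hW _ _ (fun _ => Iff.rfl) (min_le_right _ _) (by omega)).trans ?_
  have hk0 : (0 : ℝ) < H.card := by exact_mod_cast (by omega : 0 < H.card)
  set m := min (spotCount H.card) H.card with hm
  -- This also covers small k, where the minimum with k could take effect.
  have hm15 : 15 * H.card ≤ 1000 * m := by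
    have : 15 * H.card ≤ 1000 * spotCount H.card := by unfold spotCount; omega
    rw [hm]
    rcases min_choice (spotCount H.card) H.card with h | h <;> rw [h] <;> omega
  refine le_trans ?_ exp_neg_bound
  have h1 : ((H.card - W.card : ℕ) : ℝ) / H.card ≤ Real.exp (-(501 / H.card)) := by
    refine le_trans ?_ (Real.one_sub_le_exp_neg _)
    rw [Nat.cast_sub hk, sub_div, div_self hk0.ne']
    have : (501 : ℝ) ≤ W.card := by exact_mod_cast h500
    gcongr
  calc _ ≤ Real.exp (-(501 / H.card)) ^ m := by gcongr
    _ = Real.exp (-(501 * m / H.card)) := by rw [← Real.exp_nat_mul]; congr 1; ring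
    _ ≤ _ := by
        rw [Real.exp_le_exp, neg_le_neg_iff, le_div_iff₀ hk0]
        have : (15 : ℝ) * H.card ≤ 1000 * m := by exact_mod_cast hm15
        linarith

/-- At least 801 of the 8192 nodes are wrong, so each of the 72 draws has at most 7391 harmless
nodes. -/
theorem mean_writeSpot_le {n : ℕ} (hn : n = 2 ^ 13) (W : Finset (Fin n)) (h800 : 800 < W.card) :
    mean (fun z : {s : Finset (Fin n) // s.card = 72} =>
      if Disjoint z.1 W then (1 : ℝ) else 0) ≤ 61 / 100000 := by
  have hc : (Finset.univ : Finset (Fin n)).card = n := by rw [Finset.card_univ, Fintype.card_fin]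
  refine (mean_disjoint_le Finset.univ W (Finset.subset_univ _) 72 (fun s => s.card = 72)
    (fun s => ⟨fun h => ⟨Finset.subset_univ _, h⟩, fun h => h.2⟩) (by rw [hc, hn]; norm_num)
    (by rw [hc, hn]; norm_num)).trans ?_
  rw [hc]
  have h1 : ((n - W.card : ℕ) : ℝ) ≤ 7391 := by
    have hn' : n = 8192 := by rw [hn]; norm_num
    have : n - W.card ≤ 7391 := by omega
    exact_mod_cast this
  calc (((n - W.card : ℕ) : ℝ) / n) ^ 72 ≤ (7391 / n) ^ 72 := by gcongr
    _ ≤ 61 / 100000 := by rw [hn]; norm_num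


/-! ## The second re-upload -/

section Upload

variable {R M S : ℕ} {K V Tx D : Type*} (C : Config M S K V Tx D)
  (A : Adversary R M S K V Tx D)

/-- `v` re-uploads its pool of the `i`-th designated politician to an honest politician. -/
def Config.Uploads (ω : Tape R M S K) (i : Fin 45) (v : Fin M) : Prop :=
  (ω.upload2 v).2 ∉ C.corruptPoliticians ∧
    i ∈ ((ω.upload2 v).1 (heldIndices (C.held2 A ω v))).1

/-- The proposal `p`, which contains a pool of the `i`-th designated politician, may be the output
of the byzantine agreement. -/
def Config.Eligible (ω : Tape R M S K) (i : Fin 45) (p : Proposal M D) : Prop :=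
  C.GoodMajority ω.setup ∧ ω.setup.committee.card + 1800 ≤ 3 * (C.good ω.setup).card ∧
    p.ids i ≠ none ∧ 3 * (C.good ω.setup).card <
      3 * (C.supporters A ω (some p)).card + ω.setup.committee.card

open scoped Classical in
/-- The supporters of an eligible proposal. -/
noncomputable def Config.backers (ω : Tape R M S K) (i : Fin 45) : Finset (Fin M) :=
  Finset.univ.filter fun v => ∃ p, C.Eligible A ω i p ∧ v ∈ C.supporters A ω (some p)

variable {C A}

theorem Config.mem_supporters {ω : Tape R M S K} {x : Value M D} {v : Fin M} :
    v ∈ C.supporters A ω x ↔ v ∈ C.good ω.setup ∧ C.initial A ω v = x := by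
  classical
  exact Finset.mem_filter

theorem Config.held2_of_initial {ω : Tape R M S K} {v : Fin M} {p : Proposal M D}
    (h : C.initial A ω v = some p) {i : Fin 45} {c : D} (hc : p.ids i = some c) :
    ∃ q, C.held2 A ω v i = some q ∧ C.hash (.pool q) = c := by
  classical
  unfold Config.initial at h
  rw [Option.filter_eq_some_iff] at h
  exact of_decide_eq_true h.2 i c hc

/-- Two proposals have disjoint sets of supporters, each with more than g - n/3 members; both fit
into the good set only if 3g < 2n. -/
theorem Config.Eligible.unique {ω : Tape R M S K} {i : Fin 45} {p p' : Proposal M D}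
    (h : C.Eligible A ω i p) (h' : C.Eligible A ω i p') : p = p' := by
  classical
  by_contra hne
  have hd : Disjoint (C.supporters A ω (some p)) (C.supporters A ω (some p')) := by
    rw [Finset.disjoint_left]
    intro v hv hv'
    rw [Config.mem_supporters] at hv hv'
    exact hne (Option.some.inj (hv.2.symm.trans hv'.2))
  have hsub : C.supporters A ω (some p) ∪ C.supporters A ω (some p') ⊆ C.good ω.setup := by
    intro v hv
    rw [Finset.mem_union, Config.mem_supporters, Config.mem_supporters] at hv
    exact hv.elim (fun h => h.1) fun h => h.1
  have h1 := Finset.card_le_card hsub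
  rw [Finset.card_union_of_disjoint hd] at h1
  obtain ⟨h2, -, -, h3⟩ := h
  obtain ⟨-, -, -, h4⟩ := h'
  unfold Config.GoodMajority at h2
  omega

theorem Config.Eligible.backers {ω : Tape R M S K} {i : Fin 45} {p : Proposal M D}
    (h : C.Eligible A ω i p) : C.backers A ω i = C.supporters A ω (some p) := by
  classical
  ext v
  simp only [Config.backers, Finset.mem_filter, Finset.mem_univ, true_and]
  constructor
  · rintro ⟨p', h', hv⟩
    rwa [h.unique h']
  · exact fun hv => ⟨p, h, hv⟩

theorem Config.mem_heldIndices_of_backers {ω : Tape R M S K} {i : Fin 45} {v : Fin M}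
    (h : v ∈ C.backers A ω i) : i ∈ heldIndices (C.held2 A ω v) := by
  classical
  simp only [Config.backers, Finset.mem_filter, Finset.mem_univ, true_and] at h
  obtain ⟨p, hp, hv⟩ := h
  obtain ⟨c, hc⟩ := Option.ne_none_iff_exists'.mp hp.2.2.1
  obtain ⟨q, hq, -⟩ := Config.held2_of_initial (Config.mem_supporters.mp hv).2 hc
  simp [heldIndices, hq]

theorem Config.Agree.supporters {ω ω' : Tape R M S K} {T : ℕ} (h : C.Agree T ω ω')
    (hT : 1 ≤ T) : C.supporters A ω = C.supporters A ω' := by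
  funext x
  unfold Config.supporters
  rw [h.setup, h.initial hT]

theorem Config.Agree.eligible {ω ω' : Tape R M S K} {T : ℕ} (h : C.Agree T ω ω')
    (hT : 1 ≤ T) : C.Eligible A ω = C.Eligible A ω' := by
  funext i p
  unfold Config.Eligible
  rw [h.setup, h.supporters hT]

theorem Config.Agree.backers {ω ω' : Tape R M S K} {T : ℕ} (h : C.Agree T ω ω')
    (hT : 1 ≤ T) : C.backers A ω = C.backers A ω' := by
  funext i
  unfold Config.backers
  rw [h.supporters hT, h.eligible hT]

/-- Winners, held pools and supporters are settled at time 1, one step before the second re-upload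
is revealed. This makes the re-uploads fresh randomness relative to them. -/
theorem Config.agree_upload (ω : Tape R M S K) (v : Fin M) (z : Reupload S 10) :
    C.Agree 1 ((uploadLens R M S K v).set ω z) ω := by
  intro t ht
  unfold Config.view uploadLens
  congr 1
  rw [if_neg (by omega), if_neg (by omega)]

theorem Config.uploads_set_of_ne {ω : Tape R M S K} {v v' : Fin M} (h : v' ≠ v)
    (z : Reupload S 10) (i : Fin 45) :
    C.Uploads A ((uploadLens R M S K v).set ω z) i v' ↔ C.Uploads A ω i v' := by
  have hu : ((uploadLens R M S K v).set ω z).upload2 v' = ω.upload2 v' :=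
    Function.update_of_ne h _ _
  unfold Config.Uploads
  rw [(Config.agree_upload (C := C) ω v z).held2 le_rfl, hu]

theorem Config.uploads_set_self {ω : Tape R M S K} {v : Fin M} (z : Reupload S 10) (i : Fin 45) :
    C.Uploads A ((uploadLens R M S K v).set ω z) i v ↔
      z.2 ∉ C.corruptPoliticians ∧ i ∈ (z.1 (heldIndices (C.held2 A ω v))).1 := by
  have hu : ((uploadLens R M S K v).set ω z).upload2 v = z := Function.update_self _ _ _
  unfold Config.Uploads
  rw [(Config.agree_upload (C := C) ω v z).held2 le_rfl, hu]

variable (C)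

open scoped Classical in
-- A held pool is picked with probability min(10, |H|)/|H| ≥ 10/45, and independently the politician
-- is honest with probability at least 1/5; the complement is at most 1 - 2/45.
theorem Config.mean_not_upload_le (hp : 5 * C.corruptPoliticians.card ≤ 4 * S) (hS : 0 < S)
    (H : Finset (Fin 45)) (i : Fin 45) (hi : i ∈ H) :
    mean (fun z : Reupload S 10 => if z.2 ∉ C.corruptPoliticians ∧ i ∈ (z.1 H).1
      then (0 : ℝ) else 1) ≤ 43 / 45 := by
  have hne : ∀ H : Finset (Fin 45),
      Nonempty {s : Finset (Fin 45) // s ⊆ H ∧ s.card = min 10 H.card} := fun H => by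
    obtain ⟨s, hs⟩ := Finset.exists_subset_card_eq (min_le_right 10 H.card)
    exact ⟨⟨s, hs⟩⟩
  have : Nonempty (Fin S) := ⟨⟨0, hS⟩⟩
  have hH0 : 0 < H.card := Finset.card_pos.mpr ⟨i, hi⟩
  have hH45 : H.card ≤ 45 := by simpa using Finset.card_le_univ H
  set m := min 10 H.card with hm
  have hmle : m ≤ H.card := min_le_right _ _
  have hm10 : 2 * H.card ≤ 9 * m := by
    rw [hm]
    rcases min_choice 10 H.card with h | h <;> rw [h] <;> omega
  have hpick : (10 / 45 : ℝ) ≤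
      mean (fun z : Pick (Fin 45) (fun _ => 10) => if i ∈ (z H).1 then (1 : ℝ) else 0) := by
    rw [mean_pi_apply (B := fun H : Finset (Fin 45) =>
      {s : Finset (Fin 45) // s ⊆ H ∧ s.card = min 10 H.card}) H
      fun s => if i ∈ s.1 then (1 : ℝ) else 0]
    have h1 : (fun s : {s : Finset (Fin 45) // s ⊆ H ∧ s.card = min 10 H.card} =>
        if i ∈ s.1 then (1 : ℝ) else 0) =
        fun s => 1 + (-1) * (if Disjoint s.1 {i} then (1 : ℝ) else 0) := by
      funext s
      by_cases h : i ∈ s.1 <;> simp [h]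
    rw [h1, mean_add, mean_const, mean_mul_left,
      mean_disjoint H {i} (by simpa using hi) m _ fun _ => Iff.rfl, Finset.card_singleton]
    have hpos : (0 : ℝ) < H.card.choose m := by exact_mod_cast Nat.choose_pos hmle
    have h2 : ((H.card - 1).choose m : ℝ) / H.card.choose m = (H.card - m) / H.card := by
      rw [div_eq_div_iff hpos.ne' (by positivity)]
      have := Nat.choose_mul_succ_eq (H.card - 1) m
      rw [Nat.sub_add_cancel hH0] at this
      rw [← Nat.cast_sub hmle, mul_comm ((H.card - m : ℕ) : ℝ)]
      exact_mod_cast this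
    rw [h2]
    have hH0' : (0 : ℝ) < H.card := by exact_mod_cast hH0
    have hm10' : (2 : ℝ) * H.card ≤ 9 * m := by exact_mod_cast hm10
    have h3 : ((H.card : ℝ) - m) / H.card ≤ 35 / 45 := by
      rw [div_le_iff₀ hH0']
      linarith
    linarith
  have hpol : (1 / 5 : ℝ) ≤
      mean (fun z : Fin S => if z ∉ C.corruptPoliticians then (1 : ℝ) else 0) := by
    rw [mean_eq, Finset.sum_boole, Fintype.card_fin, Finset.filter_notMem_eq_sdiff,
      Finset.card_sdiff_of_subset (Finset.subset_univ _), Finset.card_univ, Fintype.card_fin,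
      Nat.cast_sub (by simpa using Finset.card_le_univ C.corruptPoliticians),
      le_div_iff₀ (by exact_mod_cast hS)]
    have : (5 : ℝ) * C.corruptPoliticians.card ≤ 4 * S := by exact_mod_cast hp
    linarith
  have hsplit : (fun z : Reupload S 10 => if z.2 ∉ C.corruptPoliticians ∧ i ∈ (z.1 H).1
      then (0 : ℝ) else 1) = fun z => 1 + (-1) * ((if i ∈ (z.1 H).1 then (1 : ℝ) else 0) *
        (if z.2 ∉ C.corruptPoliticians then (1 : ℝ) else 0)) := by
    funext z
    by_cases h1 : i ∈ (z.1 H).1 <;> by_cases h2 : z.2 ∈ C.corruptPoliticians <;> simp [h1, h2]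
  have : Nonempty (Pick (Fin 45) fun _ => 10) := inferInstance
  rw [hsplit, mean_add, mean_const, mean_mul_left,
    mean_prod_mul (fun z : Pick (Fin 45) (fun _ => 10) => if i ∈ (z H).1 then (1 : ℝ) else 0)
      (fun z : Fin S => if z ∉ C.corruptPoliticians then (1 : ℝ) else 0)]
  have := mul_le_mul hpick hpol (by norm_num) (le_trans (by norm_num) hpick)
  linarith

variable (A) [Finite K]

/-- By uniqueness the backers form one set that is known before the re-upload. So no union over
proposals is needed, and the factors 43/45 of the backers multiply. -/
theorem Config.prob_eligible_le (hp : 5 * C.corruptPoliticians.card ≤ 4 * S) (i : Fin 45) :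
    prob (fun ω : Tape R M S K => ∃ p, C.Eligible A ω i p ∧
      ∀ v ∈ C.supporters A ω (some p), ¬ C.Uploads A ω i v) ≤ (43 / 45) ^ 601 := by
  classical
  let w : Tape R M S K → ℝ := fun ω => if ∃ p, C.Eligible A ω i p then 1 else 0
  let G : Fin M → Tape R M S K → ℝ := fun v ω =>
    if v ∈ C.backers A ω i ∧ C.Uploads A ω i v then 0 else 1
  let c : Fin M → Tape R M S K → ℝ := fun v ω => if v ∈ C.backers A ω i then 43 / 45 else 1
  have hw0 : ∀ ω, 0 ≤ w ω := fun ω => by simp only [w]; split_ifs <;> norm_num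
  have hG0 : ∀ r ω, 0 ≤ G r ω := fun r ω => by simp only [G]; split_ifs <;> norm_num
  have hc0 : ∀ r ω, 0 ≤ c r ω := fun r ω => by simp only [c]; split_ifs <;> norm_num
  have hb : ∀ v (ω : Tape R M S K) z, C.backers A ((uploadLens R M S K v).set ω z) i =
      C.backers A ω i := fun v ω z => by
    rw [(Config.agree_upload (C := C) ω v z).backers le_rfl]
  calc prob _ ≤ mean (fun ω => w ω * ∏ v, G v ω) := by
        apply prob_le_mean
        · exact fun ω => mul_nonneg (hw0 ω) (Finset.prod_nonneg fun r _ => hG0 r ω)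
        · rintro ω ⟨p, h1, h2⟩
          have h3 : ∀ v ∈ Finset.univ, G v ω = 1 := fun v _ =>
            if_neg fun h => h2 v (h1.backers ▸ h.1) h.2
          rw [Finset.prod_congr rfl h3]
          have : ∃ p, C.Eligible A ω i p := ⟨p, h1⟩
          simp [w, this]
    _ ≤ mean (fun ω => w ω * ∏ v, c v ω) := by
        refine mean_mul_prod_le (uploadLens R M S K) G c hG0 hc0 ?_ ?_ ?_ _ w hw0 ?_
        · intro v v' ω z
          simp only [c, hb]
        · intro v v' hv ω z
          simp only [G, hb, Config.uploads_set_of_ne hv.ne]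
        · intro v ω
          simp only [G, c, hb, Config.uploads_set_self]
          by_cases hv : v ∈ C.backers A ω i
          · simp only [hv, true_and, if_true]
            have hS : 0 < S := (ω.setup.sample v 0).pos
            exact C.mean_not_upload_le hp hS _ i (Config.mem_heldIndices_of_backers hv)
          · simp only [hv, false_and, if_false]
            exact mean_const_le zero_le_one
        · intro v ω z
          simp only [w, (Config.agree_upload (C := C) ω v z).eligible le_rfl]
    _ ≤ (43 / 45) ^ 601 := by
        apply mean_le_of_le (by positivity)
        intro ω
        simp only [w, c]
        split_ifs with h
        · obtain ⟨p, h⟩ := h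
          rw [one_mul, Finset.prod_ite_mem, Finset.univ_inter, Finset.prod_const, h.backers]
          apply pow_le_pow_of_le_one (by norm_num) (by norm_num)
          -- From n + 1800 ≤ 3g < 3s + n follows s > 600, hence the exponent 601.
          obtain ⟨-, h1, -, h2⟩ := h
          omega
        · rw [zero_mul]
          positivity

theorem Config.prob_not_stored_le (hp : 5 * C.corruptPoliticians.card ≤ 4 * S) :
    prob (fun ω : Tape R M S K => C.GoodMajority ω.setup ∧
      ω.setup.committee.card + 1800 ≤ 3 * (C.good ω.setup).card ∧
      ∃ p, 3 * (C.good ω.setup).card <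
        3 * (C.supporters A ω (some p)).card + ω.setup.committee.card ∧ ¬ C.Stored A ω p) ≤
      45 * (43 / 45) ^ 601 := by
  refine (prob_mono (F := fun ω => ∃ i, ∃ p, C.Eligible A ω i p ∧
      ∀ v ∈ C.supporters A ω (some p), ¬ C.Uploads A ω i v) ?_).trans ?_
  · rintro ω ⟨h1, h2, p, h3, h4⟩
    unfold Config.Stored at h4
    push Not at h4
    obtain ⟨i, c, hc, h5⟩ := h4
    refine ⟨i, p, ⟨h1, h2, by rw [hc]; simp, h3⟩, fun v hv hu => ?_⟩
    rw [Config.mem_supporters] at hv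
    obtain ⟨q, hq, hqc⟩ := Config.held2_of_initial hv.2 hc
    exact h5 q (Or.inr (Or.inl ⟨v, hv.1, hu.1, hu.2, hq⟩)) hqc
  · refine (prob_exists_le _).trans ?_
    refine (Finset.sum_le_sum fun i _ => C.prob_eligible_le A hp i).trans ?_
    rw [Finset.sum_const, Finset.card_univ, Fintype.card_fin, nsmul_eq_mul]
    norm_num

end Upload

/-! ## Spot-checks that miss wrong values -/

section Fails

variable {R M S : ℕ} {K V Tx D : Type*} (C : Config M S K V Tx D)
  (A : Adversary R M S K V Tx D)

/-- The honest committee member `v` may rely on its `j`-th politician, which is corrupted. -/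
def Config.Exposed (σ : Setup M S) (j : Fin 25) (v : Fin M) : Prop :=
  v ∈ σ.committee ∧ v ∉ C.corruptCitizens ∧ ∀ i ≤ j, σ.sample v i ∈ C.corruptPoliticians

variable {C A}

theorem Config.agree_read (ω : Tape R M S K) (l : Fin 25 ×ₗ Fin M) (z : Pick K spotCount) :
    C.Agree (3 + R + (ofLex l).1) ((readLens R M S K l).set ω z) ω := by
  intro t ht
  unfold Config.view readLens
  congr 1
  funext j
  by_cases h : 3 + R + (j : ℕ) < t
  · have : j ≠ (ofLex l).1 := by rintro rfl; omega
    simp only [if_pos h, Function.update_of_ne this]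
  · simp only [if_neg h]

theorem Config.agree_write (ω : Tape R M S K) (l : Fin 25 ×ₗ Fin M)
    (z : {s : Finset (Fin (2 ^ 13)) // s.card = 72}) :
    C.Agree (3 + R + 25 + (ofLex l).1) ((writeLens R M S K l).set ω z) ω := by
  intro t ht
  unfold Config.view writeLens
  congr 1
  funext j
  by_cases h : 3 + R + 25 + (j : ℕ) < t
  · have : j ≠ (ofLex l).1 := by rintro rfl; omega
    simp only [if_pos h, Function.update_of_ne this]
  · simp only [if_neg h]

theorem readSpot_set_of_lt {ω : Tape R M S K} {l l' : Fin 25 ×ₗ Fin M} (h : l' < l)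
    (z : Pick K spotCount) :
    ((readLens R M S K l).set ω z).readSpot (ofLex l').1 (ofLex l').2 =
      ω.readSpot (ofLex l').1 (ofLex l').2 := by
  by_cases h1 : (ofLex l').1 = (ofLex l).1
  · have h2 : (ofLex l').2 ≠ (ofLex l).2 := fun h2 => h.ne (Prod.ext h1 h2)
    simp only [readLens, h1, Function.update_self, Function.update_of_ne h2]
  · simp only [readLens, Function.update_of_ne h1]

theorem writeSpot_set_of_lt {ω : Tape R M S K} {l l' : Fin 25 ×ₗ Fin M} (h : l' < l)
    (z : {s : Finset (Fin (2 ^ 13)) // s.card = 72}) :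
    ((writeLens R M S K l).set ω z).writeSpot (ofLex l').1 (ofLex l').2 =
      ω.writeSpot (ofLex l').1 (ofLex l').2 := by
  by_cases h1 : (ofLex l').1 = (ofLex l).1
  · have h2 : (ofLex l').2 ≠ (ofLex l).2 := fun h2 => h.ne (Prod.ext h1 h2)
    simp only [writeLens, h1, Function.update_self, Function.update_of_ne h2]
  · simp only [writeLens, Function.update_of_ne h1]

theorem fst_le_of_lex_lt {l l' : Fin 25 ×ₗ Fin M} (h : l' < l) :
    ((ofLex l').1 : ℕ) ≤ (ofLex l).1 := by
  rcases Prod.Lex.lt_iff.mp h with h | h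
  · exact h.le
  · exact (congrArg Fin.val h.1).le

variable [Fintype K]

theorem Config.ReadFails.exposed {ω : Tape R M S K} {j : Fin 25} {v : Fin M}
    (h : C.ReadFails A ω j v) : C.Exposed ω.setup j v :=
  ⟨h.1.1, h.1.2.1, fun i hi => not_not.mp (h.1.2.2 i hi)⟩

theorem Config.WriteFails.exposed {ω : Tape R M S K} {j : Fin 25} {v : Fin M}
    (h : C.WriteFails A ω j v) : C.Exposed ω.setup j v :=
  ⟨h.1.1, h.1.2.1, fun i hi => not_not.mp (h.1.2.2 i hi)⟩

variable (C A)

open scoped Classical in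
-- The set `W` of wrong keys is fixed before the spot-check is drawn, and failure means that the
-- check avoids `W`. A failure of probability p weighted by 4 has mean at most 1 + 3p; without
-- exposure no failure is possible.
theorem Config.mean_readFails_le (ω : Tape R M S K) (l : Fin 25 ×ₗ Fin M) :
    mean (fun z => if C.ReadFails A ((readLens R M S K l).set ω z) (ofLex l).1 (ofLex l).2
      then (4 : ℝ) else 1) ≤
      if C.Exposed ω.setup (ofLex l).1 (ofLex l).2 then 1 + 3 * (11 / 20000) else 1 := by
  have hag := fun z => Config.agree_read (C := C) ω l z
  have hset : ∀ z, ((readLens R M S K l).set ω z).readSpot (ofLex l).1 (ofLex l).2 = z :=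
    (readLens R M S K l).get_set ω
  by_cases h : C.Exposed ω.setup (ofLex l).1 (ofLex l).2 ∧
      ∃ p txs, C.out A ω (ofLex l).2 = some (some p) ∧
        C.txsOf A ω (ofLex l).2 p = some txs ∧
        500 < ((C.keysIn txs).filter fun κ =>
          C.readVals A ω (ofLex l).2 (ofLex l).1 κ ≠ C.state κ).card
  · obtain ⟨he, p, txs, h1, h2, h3⟩ := h
    rw [if_pos he]
    set W := (C.keysIn txs).filter fun κ =>
      C.readVals A ω (ofLex l).2 (ofLex l).1 κ ≠ C.state κ with hW
    have hle := mean_readSpot_le (C.keysIn txs) W (Finset.filter_subset _ _) h3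
    calc _ ≤ mean (fun z : Pick K spotCount => 1 + 3 *
          (if Disjoint (z (C.keysIn txs)).1 W then (1 : ℝ) else 0)) := by
          apply mean_mono
          intro z
          have hdis : C.ReadFails A ((readLens R M S K l).set ω z) (ofLex l).1 (ofLex l).2 →
              Disjoint (z (C.keysIn txs)).1 W := by
            rintro ⟨-, p', txs', h1', h2', -, h4'⟩
            rw [(hag z).out (by omega), h1] at h1'
            obtain rfl := Option.some.inj (Option.some.inj h1')
            rw [(hag z).txsOf (by omega), h2] at h2'
            obtain rfl := Option.some.inj h2'
            rw [hset, (hag z).readVals le_rfl] at h4'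
            rw [Finset.disjoint_left]
            intro κ hκ hκW
            exact (Finset.mem_filter.mp hκW).2 (h4' κ hκ)
          by_cases hd : Disjoint (z (C.keysIn txs)).1 W
          · rw [if_pos hd]
            split_ifs <;> norm_num
          · rw [if_neg hd, if_neg fun h => hd (hdis h)]
            norm_num
      _ ≤ 1 + 3 * (11 / 20000) := by
          rw [mean_add, mean_mul_left]
          have := mean_const_le (α := Pick K spotCount) zero_le_one
          linarith
  · have hno : ∀ z, ¬ C.ReadFails A ((readLens R M S K l).set ω z) (ofLex l).1 (ofLex l).2 := by
      intro z hf
      refine h ⟨hf.exposed, ?_⟩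
      obtain ⟨-, p, txs, h1, h2, h3, -⟩ := hf
      rw [(hag z).out (by omega)] at h1
      rw [(hag z).txsOf (by omega)] at h2
      rw [(hag z).readVals le_rfl] at h3
      exact ⟨p, txs, h1, h2, h3⟩
    simp only [hno, if_false]
    refine (mean_const_le zero_le_one).trans ?_
    split_ifs <;> norm_num

open scoped Classical in
theorem Config.mean_writeFails_le (ω : Tape R M S K) (l : Fin 25 ×ₗ Fin M) :
    mean (fun z => if C.WriteFails A ((writeLens R M S K l).set ω z) (ofLex l).1 (ofLex l).2
      then (4 : ℝ) else 1) ≤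
      if C.Exposed ω.setup (ofLex l).1 (ofLex l).2 then 1 + 3 * (61 / 100000) else 1 := by
  have hag := fun z => Config.agree_write (C := C) ω l z
  have hset : ∀ z, ((writeLens R M S K l).set ω z).writeSpot (ofLex l).1 (ofLex l).2 = z :=
    (writeLens R M S K l).get_set ω
  by_cases h : C.Exposed ω.setup (ofLex l).1 (ofLex l).2 ∧
      ∃ p, C.out A ω (ofLex l).2 = some (some p) ∧
        800 < (Finset.univ.filter fun f : Fin (2 ^ 13) =>
          C.frontierOf A ω p (ofLex l).2 (ofLex l).1 f ≠ C.tree (C.polState A ω p) 17 f).card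
  · obtain ⟨he, p, h1, h3⟩ := h
    rw [if_pos he]
    set W := Finset.univ.filter fun f : Fin (2 ^ 13) =>
      C.frontierOf A ω p (ofLex l).2 (ofLex l).1 f ≠ C.tree (C.polState A ω p) 17 f with hW
    have hle := mean_writeSpot_le rfl W h3
    calc _ ≤ mean (fun z : {s : Finset (Fin (2 ^ 13)) // s.card = 72} => 1 + 3 *
          (if Disjoint z.1 W then (1 : ℝ) else 0)) := by
          apply mean_mono
          intro z
          have hdis : C.WriteFails A ((writeLens R M S K l).set ω z) (ofLex l).1 (ofLex l).2 →
              Disjoint z.1 W := by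
            rintro ⟨-, p', h1', -, h4'⟩
            rw [(hag z).out (by omega), h1] at h1'
            obtain rfl := Option.some.inj (Option.some.inj h1')
            rw [hset, (hag z).frontierOf le_rfl, (hag z).polState (by omega)] at h4'
            rw [Finset.disjoint_left]
            intro f hf hfW
            exact (Finset.mem_filter.mp hfW).2 (h4' f hf)
          by_cases hd : Disjoint z.1 W
          · rw [if_pos hd]
            split_ifs <;> norm_num
          · rw [if_neg hd, if_neg fun h => hd (hdis h)]
            norm_num
      _ ≤ 1 + 3 * (61 / 100000) := by
          rw [mean_add, mean_mul_left]
          have := mean_const_le (α := {s : Finset (Fin (2 ^ 13)) // s.card = 72}) zero_le_one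
          linarith
  · have hno : ∀ z, ¬ C.WriteFails A ((writeLens R M S K l).set ω z) (ofLex l).1 (ofLex l).2 := by
      intro z hf
      refine h ⟨hf.exposed, ?_⟩
      obtain ⟨-, p, h1, h3, -⟩ := hf
      rw [(hag z).out (by omega)] at h1
      rw [(hag z).frontierOf le_rfl, (hag z).polState (by omega)] at h3
      exact ⟨p, h1, h3⟩
    simp only [hno, if_false]
    refine (mean_const_le zero_le_one).trans ?_
    split_ifs <;> norm_num

end Fails


/-! ### The number of citizens with a failed spot-check -/

section Count

variable {R M S : ℕ} {K V Tx D : Type*} (C : Config M S K V Tx D)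
  (A : Adversary R M S K V Tx D)

theorem prod_lex {m n : ℕ} (f : Fin m → Fin n → ℝ) :
    ∏ l : Fin m ×ₗ Fin n, f (ofLex l).1 (ofLex l).2 = ∏ v, ∏ j, f j v := by
  rw [Finset.prod_comm, ← Fintype.prod_prod_type' (f := f)]
  exact ofLex.prod_comp fun x : Fin m × Fin n => f x.1 x.2

/-- Each new factor `ρ` adds (ρ - 1) times the product so far, and that product is at most ρ^j. A
product over attempts thus becomes a sum whose mean can be taken term by term. -/
theorem prod_ite_le_one_add_sum {ρ : ℝ} (hρ : 1 ≤ ρ) (u : ℕ → Prop) [DecidablePred u] (n : ℕ) :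
    ∏ j ∈ Finset.range n, (if u j then ρ else 1) ≤
      1 + ∑ j ∈ Finset.range n, (ρ - 1) * ρ ^ j * if u j then 1 else 0 := by
  induction n with
  | zero => simp
  | succ n ih =>
    rw [Finset.prod_range_succ, Finset.sum_range_succ]
    split_ifs with h
    · have h1 : ∏ j ∈ Finset.range n, (if u j then ρ else 1) ≤ ρ ^ n := by
        calc _ ≤ ∏ _j ∈ Finset.range n, ρ := by
              apply Finset.prod_le_prod
              · intro j _; split_ifs <;> linarith
              · intro j _; split_ifs <;> linarith
          _ = ρ ^ n := by simp
      nlinarith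
    · linarith

/-- The factor by which an exposed attempt to read and to write raises the expected weight. -/
noncomputable def spotFactor : ℝ := (1 + 3 * (11 / 20000)) * (1 + 3 * (61 / 100000))

theorem one_le_spotFactor : 1 ≤ spotFactor := by unfold spotFactor; norm_num

open scoped Classical in
-- Attempt j is exposed only if the first j + 1 politicians of the sample are corrupt, with
-- probability at most (4/5)^(j+1). The mean weight `H` of an honest member therefore exceeds 1 by a
-- convergent geometric-like sum, at most 29/2000; corrupt citizens have weight 1.
theorem Config.mean_exposed_le [Finite K] (hM : 2000 ≤ M)
    (hp : 5 * C.corruptPoliticians.card ≤ 4 * S) :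
    mean (fun ω : Tape R M S K => ∏ v, ∏ j,
      if C.Exposed ω.setup j v then spotFactor else 1) ≤ Real.exp 29 := by
  set ρ := spotFactor with hρ
  have hρ1 : 1 ≤ ρ := one_le_spotFactor
  let h : (Fin 25 ↪ Fin S) → ℝ := fun e => ∏ j : Fin 25,
    if ∀ i ≤ j, e i ∈ C.corruptPoliticians then ρ else 1
  let H : ℝ := 1 + ∑ j ∈ Finset.range 25, (ρ - 1) * ρ ^ j * (4 / 5) ^ (j + 1)
  have hH : mean h ≤ H := by
    have h1 : ∀ e, h e ≤ 1 + ∑ j ∈ Finset.range 25, (ρ - 1) * ρ ^ j *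
        if ∀ i : Fin 25, (i : ℕ) < j + 1 → e i ∈ C.corruptPoliticians then 1 else 0 := by
      intro e
      refine le_trans (le_of_eq ?_) (prod_ite_le_one_add_sum hρ1
        (fun j => ∀ i : Fin 25, (i : ℕ) < j + 1 → e i ∈ C.corruptPoliticians) 25)
      rw [← Fin.prod_univ_eq_prod_range (fun j : ℕ =>
        if ∀ i : Fin 25, (i : ℕ) < j + 1 → e i ∈ C.corruptPoliticians then ρ else 1)]
      refine Finset.prod_congr rfl fun j _ => ?_
      have : (∀ i ≤ j, e i ∈ C.corruptPoliticians) ↔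
          ∀ i : Fin 25, (i : ℕ) < (j : ℕ) + 1 → e i ∈ C.corruptPoliticians :=
        forall_congr' fun i => by rw [Fin.le_def, Nat.lt_succ_iff]
      simp only [this]
    refine (mean_mono h1).trans ?_
    rw [mean_add, mean_sum]
    refine add_le_add (mean_const_le zero_le_one) (Finset.sum_le_sum fun j hj => ?_)
    rw [mean_mul_left]
    refine mul_le_mul_of_nonneg_left ?_ (mul_nonneg (by linarith) (by positivity))
    refine le_trans (le_of_eq ?_) (C.mean_corrupt_prefix_le hp (j + 1)
      (by have := Finset.mem_range.mp hj; omega))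
    congr!
  have hH29 : H - 1 ≤ 29 / 2000 := by
    simp only [H, hρ, spotFactor]
    norm_num [Finset.sum_range_succ]
  have hH1 : 1 ≤ H := by
    simp only [H, le_add_iff_nonneg_right]
    exact Finset.sum_nonneg fun j _ =>
      mul_nonneg (mul_nonneg (by linarith) (by positivity)) (by positivity)
  have key := C.mean_committee_le (R := R) hM h 1 H (29 / 2000)
    (fun e => Finset.prod_nonneg fun j _ => by split_ifs <;> linarith) zero_le_one hH ?_
  · rw [show (2000 : ℝ) * (29 / 2000) = 29 by norm_num] at key
    refine le_trans (le_of_eq ?_) key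
    congr 1
    funext ω
    refine Finset.prod_congr rfl fun v _ => ?_
    by_cases h1 : v ∈ ω.setup.committee
    · by_cases h2 : v ∈ C.corruptCitizens
      · simp [Config.Exposed, h1, h2]
      · simp only [Config.Exposed, h1, h2, not_false_eq_true, true_and, if_true, if_false, h]
    · simp [Config.Exposed, h1]
  · have : (0 : ℝ) ≤ C.corruptCitizens.card := by positivity
    have hM0 : (0 : ℝ) ≤ M := by positivity
    nlinarith [mul_nonneg this (sub_nonneg.mpr hH1), mul_le_mul_of_nonneg_left hH29 hM0]

variable [Fintype K]

open scoped Classical in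
-- Factors are averaged out against time: first the writes, whose spot-checks no read factor sees,
-- then the reads. The lexicographic order puts attempts before citizens, since offers in an attempt
-- precede all its checks. What remains depends on the setup alone.
theorem Config.mean_fails_le (hM : 2000 ≤ M) (hp : 5 * C.corruptPoliticians.card ≤ 4 * S) :
    mean (fun ω : Tape R M S K => (∏ l : Fin 25 ×ₗ Fin M,
        if C.ReadFails A ω (ofLex l).1 (ofLex l).2 then (4 : ℝ) else 1) *
      ∏ l : Fin 25 ×ₗ Fin M,
        if C.WriteFails A ω (ofLex l).1 (ofLex l).2 then (4 : ℝ) else 1) ≤ Real.exp 29 := by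
  let Gr : Fin 25 ×ₗ Fin M → Tape R M S K → ℝ := fun l ω =>
    if C.ReadFails A ω (ofLex l).1 (ofLex l).2 then (4 : ℝ) else 1
  let Gw : Fin 25 ×ₗ Fin M → Tape R M S K → ℝ := fun l ω =>
    if C.WriteFails A ω (ofLex l).1 (ofLex l).2 then (4 : ℝ) else 1
  let cr : Fin 25 ×ₗ Fin M → Tape R M S K → ℝ := fun l ω =>
    if C.Exposed ω.setup (ofLex l).1 (ofLex l).2 then 1 + 3 * (11 / 20000) else 1
  let cw : Fin 25 ×ₗ Fin M → Tape R M S K → ℝ := fun l ω =>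
    if C.Exposed ω.setup (ofLex l).1 (ofLex l).2 then 1 + 3 * (61 / 100000) else 1
  have hGr : ∀ l ω, 0 ≤ Gr l ω := fun l ω => by simp only [Gr]; split_ifs <;> norm_num
  have hGw : ∀ l ω, 0 ≤ Gw l ω := fun l ω => by simp only [Gw]; split_ifs <;> norm_num
  have hcr : ∀ l ω, 0 ≤ cr l ω := fun l ω => by simp only [cr]; split_ifs <;> norm_num
  have hcw : ∀ l ω, 0 ≤ cw l ω := fun l ω => by simp only [cw]; split_ifs <;> norm_num
  calc mean (fun ω => (∏ l, Gr l ω) * ∏ l, Gw l ω)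
      ≤ mean (fun ω => (∏ l, Gr l ω) * ∏ l, cw l ω) := by
        refine mean_mul_prod_le (writeLens R M S K) Gw cw hGw hcw (fun _ _ _ _ => rfl) ?_
          (fun l ω => C.mean_writeFails_le A ω l) _ _
          (fun ω => Finset.prod_nonneg fun l _ => hGr l ω) ?_
        · intro l l' hl ω z
          have := fst_le_of_lex_lt hl
          simp only [Gw, (Config.agree_write (C := C) ω l z).writeFails (A := A)
            (by omega : 3 + R + 25 + ((ofLex l').1 : ℕ) ≤ _) (writeSpot_set_of_lt hl z)]
        · intro l ω z
          refine Finset.prod_congr rfl fun l' _ => ?_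
          simp only [Gr, (Config.agree_write (C := C) ω l z).readFails (A := A)
            (by omega : 3 + R + ((ofLex l').1 : ℕ) ≤ _) (v := (ofLex l').2) rfl]
    _ = mean (fun ω => (∏ l, cw l ω) * ∏ l, Gr l ω) := by
        congr 1; funext ω; exact mul_comm _ _
    _ ≤ mean (fun ω => (∏ l, cw l ω) * ∏ l, cr l ω) := by
        refine mean_mul_prod_le (readLens R M S K) Gr cr hGr hcr (fun _ _ _ _ => rfl) ?_
          (fun l ω => C.mean_readFails_le A ω l) _ _
          (fun ω => Finset.prod_nonneg fun l _ => hcw l ω) (fun _ _ _ => rfl)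
        intro l l' hl ω z
        have := fst_le_of_lex_lt hl
        simp only [Gr, (Config.agree_read (C := C) ω l z).readFails (A := A)
          (by omega : 3 + R + ((ofLex l').1 : ℕ) ≤ _) (readSpot_set_of_lt hl z)]
    _ = mean (fun ω : Tape R M S K => ∏ v, ∏ j,
          if C.Exposed ω.setup j v then spotFactor else 1) := by
        congr 1
        funext ω
        rw [← Finset.prod_mul_distrib,
          ← prod_lex fun j v => if C.Exposed ω.setup j v then spotFactor else 1]
        refine Finset.prod_congr rfl fun l _ => ?_
        simp only [cw, cr, spotFactor]
        split_ifs
        · ring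
        · norm_num
    _ ≤ Real.exp 29 := C.mean_exposed_le hM hp

open scoped Classical in
-- Every failing citizen contributes at least a factor 4 to the product, so 37 of them make it at
-- least 4^37, and Markov's inequality applies.
theorem Config.prob_fails_le (hM : 2000 ≤ M) (hp : 5 * C.corruptPoliticians.card ≤ 4 * S) :
    prob (fun ω : Tape R M S K => 36 < ((C.good ω.setup).filter fun v =>
      ∃ j, C.ReadFails A ω j v ∨ C.WriteFails A ω j v).card) ≤ Real.exp 29 / 4 ^ 37 := by
  let Gr : Fin 25 → Fin M → Tape R M S K → ℝ := fun j v ω =>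
    if C.ReadFails A ω j v then (4 : ℝ) else 1
  let Gw : Fin 25 → Fin M → Tape R M S K → ℝ := fun j v ω =>
    if C.WriteFails A ω j v then (4 : ℝ) else 1
  have hGr : ∀ j v ω, 1 ≤ Gr j v ω := fun j v ω => by simp only [Gr]; split_ifs <;> norm_num
  have hGw : ∀ j v ω, 1 ≤ Gw j v ω := fun j v ω => by simp only [Gw]; split_ifs <;> norm_num
  have hG1 : ∀ j v ω, 1 ≤ Gr j v ω * Gw j v ω := fun j v ω =>
    one_le_mul_of_one_le_of_one_le (hGr j v ω) (hGw j v ω)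
  have hprod : ∀ ω, (∏ l : Fin 25 ×ₗ Fin M, Gr (ofLex l).1 (ofLex l).2 ω) *
      (∏ l : Fin 25 ×ₗ Fin M, Gw (ofLex l).1 (ofLex l).2 ω) =
      ∏ v, ∏ j, Gr j v ω * Gw j v ω := by
    intro ω
    rw [← Finset.prod_mul_distrib]
    exact prod_lex fun j v => Gr j v ω * Gw j v ω
  have h := C.mean_fails_le (R := R) A hM hp
  have hmul := mean_mul_left ((4 : ℝ) ^ 37)⁻¹ fun ω : Tape R M S K =>
    (∏ l : Fin 25 ×ₗ Fin M, Gr (ofLex l).1 (ofLex l).2 ω) *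
      ∏ l : Fin 25 ×ₗ Fin M, Gw (ofLex l).1 (ofLex l).2 ω
  calc prob _ ≤ mean (fun ω : Tape R M S K => ((4 : ℝ) ^ 37)⁻¹ *
        ((∏ l : Fin 25 ×ₗ Fin M, Gr (ofLex l).1 (ofLex l).2 ω) *
          ∏ l : Fin 25 ×ₗ Fin M, Gw (ofLex l).1 (ofLex l).2 ω)) := by
        apply prob_le_mean
        · intro ω
          rw [hprod]
          exact mul_nonneg (by positivity) (Finset.prod_nonneg fun v _ =>
            Finset.prod_nonneg fun j _ => zero_le_one.trans (hG1 j v ω))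
        · intro ω hω
          rw [hprod, inv_mul_eq_div, one_le_div (by positivity)]
          set F := (C.good ω.setup).filter fun v =>
            ∃ j, C.ReadFails A ω j v ∨ C.WriteFails A ω j v with hF
          calc (4 : ℝ) ^ 37 ≤ 4 ^ F.card := pow_le_pow_right₀ (by norm_num) hω
            _ = ∏ v, if v ∈ F then (4 : ℝ) else 1 := by
                rw [Finset.prod_ite_mem, Finset.univ_inter, Finset.prod_const]
            _ ≤ ∏ v, ∏ j, Gr j v ω * Gw j v ω := by
                apply Finset.prod_le_prod
                · intro v _; split_ifs <;> norm_num
                · intro v _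
                  have hrest : ∀ s : Finset (Fin 25), 1 ≤ ∏ j ∈ s, Gr j v ω * Gw j v ω := by
                    intro s
                    calc (1 : ℝ) = ∏ _j ∈ s, (1 : ℝ) := by simp
                      _ ≤ _ := Finset.prod_le_prod (fun _ _ => zero_le_one) fun j _ => hG1 j v ω
                  split_ifs with hv
                  · obtain ⟨j, hj⟩ := (Finset.mem_filter.mp hv).2
                    rw [← Finset.mul_prod_erase _ _ (Finset.mem_univ j)]
                    have h4 : 4 ≤ Gr j v ω * Gw j v ω := by
                      have h1 := hGr j v ω
                      have h2 := hGw j v ω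
                      rcases hj with hj | hj
                      · have : Gr j v ω = 4 := if_pos hj
                        rw [this]; linarith
                      · have : Gw j v ω = 4 := if_pos hj
                        rw [this]; linarith
                    calc (4 : ℝ) = 4 * 1 := by norm_num
                      _ ≤ _ := mul_le_mul h4 (hrest _) zero_le_one
                        (zero_le_one.trans (hG1 j v ω))
                  · exact hrest _
    _ ≤ Real.exp 29 / 4 ^ 37 := by
        rw [hmul, div_eq_inv_mul]
        exact mul_le_mul_of_nonneg_left h (by positivity)

end Count

/-! ## The size of the committee -/

section Size

variable {R M S : ℕ} {K V Tx D : Type*} [Finite K] (C : Config M S K V Tx D)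

theorem exp_neg_natCast_le (n : ℕ) : Real.exp (-n) ≤ (2.718 ^ n)⁻¹ := by
  rw [Real.exp_neg, ← mul_one (n : ℝ), Real.exp_nat_mul]
  gcongr
  linarith [Real.exp_one_gt_d9]

/-- Chernoff bound with t = 57/50: the event says g ≤ 2(n - g), so t^(2(n - g) - g) ≥ 1 on it. -/
theorem Config.prob_not_goodMajority_le (hM : 2000 ≤ M) (hc : 4 * C.corruptCitizens.card ≤ M)
    (hp : 5 * C.corruptPoliticians.card ≤ 4 * S) :
    prob (fun ω : Tape R M S K => ¬ C.GoodMajority ω.setup) ≤ 1 / 10 ^ 11 := by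
  have h := C.mean_good_bad_le (R := R) (K := K) hM hc hp (50 / 57) ((57 / 50) ^ 2) (by norm_num)
    (by norm_num)
  refine (prob_le_mean _ (fun ω => by positivity) fun ω hω => ?_).trans (h.trans ?_)
  · unfold Config.GoodMajority at hω
    have h1 : (C.good ω.setup).card ≤
        2 * (ω.setup.committee.card - (C.good ω.setup).card) := by omega
    rw [← pow_mul]
    calc (1 : ℝ) = (50 / 57) ^ (C.good ω.setup).card * (57 / 50) ^ (C.good ω.setup).card := by
          rw [← mul_pow]; norm_num
      _ ≤ _ := by
          gcongr
          norm_num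
  · calc _ ≤ Real.exp (-(31 : ℕ)) := by
          rw [Real.exp_le_exp]
          unfold weightRate
          norm_num
      _ ≤ _ := exp_neg_natCast_le 31
      _ ≤ _ := by norm_num

/-- Chernoff bound with t = 28/25: on the event 2g ≤ 1800 + (n - g), so t^1800 · t^((n - g) - 2g) ≥
1. The factor t^1800 is paid for by the small mean of the rest. -/
theorem Config.prob_few_good_le (hM : 2000 ≤ M) (hc : 4 * C.corruptCitizens.card ≤ M)
    (hp : 5 * C.corruptPoliticians.card ≤ 4 * S) :
    prob (fun ω : Tape R M S K =>
      3 * (C.good ω.setup).card < ω.setup.committee.card + 1800) ≤ 1 / 10 ^ 11 := by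
  have h := C.mean_good_bad_le (R := R) (K := K) hM hc hp ((28 / 25) ^ 2)⁻¹ (28 / 25)
    (by norm_num) (by norm_num)
  have h2 : (28 / 25 : ℝ) ^ 1800 ≤ Real.exp (1800 * (114 / 1000)) := by
    have : (28 / 25 : ℝ) ≤ Real.exp (114 / 1000) :=
      le_trans (by norm_num) (Real.quadratic_le_exp_of_nonneg (by norm_num))
    calc _ ≤ Real.exp (114 / 1000) ^ 1800 := pow_le_pow_left₀ (by norm_num) this _
      _ = _ := by rw [← Real.exp_nat_mul]; norm_num
  have h3 := mean_mul_left ((28 / 25 : ℝ) ^ 1800) fun ω : Tape R M S K =>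
    (((28 / 25 : ℝ) ^ 2)⁻¹) ^ (C.good ω.setup).card *
      (28 / 25 : ℝ) ^ (ω.setup.committee.card - (C.good ω.setup).card)
  refine (prob_le_mean (fun ω => (28 / 25 : ℝ) ^ 1800 *
    ((((28 / 25 : ℝ) ^ 2)⁻¹) ^ (C.good ω.setup).card *
      (28 / 25 : ℝ) ^ (ω.setup.committee.card - (C.good ω.setup).card)))
      (fun ω => by positivity) fun ω hω => ?_).trans (h3.le.trans ?_)
  · have h1 : 2 * (C.good ω.setup).card ≤
        1800 + (ω.setup.committee.card - (C.good ω.setup).card) := by omega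
    rw [mul_left_comm, ← pow_add, inv_pow, ← pow_mul, inv_mul_eq_div,
      one_le_div (by positivity)]
    exact pow_le_pow_right₀ (by norm_num) h1
  · calc _ ≤ Real.exp (1800 * (114 / 1000)) *
          Real.exp (2000 * weightRate ((28 / 25) ^ 2)⁻¹ (28 / 25)) :=
          mul_le_mul h2 h (mean_nonneg fun ω => by positivity) (Real.exp_pos _).le
      _ ≤ Real.exp (-(31 : ℕ)) := by
          rw [← Real.exp_add, Real.exp_le_exp]
          unfold weightRate
          norm_num
      _ ≤ _ := exp_neg_natCast_le 31
      _ ≤ _ := by norm_num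

/-- The mean of 2^n is at most e^2000, so Markov's inequality gives (e/4)^2000. -/
theorem Config.prob_large_le (hM : 2000 ≤ M) (hc : 4 * C.corruptCitizens.card ≤ M)
    (hp : 5 * C.corruptPoliticians.card ≤ 4 * S) :
    prob (fun ω : Tape R M S K => 4000 < ω.setup.committee.card) ≤ 1 / 10 ^ 11 := by
  have h := C.mean_good_bad_le (R := R) (K := K) hM hc hp 2 2 (by norm_num) le_rfl
  have h3 := mean_mul_left ((2 : ℝ) ^ 4000)⁻¹ fun ω : Tape R M S K =>
    (2 : ℝ) ^ (C.good ω.setup).card *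
      2 ^ (ω.setup.committee.card - (C.good ω.setup).card)
  refine (prob_le_mean (fun ω => ((2 : ℝ) ^ 4000)⁻¹ * (2 ^ (C.good ω.setup).card *
      2 ^ (ω.setup.committee.card - (C.good ω.setup).card)))
      (fun ω => by positivity) fun ω hω => ?_).trans (h3.le.trans ?_)
  · have := Finset.card_le_card (C.good_subset ω.setup)
    rw [← pow_add, Nat.add_sub_cancel' this, inv_mul_eq_div, one_le_div (by positivity)]
    exact pow_le_pow_right₀ (by norm_num) hω.le
  · have hw : weightRate 2 2 = 1 := by unfold weightRate; norm_num
    have he : Real.exp 1 / 4 ≤ 7 / 10 := by linarith [Real.exp_one_lt_d9]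
    have he0 : 0 ≤ Real.exp 1 / 4 := by positivity
    calc _ ≤ ((2 : ℝ) ^ 4000)⁻¹ * Real.exp (2000 * weightRate 2 2) := by gcongr
      _ = (Real.exp 1 / 4) ^ 2000 := by
          rw [hw, div_pow, ← Real.exp_nat_mul, show (4 : ℝ) = 2 ^ 2 by norm_num, ← pow_mul,
            inv_mul_eq_div]
          norm_num
      _ ≤ (Real.exp 1 / 4) ^ 100 := pow_le_pow_of_le_one he0 (by linarith) (by norm_num)
      _ ≤ (7 / 10) ^ 100 := by gcongr
      _ ≤ _ := by norm_num

end Size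

end Blockene

/-! ### The union bound -/

theorem mainTheorem5 :
    ∃ R₀ : ℕ, ∀ R : ℕ, R₀ ≤ R →
      ∀ (M S : ℕ) (K V Tx D : Type) [Fintype K]
        (C : Blockene.Config M S K V Tx D) (A : Blockene.Adversary R M S K V Tx D),
        2000 ≤ M →
        4 * C.corruptCitizens.card ≤ M →
        5 * C.corruptPoliticians.card ≤ 4 * S →
        C.IsLedger C.chain C.state →
        Blockene.prob (fun ω => ¬ C.BlockConsensus A ω ∧ ¬ C.Collision A ω) ≤ (2 : ℝ)⁻¹ ^ 30 := by
  classical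
  have hV : (0 : ℝ) < (Fintype.card Blockene.Vrf : ℝ)⁻¹ :=
    inv_pos.mpr (by exact_mod_cast Fintype.card_pos)
  have hV1 : (Fintype.card Blockene.Vrf : ℝ)⁻¹ ≤ 1 :=
    inv_le_one_of_one_le₀ (by exact_mod_cast Fintype.card_pos)
  have hδ0 := pow_pos hV 4000
  have hδ1 := pow_le_one₀ hV.le hV1 (n := 4000)
  generalize hδ : ((Fintype.card Blockene.Vrf : ℝ)⁻¹) ^ 4000 = δ at hδ0 hδ1
  -- `δ` depends only on the size of the VRF range, so the number of phases is an absolute constant.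
  obtain ⟨n, hn⟩ := exists_pow_lt_of_lt_one (by norm_num : (0 : ℝ) < 1 / 10 ^ 11)
    (by linarith : 1 - δ < 1)
  refine ⟨n + 1, fun R hR M S K V Tx D _ C A hM hc hp hC => ?_⟩
  have hunlucky := C.prob_unlucky_le A
  rw [hδ] at hunlucky
  have hpow : (1 - δ) ^ (R - 1) ≤ 1 / 10 ^ 11 :=
    (pow_le_pow_of_le_one (by linarith) (by linarith) (by omega)).trans hn.le
  -- With 601 = 1 + 3 · 200, only a 200th power has to be evaluated and then rounded.
  have hstored : (45 : ℝ) * (43 / 45) ^ 601 ≤ 1 / 10 ^ 10 := by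
    have h200 : (43 / 45 : ℝ) ^ 200 ≤ 113 / 10 ^ 6 := by norm_num
    calc (45 : ℝ) * (43 / 45) ^ 601 = 45 * (43 / 45) * ((43 / 45) ^ 200) ^ 3 := by
          rw [← pow_mul, mul_assoc, ← pow_succ']
      _ ≤ 45 * (43 / 45) * (113 / 10 ^ 6) ^ 3 := by gcongr
      _ ≤ _ := by norm_num
  let E₁ : Blockene.Tape R M S K → Prop := fun ω => ¬ C.GoodMajority ω.setup
  let E₂ : Blockene.Tape R M S K → Prop := fun ω =>
    3 * (C.good ω.setup).card < ω.setup.committee.card + 1800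
  let E₃ : Blockene.Tape R M S K → Prop := fun ω => 4000 < ω.setup.committee.card
  let E₄ : Blockene.Tape R M S K → Prop := fun ω => ω.setup.committee.card ≤ 4000 ∧
    ∀ r : Fin R, (r : ℕ) + 1 < R → ¬ C.Lucky A ω r
  let E₅ : Blockene.Tape R M S K → Prop := fun ω => C.GoodMajority ω.setup ∧
    ω.setup.committee.card + 1800 ≤ 3 * (C.good ω.setup).card ∧
    ∃ p, 3 * (C.good ω.setup).card <
      3 * (C.supporters A ω (some p)).card + ω.setup.committee.card ∧ ¬ C.Stored A ω p
  let E₆ : Blockene.Tape R M S K → Prop := fun ω =>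
    36 < ((C.good ω.setup).filter fun v =>
      ∃ j, C.ReadFails A ω j v ∨ C.WriteFails A ω j v).card
  -- The committee bounds `E₁`, `E₂`, `E₃` are separate events, so that luck and storage may be
  -- estimated under their complements, as `E₄` and `E₅` do.
  have hsub : ∀ ω, (¬ C.BlockConsensus A ω ∧ ¬ C.Collision A ω) →
      E₁ ω ∨ E₂ ω ∨ E₃ ω ∨ E₄ ω ∨ E₅ ω ∨ E₆ ω := by
    rintro ω ⟨h1, h2⟩
    by_contra! hn
    obtain ⟨n1, n2, n3, n4, n5, n6⟩ := hn
    simp only [E₁, E₂, E₃, E₄, E₅, E₆, not_not, not_lt, not_and] at n1 n2 n3 n4 n5 n6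
    have hl := n4 n3
    push Not at hl
    refine h1 (n1.blockConsensus hC h2 hl (fun p hp => ?_) n6)
    by_contra hst
    exact n5 n1 n2 ⟨p, hp, hst⟩
  have b1 : Blockene.prob E₁ ≤ 1 / 10 ^ 11 := C.prob_not_goodMajority_le hM hc hp
  have b2 : Blockene.prob E₂ ≤ 1 / 10 ^ 11 := C.prob_few_good_le hM hc hp
  have b3 : Blockene.prob E₃ ≤ 1 / 10 ^ 11 := C.prob_large_le hM hc hp
  have b4 : Blockene.prob E₄ ≤ 1 / 10 ^ 11 := hunlucky.trans hpow
  have b5 : Blockene.prob E₅ ≤ 1 / 10 ^ 10 :=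
    (C.prob_not_stored_le A hp).trans hstored
  have b6 : Blockene.prob E₆ ≤ 3 / 10 ^ 10 := by
    refine (C.prob_fails_le A hM hp).trans ?_
    have he : Real.exp 29 ≤ 2.7183 ^ 29 := by
      rw [show (29 : ℝ) = (29 : ℕ) * 1 by norm_num, Real.exp_nat_mul]
      gcongr
      linarith [Real.exp_one_lt_d9]
    calc Real.exp 29 / 4 ^ 37 ≤ 2.7183 ^ 29 / 4 ^ 37 := by gcongr
      _ ≤ _ := by norm_num
  have hu := (Blockene.prob_mono hsub).trans (Blockene.prob_or_le E₁ _)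
  have hu2 := Blockene.prob_or_le E₂ fun ω => E₃ ω ∨ E₄ ω ∨ E₅ ω ∨ E₆ ω
  have hu3 := Blockene.prob_or_le E₃ fun ω => E₄ ω ∨ E₅ ω ∨ E₆ ω
  have hu4 := Blockene.prob_or_le E₄ fun ω => E₅ ω ∨ E₆ ω
  have hu5 := Blockene.prob_or_le E₅ E₆
  -- The sum is 4.4 · 10⁻¹⁰, while 2⁻³⁰ exceeds 9.3 · 10⁻¹⁰.
  have hfin : (1 / 10 ^ 11 + 1 / 10 ^ 11 + 1 / 10 ^ 11 + 1 / 10 ^ 11 + 1 / 10 ^ 10 +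
    3 / 10 ^ 10 : ℝ) ≤ (2 : ℝ)⁻¹ ^ 30 := by norm_num
  linarith
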